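/- Work in dimension one. Write $q$ for multiplication by $x$, $p=-i\,d/dx$, $\Delta=p^2$, $\langle x\rangle=\sqrt{1+x^2}$, $\hat f(\xi)=(2\pi)^{-1/2}\int e^{-ix\xi}f(x)\,dx$ (extended to tempered distributions by duality), $\mathcal H^s$ for the Sobolev spaces on $\mathbb R$ ($\mathcal H^1$ with norm $\|f\|_1^2=\int |f|^2+|f'|^2$), and $\mathcal H^{-1}$ for the adjoint space of $\mathcal H^1$. For $u\in C^\infty(\mathbb R,\mathbb R)$ with all derivatives of order $\ge 1$ bounded, let $A_u=\frac12(u(p)q+q\,u(p))$ be the self-adjoint operator in $L^2(\mathbb R)$ obtained as the closure from $C_c^\infty(\mathbb R)$, and let $A_D=\frac12(pq+qp)$ be the case $u(x)=x$. Let $\mathcal U$ be the set of $u\in C^\infty(\mathbb R,\mathbb R)$ that are bounded with all derivatives bounded and satisfy $x\,u(x)>0$ for all $x\neq0$. For a bounded operator $T:\mathcal H^1\to\mathcal H^{-1}$ and $A=A_u$ or $A=A_D$ put $T_\tau=e^{i\tau A}Te^{-i\tau A}$; $T$ is of class $C^1(A,\mathcal H^1,\mathcal H^{-1})$ if $\tau\mapsto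 T_\tau f\in\mathcal H^{-1}$ is $C^1$ for every $f\in\mathcal H^1$, and of class $C^{1,1}(A,\mathcal H^1,\mathcal H^{-1})$ if $\int_0^1\|T_\tau+T_{-\tau}-2T\|_{B(\mathcal H^1,\mathcal H^{-1})}\,\frac{d\tau}{\tau^2}<\infty$. Let $\chi\in C^1(\mathbb R,\mathbb R)$ be even with $\chi(x)>0$ for $|x|<1$ and $\chi(x)=0$ for $|x|>1$. Let $(\lambda_n)_{n\in\mathbb Z}$ be an unbounded sequence of real numbers with $\lambda_{-n}=\lambda_n\ge0$, $\lambda_0=0$, and $\sum_{n\in\mathbb Z}\lambda_n\langle n\rangle^{-1/2+\varepsilon}<\infty$ for some $0<\varepsilon<1/2$. Consider tempered distributions $V$ on $\mathbb R$ with $$\widehat{qV}(\xi)=\sum_{n\in\mathbb Z}\lambda_n\,\chi(\xi-n).$$ This equation fixes $V$ up to a multiple of the Dirac measure at $0$, i.e. fixes the function $\hat V$, which is continuous, up to an additive constant; the constant is taken such that $\hat V(0)\in\mathbb R$. Such $V$ exist, and for each of them multiplication by $V$ extends from Schwartz functions to a bounded operator $V:\mathcal H^1\to\mathcal H^{-1}$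 such that: 1. $V$ is symmetric and $V:\mathcal H^1\to\mathcal H^{-1}$ is compact; 2. $V\in C^{1,1}(A_u,\mathcal H^1,\mathcal H^{-1})$ for all $u\in\mathcal U$; 3. $V\notin C^1(A_D,\mathcal H^1,\mathcal H^{-1})$; 4. $V$ is not $\Delta$-bounded: there are no constants $a,b$ such that for all $f\in\mathcal H^2$ one has $Vf\in L^2$ and $\|Vf\|\le a\|\Delta f\|+b\|f\|$. -/

import Mathlib

open MeasureTheory FourierTransform
open scoped SchwartzMap ContDiff InnerProductSpace ENNReal

noncomputable section

namespace NakReg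

/-- The Hilbert space `L²(ℝ)`. -/
abbrev L2 : Type := Lp ℂ 2 (volume : Measure ℝ)

/-! ### The Sobolev space `ℋ¹`, its adjoint space `ℋ⁻¹` -/

/-- `k` is the weak (distributional) derivative of `h`, both in `L²(ℝ)`. -/
def IsWeakDeriv (h k : L2) : Prop :=
  TemperedDistribution.derivCLM ℂ (Lp.toTemperedDistribution h) = Lp.toTemperedDistribution k

/-- The Sobolev space `ℋ¹(ℝ)`, realised as the set of pairs `(f, f')` in `L² × L²` with `f'` the
weak derivative of `f`; its norm is `‖f‖₁² = ∫ |f|² + |f'|²`. -/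
def sobolevH1 : Submodule ℂ (WithLp 2 (L2 × L2)) where
  carrier := {p | IsWeakDeriv p.fst p.snd}
  zero_mem' := by
    simp [IsWeakDeriv, ← Lp.toTemperedDistributionCLM_apply]
  add_mem' := by
    intro a b ha hb
    have h : ∀ x y : L2, Lp.toTemperedDistribution (x + y) =
        Lp.toTemperedDistribution x + Lp.toTemperedDistribution y :=
      map_add (Lp.toTemperedDistributionCLM ℂ volume 2)
    change IsWeakDeriv (a.fst + b.fst) (a.snd + b.snd)
    unfold IsWeakDeriv
    rw [h, h, map_add, ha, hb]
  smul_mem' := by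
    intro c a ha
    have h : ∀ x : L2, Lp.toTemperedDistribution (c • x) = c • Lp.toTemperedDistribution x :=
      map_smul (Lp.toTemperedDistributionCLM ℂ volume 2) c
    change IsWeakDeriv (c • a.fst) (c • a.snd)
    unfold IsWeakDeriv
    rw [h, h, map_smul, ha]

/-- The Hilbert space `ℋ¹(ℝ)`. -/
def H1 : Type := sobolevH1

instance : NormedAddCommGroup H1 := inferInstanceAs (NormedAddCommGroup sobolevH1)

instance : InnerProductSpace ℂ H1 := inferInstanceAs (InnerProductSpace ℂ sobolevH1)

/-- The function in `L²` underlying an element of `ℋ¹`. -/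
def fn (f : H1) : L2 := (Subtype.val f).fst

/-- The weak derivative of an element of `ℋ¹`. -/
def weakDeriv (f : H1) : L2 := (Subtype.val f).snd

theorem H1.norm_sq (f : H1) : ‖f‖ ^ 2 = ‖fn f‖ ^ 2 + ‖weakDeriv f‖ ^ 2 :=
  WithLp.prod_norm_sq_eq_of_L2 (Subtype.val f)

/-- The adjoint space `ℋ⁻¹` of `ℋ¹`: continuous antilinear functionals with the dual norm. A
function `h` in `L²` is identified with the functional `g ↦ ⟪g, h⟫`. -/
abbrev Hm1 : Type := H1 →L⋆[ℂ] ℂ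

/-- A Schwartz function as an element of `L²`. -/
def toL2 : 𝓢(ℝ, ℂ) →L[ℂ] L2 := SchwartzMap.toLpCLM ℂ ℂ 2 volume

theorem schwartz_isWeakDeriv (φ : 𝓢(ℝ, ℂ)) :
    IsWeakDeriv (φ.toLp 2 volume) ((SchwartzMap.derivCLM ℂ ℂ φ).toLp 2 volume) := by
  unfold IsWeakDeriv
  rw [Lp.toTemperedDistribution_toLp_eq, Lp.toTemperedDistribution_toLp_eq]
  exact TemperedDistribution.derivCLM_toTemperedDistributionCLM_eq (𝕜 := ℂ) φ

/-- A Schwartz function as an element of `ℋ¹`. -/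
def toH1 (φ : 𝓢(ℝ, ℂ)) : H1 :=
  ⟨WithLp.toLp 2 (φ.toLp 2 volume, (SchwartzMap.derivCLM ℂ ℂ φ).toLp 2 volume), by
    change IsWeakDeriv _ _
    exact schwartz_isWeakDeriv φ⟩

/-! ### Fourier transform, multiplication by `q`, functions of `p` -/

/-- Fourier transform of a Schwartz function in the normalisation
`φ̂(ξ) = (2π)^(-1/2) ∫ exp(-i x ξ) φ(x) dx`. -/
def fourierS : 𝓢(ℝ, ℂ) →L[ℂ] 𝓢(ℝ, ℂ) :=
  ((Real.sqrt (2 * Real.pi))⁻¹ : ℂ) •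
    ((SchwartzMap.compCLMOfContinuousLinearEquiv ℂ
      (ContinuousLinearEquiv.unitsEquivAut ℝ
        (Units.mk0 (2 * Real.pi)⁻¹ (inv_ne_zero Real.two_pi_pos.ne')))).comp
      (FourierTransform.fourierCLM ℂ 𝓢(ℝ, ℂ)))

theorem fourierS_apply (φ : 𝓢(ℝ, ℂ)) (ξ : ℝ) :
    fourierS φ ξ = ((Real.sqrt (2 * Real.pi))⁻¹ : ℂ) *
      ∫ x : ℝ, Complex.exp (-(Complex.I * x * ξ)) * φ x := by
  have h : fourierS φ ξ = ((Real.sqrt (2 * Real.pi))⁻¹ : ℂ) *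
      (𝓕 φ) (ξ * (2 * Real.pi)⁻¹) := rfl
  rw [h, SchwartzMap.fourier_coe, Real.fourier_real_eq_integral_exp_smul]
  congr 2
  ext x
  rw [smul_eq_mul]
  congr 2
  push_cast
  have : (Real.pi : ℂ) ≠ 0 := by exact_mod_cast Real.pi_ne_zero
  field_simp

/-- The Fourier transform of the tempered distribution `V`, defined by duality
`⟨V̂, φ⟩ = ⟨V, φ̂⟩`, is the (locally integrable, tempered) function `F`. -/
def HasFourierTransform (V : 𝓢'(ℝ, ℂ)) (F : ℝ → ℂ) : Prop :=
  ∀ φ : 𝓢(ℝ, ℂ), Integrable (fun ξ : ℝ => F ξ * φ ξ) ∧ V (fourierS φ) = ∫ ξ : ℝ, F ξ * φ ξ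

/-- The tempered distribution `qV`. -/
def mulQ (V : 𝓢'(ℝ, ℂ)) : 𝓢'(ℝ, ℂ) :=
  TemperedDistribution.smulLeftCLM ℂ (fun x : ℝ => (x : ℂ)) V

/-- Multiplication by `x` on Schwartz functions. -/
def opQ : 𝓢(ℝ, ℂ) →L[ℂ] 𝓢(ℝ, ℂ) := SchwartzMap.smulLeftCLM ℂ (fun x : ℝ => (x : ℂ))

/-- The operator `u(p)`, `p = -i d/dx`, on Schwartz functions, for `u` smooth of temperate growth.
The factor `2π` converts Mathlib's frequency variable into the spectral variable of `p`. -/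
def opP (u : ℝ → ℝ) : 𝓢(ℝ, ℂ) →L[ℂ] 𝓢(ℝ, ℂ) :=
  SchwartzMap.fourierMultiplierCLM ℂ (fun x : ℝ => (u (2 * Real.pi * x) : ℂ))

/-! ### The conjugate operators `A_u` -/

/-- The test functions `C_c^∞(ℝ)` inside the Schwartz space. -/
def testFunctions : Submodule ℂ 𝓢(ℝ, ℂ) where
  carrier := {φ | HasCompactSupport φ}
  zero_mem' := by
    change HasCompactSupport (fun _ : ℝ => (0 : ℂ))
    exact HasCompactSupport.zero
  add_mem' := by
    intro a b ha hb
    exact HasCompactSupport.add (f := (a : ℝ → ℂ)) (f' := (b : ℝ → ℂ)) ha hb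
  smul_mem' := by
    intro c a ha
    exact HasCompactSupport.smul_left (f := fun _ : ℝ => c) (f' := (a : ℝ → ℂ)) ha

/-- `C_c^∞(ℝ) → L²(ℝ)`. -/
def testToL2 : testFunctions →ₗ[ℂ] L2 := toL2.toLinearMap ∘ₗ testFunctions.subtype

theorem testToL2_injective : Function.Injective testToL2 := by
  intro a b h
  exact Subtype.ext (SchwartzMap.injective_toLp (E := ℝ) (F := ℂ) 2 volume h)

/-- The unbounded operator in `L²` with domain `C_c^∞(ℝ)` acting there as `S`. -/
def minimalOp (S : 𝓢(ℝ, ℂ) →L[ℂ] 𝓢(ℝ, ℂ)) : L2 →ₗ.[ℂ] L2 where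
  domain := LinearMap.range testToL2
  toFun := toL2.toLinearMap ∘ₗ S.toLinearMap ∘ₗ testFunctions.subtype ∘ₗ
    (LinearEquiv.ofInjective testToL2 testToL2_injective).symm.toLinearMap

/-- `A_u = ½ (u(p) q + q u(p))`: the closure of this operator defined on `C_c^∞(ℝ)`. -/
def conjOp (u : ℝ → ℝ) : L2 →ₗ.[ℂ] L2 :=
  (minimalOp ((1 / 2 : ℂ) • ((opP u).comp opQ + opQ.comp (opP u)))).closure

/-- The generator of dilations `A_D = ½ (p q + q p)`. -/
def dilationOp : L2 →ₗ.[ℂ] L2 := conjOp (fun x => x)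

/-- The class `𝒰` of bounded smooth vector fields on `ℝ`, all of whose derivatives are bounded,
with `x u(x) > 0` for `x ≠ 0`. -/
def IsAdmissible (u : ℝ → ℝ) : Prop :=
  ContDiff ℝ ∞ u ∧ (∀ k : ℕ, ∃ C : ℝ, ∀ x, |iteratedDeriv k u x| ≤ C) ∧ ∀ x, x ≠ 0 → 0 < x * u x

/-! ### The unitary group `exp(iτA)` and its action on `ℋ¹` and `ℋ⁻¹` -/

/-- `U` is a strongly continuous one-parameter unitary group with `d/dτ U(τ)f = i A f` at `τ = 0`
for `f` in the domain of `A`. If `A` is self-adjoint, exactly one `U` has this property, namely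
`U(τ) = exp(iτA)` (a self-adjoint operator has no proper symmetric extension). -/
structure IsUnitaryGroup (A : L2 →ₗ.[ℂ] L2) (U : ℝ → L2 →L[ℂ] L2) : Prop where
  unitary : ∀ τ, U τ ∈ unitary (L2 →L[ℂ] L2)
  zero : U 0 = 1
  add : ∀ σ τ, U (σ + τ) = U σ * U τ
  continuous : ∀ f, Continuous fun τ => U τ f
  generator : ∀ f : A.domain, HasDerivAt (fun τ => U τ (f : L2)) (Complex.I • A f) 0

open Classical in
/-- The unitary group `exp(iτA)` of a self-adjoint operator `A` in `L²`. -/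
def expI (A : L2 →ₗ.[ℂ] L2) : ℝ → L2 →L[ℂ] L2 :=
  if h : ∃ U, IsUnitaryGroup A U then h.choose else 0

open Classical in
/-- The restriction to `ℋ¹` of a bounded operator of `L²` that leaves `ℋ¹` invariant. -/
def restrictH1 (S : L2 →L[ℂ] L2) : H1 →L[ℂ] H1 :=
  if h : ∃ W : H1 →L[ℂ] H1, ∀ f, fn (W f) = S (fn f) then h.choose else 0

/-- `exp(iτA)` acting in `ℋ¹`. -/
def expH1 (A : L2 →ₗ.[ℂ] L2) (τ : ℝ) : H1 →L[ℂ] H1 := restrictH1 (expI A τ)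

/-- `exp(iτA)` acting in `ℋ⁻¹`, the adjoint of `exp(-iτA)` acting in `ℋ¹`. -/
def expHm1 (A : L2 →ₗ.[ℂ] L2) (τ : ℝ) : Hm1 →L[ℂ] Hm1 :=
  (ContinuousLinearMap.compSL H1 H1 ℂ (RingHom.id ℂ) (starRingEnd ℂ)).flip (expH1 A (-τ))

/-- `T_τ = exp(iτA) T exp(-iτA)`. -/
def evolve (A : L2 →ₗ.[ℂ] L2) (T : H1 →L[ℂ] Hm1) (τ : ℝ) : H1 →L[ℂ] Hm1 :=
  (expHm1 A τ).comp (T.comp (expH1 A (-τ)))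

/-- `T ∈ C¹(A, ℋ¹, ℋ⁻¹)`: for each `f` in `ℋ¹` the map `τ ↦ T_τ f` is of class `C¹`. -/
def IsC1 (A : L2 →ₗ.[ℂ] L2) (T : H1 →L[ℂ] Hm1) : Prop :=
  ∀ f : H1, ContDiff ℝ 1 fun τ : ℝ => evolve A T τ f

/-- `T ∈ C^{1,1}(A, ℋ¹, ℋ⁻¹)`: `∫₀¹ ‖T_τ + T_{-τ} - 2T‖ dτ / τ² < ∞`. -/
def IsC11 (A : L2 →ₗ.[ℂ] L2) (T : H1 →L[ℂ] Hm1) : Prop :=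
  ∫⁻ τ in Set.Ioc (0 : ℝ) 1,
    ‖evolve A T τ + evolve A T (-τ) - (2 : ℂ) • T‖ₑ / ENNReal.ofReal (τ ^ 2) < ⊤

/-! ### Potentials as operators `ℋ¹ → ℋ⁻¹` -/

/-- The Schwartz function `x ↦ conj (ψ x) * φ x`. -/
def conjMul (ψ φ : 𝓢(ℝ, ℂ)) : 𝓢(ℝ, ℂ) :=
  SchwartzMap.pairing (ContinuousLinearMap.mul ℂ ℂ)
    (ψ.postcompCLM (Complex.conjCLE : ℂ →L[ℝ] ℂ)) φ

/-- `T` is the continuous extension `ℋ¹ → ℋ⁻¹` of the operator of multiplication by the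
distribution `V`: `(ψ, T φ) = ⟨V, conj(ψ) φ⟩`. It is unique, Schwartz functions being dense. -/
def IsMultiplicationBy (V : 𝓢'(ℝ, ℂ)) (T : H1 →L[ℂ] Hm1) : Prop :=
  ∀ φ ψ : 𝓢(ℝ, ℂ), T (toH1 φ) (toH1 ψ) = V (conjMul ψ φ)

/-- `T : ℋ¹ → ℋ⁻¹` is symmetric: `(g, T f) = conj (f, T g)`. -/
def IsSymm (T : H1 →L[ℂ] Hm1) : Prop :=
  ∀ f g : H1, T f g = starRingEnd ℂ (T g f)

/-- `T` is `Δ`-bounded: for `f` in `ℋ²` (that is, `f ∈ ℋ¹` whose second weak derivative `k` is in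
`L²`), `T f` is in `L²` and `‖T f‖ ≤ a ‖Δf‖ + b ‖f‖`. -/
def IsLaplacianBounded (T : H1 →L[ℂ] Hm1) : Prop :=
  ∃ a b : ℝ, ∀ (f : H1) (k : L2), IsWeakDeriv (weakDeriv f) k →
    ∃ h : L2, (∀ g : H1, T f g = ⟪fn g, h⟫_ℂ) ∧ ‖h‖ ≤ a * ‖k‖ + b * ‖fn f‖

/-- The function `ξ ↦ ∑ₙ λₙ χ(ξ - n)`, `n ∈ ℤ`; for compactly supported `χ` the sum is finite at
each point. -/
def bumpSum (χ : ℝ → ℝ) (lam : ℤ → ℝ) (ξ : ℝ) : ℂ :=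
  ((∑' n : ℤ, lam n * χ (ξ - n) : ℝ) : ℂ)

/-- `V` is a tempered distribution whose product with `x` has Fourier transform
`∑ₙ λₙ χ(ξ - n)`. This equation determines `V` up to a multiple `c δ₀` of the Dirac measure, that
is, up to an additive constant in the continuous function `V̂`; the constant is only required to be
such that `V̂(0)` is real. -/
def IsPotential (χ : ℝ → ℝ) (lam : ℤ → ℝ) (V : 𝓢'(ℝ, ℂ)) : Prop :=
  HasFourierTransform (mulQ V) (bumpSum χ lam) ∧
    ∃ v : ℝ → ℂ, Continuous v ∧ HasFourierTransform V v ∧ (v 0).im = 0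

end NakReg

end

noncomputable section

namespace NakReg

open Set Filter Topology

/-! ### Elementary calculus -/

/-! On the Fourier side multiplication by `x` becomes `i d/dξ`, so the equation for `qV` says that
`V̂` equals `c - i ∫₀^ξ ∑ₙ λₙ χ(η - n) dη` with `c` real (`exists_potFun`). Multiplication by `V` is
then the integral operator with kernel `w(k - l)`, where `w` is `V̂` up to scaling
(`isMultiplicationBy_op`). As `χ` and `λ` are even, `w(-k)` is the conjugate of `w(k)`, hence the
symmetry. Put `s = 1/2 - ε`. Summability of `λₙ ⟨n⟩^(-s)` makes `w`, `w'` and `w''` all of size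
`O((1 + |k|)^s)`: integration costs no power, because each bump has fixed mass, and one derivative
of `χ` suffices for `w''` (`exists_isSymbol`).

Since `s < 1/2`, the weight `(1 + |k|)^s` divided by the symbol of `1 + d/dx` is square integrable.
A continuous kernel dominated by `C (1 + |k|)^s (1 + |l|)^s` is therefore Hilbert–Schmidt relative
to `ℋ¹`. It is compact, and its norm is at most a constant times `C` (`IsKernel.norm_le`,
`IsKernel.isCompactOperator_op`).

The group `exp(iτA_u)` acts on Fourier transforms as composition with the flow of the rescaled field
at time `-τ`, weighted by the square root of the Jacobian. The definition of `expI` involves a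
choice, which an invariant core removes (`expI_conjOp`). So `V_τ` again has an explicit kernel
(`evolve_op`). For bounded `u`, two `τ`-derivatives of this kernel produce only `w`, `w'`, `w''`
with bounded coefficients. Hence the second difference is `O(τ²)` in norm and the `C^{1,1}`
integrand is bounded (`exists_second_difference_bound`, `isC11`).

For dilations the kernel is `e^(-τ) w(e^(-τ)(k - l))`, whose derivative contains `ξ w'(ξ)`, of size
`n λₙ` near `ξ = n`. Tested on a packet at frequency `0` and one at frequency `n`, whose `ℋ¹` norm
is of order `n`, a `C¹` property would bound `λₙ` (`not_isC1`). Finally `V̂` does not decay, as its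
imaginary part is monotone and not zero. So `V` applied to a fixed packet has matrix elements
bounded away from zero against packets that tend weakly to zero, and cannot lie in `L²`
(`not_isLaplacianBounded`). -/

/-- A first order remainder is controlled by a bound on the second derivative. -/
theorem taylor_one_bound {F : Type*} [NormedAddCommGroup F] [NormedSpace ℝ F] {f f' f'' : ℝ → F}
    {a b M : ℝ} (hf : ∀ s ∈ uIcc a b, HasDerivAt f (f' s) s)
    (hf' : ∀ s ∈ uIcc a b, HasDerivAt f' (f'' s) s) (hM : ∀ s ∈ uIcc a b, ‖f'' s‖ ≤ M) :
    ‖f b - f a - (b - a) • f' a‖ ≤ M * (b - a) ^ 2 := by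
  have h1 : ∀ s ∈ uIcc a b, ‖f' s - f' a‖ ≤ M * ‖s - a‖ := fun s hs =>
    (convex_uIcc a b).norm_image_sub_le_of_norm_hasDerivWithin_le
      (fun x hx => (hf' x hx).hasDerivWithinAt) hM left_mem_uIcc hs
  have hM0 : 0 ≤ M := (norm_nonneg _).trans (hM a left_mem_uIcc)
  have h2 : ∀ s ∈ uIcc a b, HasDerivAt (fun s => f s - (s - a) • f' a) (f' s - f' a) s := by
    intro s hs
    have h3 : HasDerivAt (fun s => (s - a) • f' a) ((1 : ℝ) • f' a) s :=
      ((hasDerivAt_id s).sub_const a).smul_const (f' a)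
    simpa using! (hf s hs).sub h3
  have h4 := (convex_uIcc a b).norm_image_sub_le_of_norm_hasDerivWithin_le
      (C := M * |b - a|) (fun x hx => (h2 x hx).hasDerivWithinAt)
      (fun x hx => (h1 x hx).trans
        (mul_le_mul_of_nonneg_left (abs_sub_left_of_mem_uIcc hx) hM0)) left_mem_uIcc right_mem_uIcc
  have h5 : (fun s => f s - (s - a) • f' a) b - (fun s => f s - (s - a) • f' a) a
      = f b - f a - (b - a) • f' a := by
    simp; abel
  rw [h5, Real.norm_eq_abs, mul_assoc, ← sq, sq_abs] at h4
  exact h4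

/-- A bound on the second difference quotient. -/
theorem second_difference_bound {F : Type*} [NormedAddCommGroup F] [NormedSpace ℝ F]
    {f f' f'' : ℝ → F} {M r t : ℝ} (hf : ∀ s, HasDerivAt f (f' s) s)
    (hf' : ∀ s, HasDerivAt f' (f'' s) s) (hM : ∀ s, |s| ≤ r → ‖f'' s‖ ≤ M) (ht : |t| ≤ r) :
    ‖f t + f (-t) - (2 : ℝ) • f 0‖ ≤ 2 * M * t ^ 2 := by
  have key : ∀ t, |t| ≤ r → ‖f t - f 0 - t • f' 0‖ ≤ M * t ^ 2 := by
    intro t ht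
    have := taylor_one_bound (a := 0) (b := t) (fun s _ => hf s) (fun s _ => hf' s)
      (fun s hs => hM s (by
        have := abs_sub_left_of_mem_uIcc hs
        simp only [sub_zero] at this
        exact this.trans ht))
    simpa using this
  have e : f t + f (-t) - (2 : ℝ) • f 0
      = (f t - f 0 - t • f' 0) + (f (-t) - f 0 - (-t) • f' 0) := by
    rw [two_smul, neg_smul]; abel
  rw [e]
  refine (norm_add_le _ _).trans ?_
  have h1 := key t ht
  have h2 := key (-t) (by rwa [abs_neg])
  rw [neg_sq] at h2
  linarith

/-- A quadratic remainder is what comparing trajectories delivers; this converts it into spatial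
differentiability of the flow. -/
theorem hasDerivAt_of_quadratic_bound {f : ℝ → ℝ} {f' C x : ℝ}
    (h : ∀ y, |f y - f x - f' * (y - x)| ≤ C * (y - x) ^ 2) : HasDerivAt f f' x := by
  rw [hasDerivAt_iff_isLittleO]
  have h1 : (fun y => f y - f x - (y - x) • f') =O[𝓝 x] fun y => (y - x) ^ 2 :=
    Asymptotics.IsBigO.of_bound C (Eventually.of_forall fun y => by
      rw [Real.norm_eq_abs, Real.norm_eq_abs, abs_of_nonneg (sq_nonneg (y - x)), smul_eq_mul,
        mul_comm (y - x)]
      exact h y)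
  refine h1.trans_isLittleO ?_
  have h2 : (fun y : ℝ => y - x) =o[𝓝 x] fun _ => (1 : ℝ) := by
    rw [Asymptotics.isLittleO_one_iff]
    have : Tendsto (fun y : ℝ => y - x) (𝓝 x) (𝓝 (x - x)) := by
      exact (continuous_id.sub continuous_const).tendsto x
    simpa using this
  simpa [sq] using (Asymptotics.isBigO_refl (fun y : ℝ => y - x) (𝓝 x)).mul_isLittleO h2

/-! ### Flows of vector fields on the line -/

/-- A smooth vector field on the line that vanishes at the origin, of temperate growth and with
first and second derivative bounded by `L`. -/
structure FlowField (v : ℝ → ℝ) (L : ℝ) : Prop where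
  temperate : v.HasTemperateGrowth
  zero : v 0 = 0
  bound₁ : ∀ x, |deriv v x| ≤ L
  bound₂ : ∀ x, |deriv (deriv v) x| ≤ L

/-- `φ` is the flow of the vector field `v`. -/
structure IsFlow (v : ℝ → ℝ) (φ : ℝ → ℝ → ℝ) : Prop where
  zero : ∀ x, φ 0 x = x
  hasDerivAt : ∀ t x, HasDerivAt (fun s => φ s x) (v (φ t x)) t

namespace FlowField

variable {v : ℝ → ℝ} {L : ℝ}

theorem nonneg (hv : FlowField v L) : 0 ≤ L := (abs_nonneg _).trans (hv.bound₁ 0)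

theorem contDiff (hv : FlowField v L) : ContDiff ℝ ∞ v := hv.temperate.1

theorem hasDerivAt (hv : FlowField v L) (x : ℝ) : HasDerivAt v (deriv v x) x :=
  (hv.contDiff.differentiable (by simp)).differentiableAt.hasDerivAt

theorem contDiff_deriv (hv : FlowField v L) : ContDiff ℝ ∞ (deriv v) :=
  (contDiff_infty_iff_deriv.1 hv.contDiff).2

theorem hasDerivAt₂ (hv : FlowField v L) (x : ℝ) : HasDerivAt (deriv v) (deriv (deriv v) x) x :=
  (hv.contDiff_deriv.differentiable (by simp)).differentiableAt.hasDerivAt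

theorem continuous_deriv₂ (hv : FlowField v L) : Continuous (deriv (deriv v)) :=
  (contDiff_infty_iff_deriv.1 hv.contDiff_deriv).2.continuous

theorem continuous_deriv (hv : FlowField v L) : Continuous (deriv v) := hv.contDiff_deriv.continuous

theorem lipschitz (hv : FlowField v L) : LipschitzWith L.toNNReal v :=
  lipschitzWith_of_nnnorm_deriv_le (hv.contDiff.differentiable (by simp)) fun x => by
    rw [← NNReal.coe_le_coe, coe_nnnorm, Real.norm_eq_abs, Real.coe_toNNReal _ hv.nonneg]
    exact hv.bound₁ x

theorem abs_sub_le (hv : FlowField v L) (x y : ℝ) : |v x - v y| ≤ L * |x - y| := by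
  have := hv.lipschitz.dist_le_mul x y
  rwa [Real.coe_toNNReal _ hv.nonneg, Real.dist_eq, Real.dist_eq] at this

theorem abs_le (hv : FlowField v L) (x : ℝ) : |v x| ≤ L * |x| := by
  simpa [hv.zero] using hv.abs_sub_le x 0

/-- Time reversal keeps the constant `L`, so estimates for negative times follow from those for
positive times. -/
theorem neg (hv : FlowField v L) : FlowField (fun x => -v x) L where
  temperate := hv.temperate.neg
  zero := by simp [hv.zero]
  bound₁ x := by simpa using hv.bound₁ x
  bound₂ x := by
    have : deriv (fun x => -v x) = fun x => -deriv v x := by ext; simp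
    rw [this]; simpa using hv.bound₂ x

end FlowField

namespace IsFlow

variable {v : ℝ → ℝ} {L : ℝ} {φ : ℝ → ℝ → ℝ}

theorem continuous_time (hφ : IsFlow v φ) (x : ℝ) : Continuous fun t => φ t x :=
  continuous_iff_continuousAt.2 fun t => (hφ.hasDerivAt t x).continuousAt

theorem unique (hv : FlowField v L) (hφ : IsFlow v φ) {f : ℝ → ℝ}
    (hf : ∀ t, HasDerivAt f (v (f t)) t) (t : ℝ) : f t = φ t (f 0) := by
  have := ODE_solution_unique_univ (v := fun _ => v) (s := fun _ => univ) (t₀ := 0)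
    (fun _ => hv.lipschitz.lipschitzOnWith) (fun t => ⟨hf t, trivial⟩)
    (fun t => ⟨hφ.hasDerivAt t (f 0), trivial⟩) (hφ.zero _).symm
  exact congrFun this t

theorem add (hv : FlowField v L) (hφ : IsFlow v φ) (s t x : ℝ) : φ (s + t) x = φ s (φ t x) := by
  have := unique hv hφ (f := fun s => φ (s + t) x) (fun s => by
    simpa using (hφ.hasDerivAt (s + t) x).comp_add_const s t) s
  simpa using this

theorem neg_apply (hv : FlowField v L) (hφ : IsFlow v φ) (t x : ℝ) : φ (-t) (φ t x) = x := by
  rw [← hφ.add hv, neg_add_cancel, hφ.zero]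

theorem apply_neg (hv : FlowField v L) (hφ : IsFlow v φ) (t x : ℝ) : φ t (φ (-t) x) = x := by
  rw [← hφ.add hv, add_neg_cancel, hφ.zero]

theorem map_zero (hv : FlowField v L) (hφ : IsFlow v φ) (t : ℝ) : φ t 0 = 0 := by
  have := unique hv hφ (f := fun _ => 0) (fun s => by
    simpa [hv.zero] using hasDerivAt_const s (0 : ℝ)) t
  exact this.symm

theorem reverse (hφ : IsFlow v φ) : IsFlow (fun x => -v x) fun t x => φ (-t) x where
  zero x := by simp [hφ.zero]
  hasDerivAt t x := by
    simpa [Function.comp_def] using (hφ.hasDerivAt (-t) x).comp t (hasDerivAt_neg t)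

/-- Grönwall's inequality, applied to the reversed flow when `t` is negative. -/
theorem abs_sub_le (hv : FlowField v L) (hφ : IsFlow v φ) (t x y : ℝ) :
    |φ t x - φ t y| ≤ Real.exp (L * |t|) * |x - y| := by
  have key : ∀ {v : ℝ → ℝ} {φ : ℝ → ℝ → ℝ}, FlowField v L → IsFlow v φ → ∀ t, 0 ≤ t →
      |φ t x - φ t y| ≤ Real.exp (L * t) * |x - y| := by
    intro v φ hv hφ t ht
    have := dist_le_of_trajectories_ODE (v := fun _ => v) (a := 0) (b := t)
      (f := fun s => φ s x) (g := fun s => φ s y) (fun _ => hv.lipschitz)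
      (hφ.continuous_time x).continuousOn (fun s _ => (hφ.hasDerivAt s x).hasDerivWithinAt)
      (hφ.continuous_time y).continuousOn (fun s _ => (hφ.hasDerivAt s y).hasDerivWithinAt)
      le_rfl t ⟨ht, le_rfl⟩
    simp only [hφ.zero, Real.dist_eq, Real.coe_toNNReal _ hv.nonneg, sub_zero] at this
    rwa [mul_comm] at this
  rcases le_total 0 t with ht | ht
  · rw [abs_of_nonneg ht]; exact key hv hφ t ht
  · rw [abs_of_nonpos ht]
    simpa using key hv.neg hφ.reverse (-t) (by linarith)

theorem abs_apply_le (hv : FlowField v L) (hφ : IsFlow v φ) (t x : ℝ) :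
    |φ t x| ≤ Real.exp (L * |t|) * |x| := by
  simpa [hφ.map_zero hv] using hφ.abs_sub_le hv t x 0

theorem le_abs_apply (hv : FlowField v L) (hφ : IsFlow v φ) (t x : ℝ) :
    |x| ≤ Real.exp (L * |t|) * |φ t x| := by
  simpa [hφ.neg_apply hv] using hφ.abs_apply_le hv (-t) (φ t x)

theorem continuous_space (hv : FlowField v L) (hφ : IsFlow v φ) (t : ℝ) : Continuous (φ t) := by
  refine (LipschitzWith.of_dist_le_mul (K := (Real.exp (L * |t|)).toNNReal) fun x y => ?_).continuous
  rw [Real.coe_toNNReal _ (Real.exp_nonneg _), Real.dist_eq, Real.dist_eq]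
  exact hφ.abs_sub_le hv t x y

end IsFlow

/-! ### The Jacobian of a flow and change of variables -/

/-- The logarithm of the Jacobian of a flow. -/
def logJac (v : ℝ → ℝ) (φ : ℝ → ℝ → ℝ) (t x : ℝ) : ℝ := ∫ s in (0 : ℝ)..t, deriv v (φ s x)

/-- The square root of the Jacobian of a flow. -/
def sqrtJac (v : ℝ → ℝ) (φ : ℝ → ℝ → ℝ) (t x : ℝ) : ℝ := Real.exp (logJac v φ t x / 2)

namespace IsFlow

variable {v : ℝ → ℝ} {L : ℝ} {φ : ℝ → ℝ → ℝ}

theorem continuous_deriv_comp (hv : FlowField v L) (hφ : IsFlow v φ) (x : ℝ) :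
    Continuous fun s => deriv v (φ s x) := hv.continuous_deriv.comp (hφ.continuous_time x)

theorem hasDerivAt_logJac (hv : FlowField v L) (hφ : IsFlow v φ) (t x : ℝ) :
    HasDerivAt (fun t => logJac v φ t x) (deriv v (φ t x)) t :=
  intervalIntegral.integral_hasDerivAt_right
    ((hφ.continuous_deriv_comp hv x).intervalIntegrable _ _)
    ((hφ.continuous_deriv_comp hv x).stronglyMeasurableAtFilter _ _)
    (hφ.continuous_deriv_comp hv x).continuousAt

theorem logJac_zero (v : ℝ → ℝ) (φ : ℝ → ℝ → ℝ) (x : ℝ) : logJac v φ 0 x = 0 := by simp [logJac]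

theorem abs_logJac_le (hv : FlowField v L) (t x : ℝ) : |logJac v φ t x| ≤ L * |t| := by
  have := intervalIntegral.norm_integral_le_of_norm_le_const (a := 0) (b := t) (C := L)
    (f := fun s => deriv v (φ s x)) (fun s _ => hv.bound₁ _)
  simpa [logJac] using this

theorem logJac_add (hv : FlowField v L) (hφ : IsFlow v φ) (s t x : ℝ) :
    logJac v φ (s + t) x = logJac v φ t x + logJac v φ s (φ t x) := by
  have h1 : logJac v φ s (φ t x) = ∫ r in t..(s + t), deriv v (φ r x) := by
    have := intervalIntegral.integral_comp_add_right (a := 0) (b := s)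
      (fun r => deriv v (φ r x)) t
    rw [zero_add] at this
    rw [← this]
    simp only [logJac, hφ.add hv]
  rw [h1, logJac, logJac, intervalIntegral.integral_add_adjacent_intervals] <;>
  exact (hφ.continuous_deriv_comp hv x).intervalIntegrable _ _

/-- The difference of two trajectories is divided by the solution `exp (logJac)` of the variational
equation along one of them. The quotient starts at `y - x`, and its time derivative contains only
the Taylor remainder of `v`, which is quadratic in `y - x`. -/
theorem hasDerivAt_space (hv : FlowField v L) (hφ : IsFlow v φ) (t x : ℝ) :
    HasDerivAt (φ t) (Real.exp (logJac v φ t x)) x := by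
  have hL := hv.nonneg
  refine hasDerivAt_of_quadratic_bound
    (C := Real.exp (L * |t|) * (L * Real.exp (3 * L * |t|) * |t|)) fun y => ?_
  set r : ℝ → ℝ := fun s => (φ s y - φ s x) * Real.exp (-logJac v φ s x)
  have hr : ∀ s, HasDerivAt r ((v (φ s y) - v (φ s x) - deriv v (φ s x) * (φ s y - φ s x)) *
      Real.exp (-logJac v φ s x)) s := by
    intro s
    refine HasDerivAt.congr_deriv (((hφ.hasDerivAt s y).sub (hφ.hasDerivAt s x)).mul
      (hφ.hasDerivAt_logJac hv s x).neg.exp) ?_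
    simp only [Pi.sub_apply, Pi.neg_apply]
    ring
  -- Of the three factors `exp (L|t|)`, two come from the squared distance of the trajectories and
  -- one from the inverse Jacobian.
  have hb : ∀ s ∈ uIcc 0 t, ‖(v (φ s y) - v (φ s x) - deriv v (φ s x) * (φ s y - φ s x)) *
      Real.exp (-logJac v φ s x)‖ ≤ L * Real.exp (3 * L * |t|) * (y - x) ^ 2 := by
    intro s hs
    have hst : |s| ≤ |t| := by simpa using abs_sub_left_of_mem_uIcc hs
    have h1 := taylor_one_bound (a := φ s x) (b := φ s y) (fun z _ => hv.hasDerivAt z)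
      (fun z _ => hv.hasDerivAt₂ z) (fun z _ => hv.bound₂ z)
    rw [smul_eq_mul, mul_comm (φ s y - φ s x), Real.norm_eq_abs] at h1
    have h2 : (φ s y - φ s x) ^ 2 ≤ (Real.exp (L * |t|) * |y - x|) ^ 2 := by
      rw [← sq_abs (φ s y - φ s x)]
      gcongr
      refine (hφ.abs_sub_le hv s y x).trans ?_
      gcongr
    have h3 : Real.exp (-logJac v φ s x) ≤ Real.exp (L * |t|) := by
      gcongr
      have := abs_logJac_le (φ := φ) hv s x
      have h4 : L * |s| ≤ L * |t| := by gcongr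
      linarith [neg_abs_le (logJac v φ s x)]
    rw [norm_mul, Real.norm_eq_abs, Real.norm_eq_abs, abs_of_pos (Real.exp_pos _)]
    calc _ ≤ (L * (Real.exp (L * |t|) * |y - x|) ^ 2) * Real.exp (L * |t|) := by
            gcongr
            exact h1.trans (by gcongr)
      _ = L * Real.exp (3 * L * |t|) * (y - x) ^ 2 := by
            rw [mul_pow, sq_abs, show 3 * L * |t| = L * |t| + L * |t| + L * |t| by ring,
              Real.exp_add, Real.exp_add]
            ring
  have h5 := (convex_uIcc 0 t).norm_image_sub_le_of_norm_hasDerivWithin_le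
      (fun s _ => (hr s).hasDerivWithinAt) hb left_mem_uIcc right_mem_uIcc
  simp only [r, hφ.zero, logJac_zero, neg_zero, Real.exp_zero, mul_one, sub_zero,
    Real.norm_eq_abs] at h5
  have h6 : φ t y - φ t x - Real.exp (logJac v φ t x) * (y - x) = Real.exp (logJac v φ t x) *
      ((φ t y - φ t x) * Real.exp (-logJac v φ t x) - (y - x)) := by
    rw [Real.exp_neg]
    field_simp
  rw [h6, abs_mul, abs_of_pos (Real.exp_pos _)]
  calc _ ≤ Real.exp (L * |t|) * (L * Real.exp (3 * L * |t|) * (y - x) ^ 2 * |t|) := by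
        gcongr
        exact (le_abs_self _).trans (abs_logJac_le hv t x)
    _ = _ := by ring

theorem continuous_logJac_space (hv : FlowField v L) (hφ : IsFlow v φ) (t : ℝ) :
    Continuous (logJac v φ t) :=
  intervalIntegral.continuous_of_dominated_interval (bound := fun _ => L)
    (fun x => (hφ.continuous_deriv_comp hv x).aestronglyMeasurable)
    (fun x => ae_of_all _ fun s _ => hv.bound₁ _) (by simp)
    (ae_of_all _ fun s _ => hv.continuous_deriv.comp (hφ.continuous_space hv s))

theorem continuous_deriv₂_jac (hv : FlowField v L) (hφ : IsFlow v φ) (x : ℝ) :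
    Continuous fun s => deriv (deriv v) (φ s x) * Real.exp (logJac v φ s x) :=
  (hv.continuous_deriv₂.comp (hφ.continuous_time x)).mul
    (Real.continuous_exp.comp (continuous_iff_continuousAt.2 fun s =>
      (hφ.hasDerivAt_logJac hv s x).continuousAt))

theorem norm_deriv₂_jac_le (hv : FlowField v L) {s t : ℝ} (hs : s ∈ uIoc 0 t) (x : ℝ) :
    ‖deriv (deriv v) (φ s x) * Real.exp (logJac v φ s x)‖ ≤ L * Real.exp (L * |t|) := by
  have hL := hv.nonneg
  have hst : |s| ≤ |t| := by simpa using abs_sub_left_of_mem_uIcc (uIoc_subset_uIcc hs)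
  rw [norm_mul, Real.norm_eq_abs, Real.norm_eq_abs, abs_of_pos (Real.exp_pos _)]
  gcongr
  · exact hv.bound₂ _
  · exact (le_abs_self _).trans ((abs_logJac_le hv s x).trans (by gcongr))

theorem hasDerivAt_logJac_space (hv : FlowField v L) (hφ : IsFlow v φ) (t x : ℝ) :
    HasDerivAt (logJac v φ t)
      (∫ s in (0 : ℝ)..t, deriv (deriv v) (φ s x) * Real.exp (logJac v φ s x)) x :=
  (intervalIntegral.hasDerivAt_integral_of_dominated_loc_of_deriv_le (𝕜 := ℝ) (μ := volume)
    (F := fun x s => deriv v (φ s x)) (s := univ)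
    (F' := fun x s => deriv (deriv v) (φ s x) * Real.exp (logJac v φ s x))
    (bound := fun _ => L * Real.exp (L * |t|)) univ_mem
    (Eventually.of_forall fun y => (hφ.continuous_deriv_comp hv y).aestronglyMeasurable)
    ((hφ.continuous_deriv_comp hv x).intervalIntegrable _ _)
    (hφ.continuous_deriv₂_jac hv x).aestronglyMeasurable
    (ae_of_all _ fun s hs y _ => norm_deriv₂_jac_le hv hs y) (by simp)
    (ae_of_all _ fun s _ y _ => (hv.hasDerivAt₂ _).comp y (hφ.hasDerivAt_space hv s y))).2

/-- One continuous derivative is all that is needed: multiplication by the root of the Jacobian must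
keep `C¹` functions `C¹`, so that `fourierCore` is invariant. -/
theorem contDiff_logJac (hv : FlowField v L) (hφ : IsFlow v φ) (t : ℝ) :
    ContDiff ℝ 1 (logJac v φ t) := by
  rw [contDiff_one_iff_deriv]
  refine ⟨fun x => (hφ.hasDerivAt_logJac_space hv t x).differentiableAt, ?_⟩
  have : deriv (logJac v φ t) = fun x =>
      ∫ s in (0 : ℝ)..t, deriv (deriv v) (φ s x) * Real.exp (logJac v φ s x) :=
    funext fun x => (hφ.hasDerivAt_logJac_space hv t x).deriv
  rw [this]
  exact intervalIntegral.continuous_of_dominated_interval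
    (fun x => (hφ.continuous_deriv₂_jac hv x).aestronglyMeasurable)
    (fun x => ae_of_all _ fun s hs => norm_deriv₂_jac_le hv hs x) (by simp)
    (ae_of_all _ fun s _ => (hv.continuous_deriv₂.comp (hφ.continuous_space hv s)).mul
      (Real.continuous_exp.comp (hφ.continuous_logJac_space hv s)))

theorem contDiff_space (hv : FlowField v L) (hφ : IsFlow v φ) (t : ℝ) : ContDiff ℝ 1 (φ t) := by
  rw [contDiff_one_iff_deriv]
  refine ⟨fun x => (hφ.hasDerivAt_space hv t x).differentiableAt, ?_⟩
  have : deriv (φ t) = fun x => Real.exp (logJac v φ t x) :=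
    funext fun x => (hφ.hasDerivAt_space hv t x).deriv
  rw [this]
  exact Real.continuous_exp.comp (hφ.continuous_logJac_space hv t)

theorem contDiff_sqrtJac (hv : FlowField v L) (hφ : IsFlow v φ) (t : ℝ) :
    ContDiff ℝ 1 (sqrtJac v φ t) :=
  Real.contDiff_exp.comp ((hφ.contDiff_logJac hv t).div_const 2)

theorem continuous_sqrtJac (hv : FlowField v L) (hφ : IsFlow v φ) (t : ℝ) :
    Continuous (sqrtJac v φ t) := (hφ.contDiff_sqrtJac hv t).continuous

theorem sqrtJac_pos (v : ℝ → ℝ) (φ : ℝ → ℝ → ℝ) (t x : ℝ) : 0 < sqrtJac v φ t x := Real.exp_pos _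

theorem sqrtJac_sq (v : ℝ → ℝ) (φ : ℝ → ℝ → ℝ) (t x : ℝ) :
    sqrtJac v φ t x ^ 2 = Real.exp (logJac v φ t x) := by
  rw [sqrtJac, ← Real.exp_nat_mul]; congr 1; push_cast; ring

theorem sqrtJac_zero (v : ℝ → ℝ) (φ : ℝ → ℝ → ℝ) (x : ℝ) : sqrtJac v φ 0 x = 1 := by
  simp [sqrtJac, logJac_zero]

theorem sqrtJac_add (hv : FlowField v L) (hφ : IsFlow v φ) (s t x : ℝ) :
    sqrtJac v φ (s + t) x = sqrtJac v φ t x * sqrtJac v φ s (φ t x) := by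
  rw [sqrtJac, hφ.logJac_add hv, add_div, Real.exp_add]; rfl

theorem sqrtJac_le (hv : FlowField v L) (t x : ℝ) : sqrtJac v φ t x ≤ Real.exp (L * |t|) := by
  have := abs_logJac_le (φ := φ) hv t x
  have h0 : 0 ≤ L * |t| := mul_nonneg hv.nonneg (abs_nonneg t)
  exact Real.exp_le_exp.2 (by linarith [le_abs_self (logJac v φ t x)])

theorem hasDerivAt_sqrtJac (hv : FlowField v L) (hφ : IsFlow v φ) (t x : ℝ) :
    HasDerivAt (fun t => sqrtJac v φ t x) (deriv v (φ t x) / 2 * sqrtJac v φ t x) t := by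
  have := ((hφ.hasDerivAt_logJac hv t x).div_const 2).exp
  rwa [mul_comm] at this

theorem hasDerivAt_comp_time (hφ : IsFlow v φ) {F : Type*} [NormedAddCommGroup F]
    [NormedSpace ℝ F] {f : ℝ → F} {f' : F} {t x : ℝ} (hf : HasDerivAt f f' (φ t x)) :
    HasDerivAt (fun t => f (φ t x)) (v (φ t x) • f') t :=
  hf.scomp t (hφ.hasDerivAt t x)

theorem bijective (hv : FlowField v L) (hφ : IsFlow v φ) (t : ℝ) : Function.Bijective (φ t) :=
  ⟨Function.LeftInverse.injective (hφ.neg_apply hv t),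
    Function.RightInverse.surjective (hφ.apply_neg hv t)⟩

theorem lintegral_comp (hv : FlowField v L) (hφ : IsFlow v φ) (t : ℝ) (g : ℝ → ℝ≥0∞) :
    ∫⁻ x, ENNReal.ofReal (sqrtJac v φ t x ^ 2) * g (φ t x) = ∫⁻ x, g x := by
  have := lintegral_image_eq_lintegral_abs_deriv_mul MeasurableSet.univ
    (fun x _ => (hφ.hasDerivAt_space hv t x).hasDerivWithinAt) (hφ.bijective hv t).1.injOn g
  rw [image_univ, (hφ.bijective hv t).2.range_eq, Measure.restrict_univ] at this
  rw [this]
  simp [sqrtJac_sq]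

theorem integral_comp (hv : FlowField v L) (hφ : IsFlow v φ) (t : ℝ) (g : ℝ → ℂ) :
    ∫ x, ((sqrtJac v φ t x ^ 2 : ℝ) : ℂ) * g (φ t x) = ∫ x, g x := by
  have := integral_image_eq_integral_abs_deriv_smul MeasurableSet.univ
    (fun x _ => (hφ.hasDerivAt_space hv t x).hasDerivWithinAt) (hφ.bijective hv t).1.injOn g
  rw [image_univ, (hφ.bijective hv t).2.range_eq, Measure.restrict_univ] at this
  rw [this]
  simp [sqrtJac_sq]

theorem sqrtJac_mul_neg (hv : FlowField v L) (hφ : IsFlow v φ) (t x : ℝ) :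
    sqrtJac v φ t x * sqrtJac v φ (-t) (φ t x) = 1 := by
  rw [← hφ.sqrtJac_add hv, neg_add_cancel, sqrtJac_zero]

/-- The weighted composition with `φ t` has the weighted composition with `φ (-t)` as transpose. -/
theorem integral_transpose (hv : FlowField v L) (hφ : IsFlow v φ) (t : ℝ) (h k : ℝ → ℂ) :
    ∫ x, (sqrtJac v φ t x : ℂ) * h (φ t x) * k x =
      ∫ x, h x * ((sqrtJac v φ (-t) x : ℂ) * k (φ (-t) x)) := by
  rw [← hφ.integral_comp hv t fun x => h x * ((sqrtJac v φ (-t) x : ℂ) * k (φ (-t) x))]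
  congr 1
  ext x
  have h1 : (sqrtJac v φ t x : ℂ) * (sqrtJac v φ (-t) (φ t x) : ℂ) = 1 := by
    exact_mod_cast hφ.sqrtJac_mul_neg hv t x
  rw [hφ.neg_apply hv]
  push_cast
  linear_combination (-(sqrtJac v φ t x : ℂ) * h (φ t x) * k x) * h1

/-- A preimage under `φ t` is an image under `φ (-t)`, and differentiable maps send null sets to
null sets. Composition with the flow is thereby defined on classes in `L²`. -/
theorem quasiMeasurePreserving (hv : FlowField v L) (hφ : IsFlow v φ) (t : ℝ) :
    Measure.QuasiMeasurePreserving (φ t) volume volume := by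
  refine ⟨(hφ.continuous_space hv t).measurable, Measure.AbsolutelyContinuous.mk fun s hs h0 => ?_⟩
  rw [Measure.map_apply (hφ.continuous_space hv t).measurable hs]
  have : φ t ⁻¹' s = φ (-t) '' s := by
    ext x
    constructor
    · intro hx; exact ⟨φ t x, hx, hφ.neg_apply hv t x⟩
    · rintro ⟨y, hy, rfl⟩; simpa [hφ.apply_neg hv] using hy
  rw [this]
  exact addHaar_image_eq_zero_of_differentiableOn_of_addHaar_eq_zero _
    (fun x _ => (hφ.hasDerivAt_space hv (-t) x).differentiableAt.differentiableWithinAt) h0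

end IsFlow

/-! ### Existence of flows -/

/-- A field bounded by `M` cannot leave the ball of radius `M (n + 1)` within time `n + 1`, so a
single use of Picard–Lindelöf covers that interval. The local solutions are glued by uniqueness. -/
theorem exists_integralCurve {v : ℝ → ℝ} {L M : ℝ} (hv : FlowField v L) (hM : ∀ x, |v x| ≤ M)
    (x : ℝ) : ∃ f : ℝ → ℝ, f 0 = x ∧ ∀ t, HasDerivAt f (v (f t)) t := by
  have hM0 : 0 ≤ M := (abs_nonneg _).trans (hM 0)
  have loc : ∀ n : ℕ, ∃ f : ℝ → ℝ, f 0 = x ∧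
      ∀ t ∈ Ioo (-(n + 1 : ℝ)) (n + 1), HasDerivAt f (v (f t)) t := by
    intro n
    have h0 : (0 : ℝ) ∈ Icc (-(n + 1 : ℝ)) (n + 1) := by constructor <;> linarith [n.cast_nonneg (α := ℝ)]
    have hP : IsPicardLindelof (fun _ => v) (⟨0, h0⟩ : Icc (-(n + 1 : ℝ)) (n + 1)) x
        (M * (n + 1)).toNNReal 0 M.toNNReal L.toNNReal := by
      refine IsPicardLindelof.of_time_independent (fun y _ => ?_) hv.lipschitz.lipschitzOnWith ?_
      · rw [Real.coe_toNNReal _ hM0]; exact hM y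
      · rw [Real.coe_toNNReal _ hM0, Real.coe_toNNReal _ (by positivity)]
        simp
    obtain ⟨f, hf0, hf⟩ := hP.exists_eq_forall_mem_Icc_hasDerivWithinAt₀
    exact ⟨f, hf0, fun t ht => (hf t (Ioo_subset_Icc_self ht)).hasDerivAt (Icc_mem_nhds ht.1 ht.2)⟩
  choose f hf0 hf using loc
  have agree : ∀ m n : ℕ, m ≤ n → EqOn (f m) (f n) (Ioo (-(m + 1 : ℝ)) (m + 1)) := by
    intro m n hmn
    have hmn' : (m : ℝ) ≤ n := by exact_mod_cast hmn
    refine ODE_solution_unique_of_mem_Ioo (v := fun _ => v) (s := fun _ => univ) (t₀ := 0)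
      (fun _ _ => hv.lipschitz.lipschitzOnWith)
      (by constructor <;> linarith [m.cast_nonneg (α := ℝ)])
      (fun t ht => ⟨hf m t ht, trivial⟩)
      (fun t ht => ⟨hf n t ⟨by linarith [ht.1], by linarith [ht.2]⟩, trivial⟩)
      (by rw [hf0, hf0])
  -- The solution of index `⌈|t|⌉₊` lives on an interval longer by one on each side, which keeps `t`
  -- in the interior.
  refine ⟨fun t => f ⌈|t|⌉₊ t, by simp [hf0], fun t => ?_⟩
  have ht : t ∈ Ioo (-(⌈|t|⌉₊ + 1 : ℝ)) (⌈|t|⌉₊ + 1) := by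
    have := Nat.le_ceil |t|
    constructor <;> linarith [neg_abs_le t, le_abs_self t]
  refine (hf ⌈|t|⌉₊ t ht).congr_of_eventuallyEq ?_
  filter_upwards [Ioo_mem_nhds ht.1 ht.2] with s hs
  have hs' : s ∈ Ioo (-(⌈|s|⌉₊ + 1 : ℝ)) (⌈|s|⌉₊ + 1) := by
    have := Nat.le_ceil |s|
    constructor <;> linarith [neg_abs_le s, le_abs_self s]
  rcases le_total ⌈|s|⌉₊ ⌈|t|⌉₊ with h | h
  · exact agree _ _ h hs'
  · exact (agree _ _ h hs).symm

theorem exists_isFlow {v : ℝ → ℝ} {L M : ℝ} (hv : FlowField v L) (hM : ∀ x, |v x| ≤ M) :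
    ∃ φ, IsFlow v φ := by
  choose f hf0 hf using exists_integralCurve hv hM
  exact ⟨fun t x => f x t, hf0, fun t x => hf x t⟩

end NakReg

end

noncomputable section

namespace NakReg

open Set Filter Topology

/-! ### Weighted composition operators in `L²` -/

theorem eLpNorm_two_sq (f : ℝ → ℂ) : eLpNorm f 2 volume ^ 2 = ∫⁻ x, ‖f x‖ₑ ^ 2 := by
  have := eLpNorm_nnreal_pow_eq_lintegral (f := f) (μ := volume) (p := 2) two_ne_zero
  simpa using this

theorem enorm_sq_L2 (f : L2) : ‖f‖ₑ ^ 2 = ∫⁻ x, ‖f x‖ₑ ^ 2 := by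
  rw [Lp.enorm_def, eLpNorm_two_sq]

theorem integrable_norm_sq_L2 (f : L2) : Integrable fun x => ‖f x‖ ^ 2 :=
  (memLp_two_iff_integrable_sq_norm (Lp.aestronglyMeasurable f)).1 (Lp.memLp f)

theorem norm_sq_L2 (f : L2) : ‖f‖ ^ 2 = ∫ x, ‖f x‖ ^ 2 := by
  have h := congrArg ENNReal.toReal (enorm_sq_L2 f)
  rw [ENNReal.toReal_pow, toReal_enorm] at h
  rw [h, integral_eq_lintegral_of_nonneg_ae (ae_of_all _ fun x => by positivity)
    (integrable_norm_sq_L2 f).aestronglyMeasurable]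
  congr 2
  ext x
  rw [ENNReal.ofReal_pow (norm_nonneg _), ofReal_norm]

theorem norm_sq_le_of_memLp {f : L2} {g : ℝ → ℝ} (hg : Integrable fun x => g x ^ 2)
    (h : ∀ᵐ x, ‖f x‖ ≤ g x) : ‖f‖ ^ 2 ≤ ∫ x, g x ^ 2 := by
  rw [norm_sq_L2]
  refine integral_mono_ae (integrable_norm_sq_L2 f) hg ?_
  filter_upwards [h] with x hx
  gcongr

/-- The operator `f ↦ b · (f ∘ φ)` is bounded in `L²` as soon as `|b|²` is dominated by the density
of the change of variables `φ`. -/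
theorem exists_weightedComp {b : ℝ → ℂ} {φ : ℝ → ℝ} {C : ℝ} (hC : 0 ≤ C)
    (hb : AEStronglyMeasurable b volume) (hφ : Measure.QuasiMeasurePreserving φ volume volume)
    (h : ∀ g : ℝ → ℝ≥0∞, ∫⁻ x, ‖b x‖ₑ ^ 2 * g (φ x) ≤ ENNReal.ofReal (C ^ 2) * ∫⁻ x, g x) :
    ∃ S : L2 →L[ℂ] L2, (∀ f, S f =ᵐ[volume] fun x => b x * f (φ x)) ∧ ∀ f, ‖S f‖ ≤ C * ‖f‖ := by
  have hle : ∀ f : L2, eLpNorm (fun x => b x * f (φ x)) 2 volume ≤ ENNReal.ofReal C * ‖f‖ₑ := by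
    intro f
    have h1 : eLpNorm (fun x => b x * f (φ x)) 2 volume ^ 2 ≤ (ENNReal.ofReal C * ‖f‖ₑ) ^ 2 := by
      rw [eLpNorm_two_sq, mul_pow, enorm_sq_L2, ← ENNReal.ofReal_pow hC]
      simpa [enorm_mul, mul_pow] using h fun x => ‖f x‖ₑ ^ 2
    exact (ENNReal.pow_le_pow_left_iff two_ne_zero).1 h1
  have hmem : ∀ f : L2, MemLp (fun x => b x * f (φ x)) 2 volume := fun f =>
    ⟨hb.mul ((Lp.aestronglyMeasurable f).comp_quasiMeasurePreserving hφ),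
      (hle f).trans_lt (ENNReal.mul_lt_top ENNReal.ofReal_lt_top enorm_lt_top)⟩
  have hnorm : ∀ f : L2, ‖(hmem f).toLp‖ ≤ C * ‖f‖ := by
    intro f
    rw [Lp.norm_toLp]
    have := ENNReal.toReal_mono (ENNReal.mul_lt_top ENNReal.ofReal_lt_top enorm_lt_top).ne (hle f)
    rwa [ENNReal.toReal_mul, ENNReal.toReal_ofReal hC, toReal_enorm] at this
  refine ⟨LinearMap.mkContinuous
    { toFun := fun f => (hmem f).toLp
      map_add' := fun f g => ?_
      map_smul' := fun c f => ?_ } C hnorm, fun f => (hmem f).coeFn_toLp, hnorm⟩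
  · ext1
    refine (hmem (f + g)).coeFn_toLp.trans (EventuallyEq.trans ?_ (Lp.coeFn_add _ _).symm)
    filter_upwards [hφ.ae_eq_comp (Lp.coeFn_add f g), (hmem f).coeFn_toLp, (hmem g).coeFn_toLp]
      with x h1 h2 h3
    simp only [Function.comp_apply, Pi.add_apply] at h1
    rw [h1, Pi.add_apply, h2, h3, mul_add]
  · ext1
    refine (hmem (c • f)).coeFn_toLp.trans (EventuallyEq.trans ?_ (Lp.coeFn_smul _ _).symm)
    filter_upwards [hφ.ae_eq_comp (Lp.coeFn_smul c f), (hmem f).coeFn_toLp] with x h1 h2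
    simp only [Function.comp_apply, Pi.smul_apply] at h1
    rw [h1, Pi.smul_apply, RingHom.id_apply, h2, smul_eq_mul, smul_eq_mul, mul_left_comm]

/-- Multiplication by a bounded function is bounded in `L²`. -/
theorem exists_mulOp {b : ℝ → ℂ} {C : ℝ} (hb : AEStronglyMeasurable b volume)
    (h : ∀ x, ‖b x‖ ≤ C) : ∃ S : L2 →L[ℂ] L2, (∀ f, S f =ᵐ[volume] fun x => b x * f x) ∧
      ∀ f, ‖S f‖ ≤ C * ‖f‖ := by
  have hC : 0 ≤ C := (norm_nonneg _).trans (h 0)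
  refine exists_weightedComp hC hb (Measure.QuasiMeasurePreserving.id volume) fun g => ?_
  rw [← lintegral_const_mul' _ _ ENNReal.ofReal_ne_top]
  refine lintegral_mono fun x => ?_
  simp only
  gcongr
  rw [← ofReal_norm, ← ENNReal.ofReal_pow (norm_nonneg _)]
  gcongr
  exact h x

namespace IsFlow

variable {v : ℝ → ℝ} {L : ℝ} {φ : ℝ → ℝ → ℝ}

theorem exists_flowOp (hv : FlowField v L) (hφ : IsFlow v φ) (t : ℝ) :
    ∃ S : L2 →L[ℂ] L2, ∀ f, S f =ᵐ[volume] fun x => (sqrtJac v φ t x : ℂ) * f (φ t x) := by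
  obtain ⟨S, hS, -⟩ := exists_weightedComp (b := fun x => (sqrtJac v φ t x : ℂ)) (φ := φ t)
    zero_le_one (Complex.continuous_ofReal.comp (hφ.continuous_sqrtJac hv t)).aestronglyMeasurable
    (hφ.quasiMeasurePreserving hv t) fun g => by
      rw [← hφ.lintegral_comp hv t g]
      simp only [one_pow, ENNReal.ofReal_one, one_mul]
      refine le_of_eq (lintegral_congr fun x => ?_)
      rw [← ofReal_norm, ← ENNReal.ofReal_pow (norm_nonneg _), Complex.norm_real, Real.norm_eq_abs,
        sq_abs]
  exact ⟨S, hS⟩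

/-- The unitary operator `f ↦ √J_t · (f ∘ φ_t)` in `L²`. -/
def flowOp (hv : FlowField v L) (hφ : IsFlow v φ) (t : ℝ) : L2 →L[ℂ] L2 :=
  (hφ.exists_flowOp hv t).choose

theorem coeFn_flowOp (hv : FlowField v L) (hφ : IsFlow v φ) (t : ℝ) (f : L2) :
    hφ.flowOp hv t f =ᵐ[volume] fun x => (sqrtJac v φ t x : ℂ) * f (φ t x) :=
  (hφ.exists_flowOp hv t).choose_spec f

theorem norm_flowOp (hv : FlowField v L) (hφ : IsFlow v φ) (t : ℝ) (f : L2) :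
    ‖hφ.flowOp hv t f‖ = ‖f‖ := by
  have : ‖hφ.flowOp hv t f‖ₑ ^ 2 = ‖f‖ₑ ^ 2 := by
    rw [enorm_sq_L2, enorm_sq_L2, ← hφ.lintegral_comp hv t fun x => ‖f x‖ₑ ^ 2]
    refine lintegral_congr_ae ?_
    filter_upwards [hφ.coeFn_flowOp hv t f] with x hx
    rw [hx, enorm_mul, mul_pow, ← ofReal_norm, ← ENNReal.ofReal_pow (norm_nonneg _),
      Complex.norm_real, Real.norm_eq_abs, sq_abs]
  have h2 := congrArg ENNReal.toReal this
  rw [ENNReal.toReal_pow, ENNReal.toReal_pow, toReal_enorm, toReal_enorm] at h2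
  exact (pow_left_inj₀ (norm_nonneg _) (norm_nonneg _) two_ne_zero).1 h2

theorem flowOp_zero (hv : FlowField v L) (hφ : IsFlow v φ) : hφ.flowOp hv 0 = 1 := by
  ext1 f
  ext1
  filter_upwards [hφ.coeFn_flowOp hv 0 f] with x hx
  rw [hx, sqrtJac_zero, hφ.zero]
  simp

theorem flowOp_add (hv : FlowField v L) (hφ : IsFlow v φ) (s t : ℝ) :
    hφ.flowOp hv (s + t) = hφ.flowOp hv s * hφ.flowOp hv t := by
  ext1 f
  ext1
  filter_upwards [hφ.coeFn_flowOp hv (s + t) f, hφ.coeFn_flowOp hv s (hφ.flowOp hv t f),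
    (hφ.quasiMeasurePreserving hv s).ae_eq_comp (hφ.coeFn_flowOp hv t f)] with x h1 h2 h3
  simp only [Function.comp_apply] at h3
  rw [h1, mul_apply_eq_comp, h2, h3, add_comm s t, hφ.sqrtJac_add hv, hφ.add hv]
  push_cast
  ring

end IsFlow

/-! ### The generator of the weighted composition group -/

/-- The operator `f ↦ v f' + ½ v' f = ½ (v f' + (v f)')` on Schwartz functions. -/
def transport (v : ℝ → ℝ) : 𝓢(ℝ, ℂ) →L[ℂ] 𝓢(ℝ, ℂ) :=
  (1 / 2 : ℂ) • ((SchwartzMap.smulLeftCLM ℂ (fun x => (v x : ℂ))).comp (SchwartzMap.derivCLM ℂ ℂ) +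
    (SchwartzMap.derivCLM ℂ ℂ).comp (SchwartzMap.smulLeftCLM ℂ (fun x => (v x : ℂ))))

theorem transport_eq (v : ℝ → ℝ) (f : 𝓢(ℝ, ℂ)) : transport v f = (1 / 2 : ℂ) •
    (SchwartzMap.smulLeftCLM ℂ (fun x => (v x : ℂ)) (SchwartzMap.derivCLM ℂ ℂ f) +
      SchwartzMap.derivCLM ℂ ℂ (SchwartzMap.smulLeftCLM ℂ (fun x => (v x : ℂ)) f)) := by
  simp only [transport, _root_.smul_apply, _root_.add_apply,
    ContinuousLinearMap.comp_apply]

theorem transport_apply {v : ℝ → ℝ} {L : ℝ} (hv : FlowField v L) (f : 𝓢(ℝ, ℂ)) (x : ℝ) :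
    transport v f x = v x * deriv f x + (deriv v x / 2 : ℝ) * f x := by
  have ht : Function.HasTemperateGrowth fun x => (v x : ℂ) := by
    have := hv.temperate
    fun_prop
  have h1 : ⇑(SchwartzMap.smulLeftCLM ℂ (fun x => (v x : ℂ)) f) = fun x => (v x : ℂ) * f x := by
    ext y; rw [SchwartzMap.smulLeftCLM_apply_apply ht, smul_eq_mul]
  have h2 : HasDerivAt (fun x => (v x : ℂ) * f x) (((deriv v x : ℝ) : ℂ) * f x + v x * deriv f x) x :=
    (hv.hasDerivAt x).ofReal_comp.fun_mul (f.hasDerivAt x)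
  rw [transport_eq, _root_.smul_apply, _root_.add_apply,
    SchwartzMap.smulLeftCLM_apply_apply ht, SchwartzMap.derivCLM_apply, SchwartzMap.derivCLM_apply,
    h1, h2.deriv, smul_eq_mul, smul_eq_mul]
  push_cast
  ring

theorem schwartz_bound (f : 𝓢(ℝ, ℂ)) : ∃ C, 0 ≤ C ∧ ∀ x, (1 + |x|) * ‖f x‖ ≤ C := by
  obtain ⟨C, hC, h⟩ := f.decay 0 0
  obtain ⟨C', hC', h'⟩ := f.decay 1 0
  refine ⟨C + C', by positivity, fun x => ?_⟩
  have h1 := h x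
  have h2 := h' x
  simp at h1 h2
  linarith

theorem integrable_one_add_abs_inv_sq : Integrable fun x : ℝ => ((1 + |x|)⁻¹) ^ 2 := by
  have := integrable_one_add_norm (E := ℝ) (μ := volume) (r := 2) (by simp)
  refine this.congr (ae_of_all _ fun x => ?_)
  simp only [Real.norm_eq_abs]
  rw [Real.rpow_neg (by positivity), inv_pow]
  norm_cast

namespace IsFlow

variable {v : ℝ → ℝ} {L : ℝ} {φ : ℝ → ℝ → ℝ}

/-- The derivative has the same form with `transport v f`, again a Schwartz function, in place of
`f`. The formula can thus be iterated to reach the second time derivative. -/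
theorem hasDerivAt_weighted (hv : FlowField v L) (hφ : IsFlow v φ) (f : 𝓢(ℝ, ℂ)) (t x : ℝ) :
    HasDerivAt (fun t => (sqrtJac v φ t x : ℂ) * f (φ t x))
      ((sqrtJac v φ t x : ℂ) * transport v f (φ t x)) t := by
  refine HasDerivAt.congr_deriv ((hφ.hasDerivAt_sqrtJac hv t x).ofReal_comp.mul
    (hφ.hasDerivAt_comp_time (f.hasDerivAt (φ t x)))) ?_
  rw [transport_apply hv, Complex.real_smul]
  push_cast
  ring

theorem coeFn_toL2 (f : 𝓢(ℝ, ℂ)) : toL2 f =ᵐ[volume] f := f.coeFn_toLp 2 volume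

theorem coeFn_flowOp_schwartz (hv : FlowField v L) (hφ : IsFlow v φ) (t : ℝ) (f : 𝓢(ℝ, ℂ)) :
    hφ.flowOp hv t (toL2 f) =ᵐ[volume] fun x => (sqrtJac v φ t x : ℂ) * f (φ t x) := by
  filter_upwards [hφ.coeFn_flowOp hv t (toL2 f),
    (hφ.quasiMeasurePreserving hv t).ae_eq_comp (coeFn_toL2 f)] with x h1 h2
  simp only [Function.comp_apply] at h2
  rw [h1, h2]

/-- Pointwise Taylor expansion in time. The remainder keeps the decay `(1 + |x|)⁻¹`, because the
flow fixes `0` and distorts distances by at most `exp L` for `|t| ≤ 1`; it is therefore `O(t²)` in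
`L²`. -/
theorem hasDerivAt_flowOp_schwartz (hv : FlowField v L) (hφ : IsFlow v φ) (f : 𝓢(ℝ, ℂ)) :
    HasDerivAt (fun t => hφ.flowOp hv t (toL2 f)) (toL2 (transport v f)) 0 := by
  have hL := hv.nonneg
  obtain ⟨C, hC, hf⟩ := schwartz_bound (transport v (transport v f))
  set I : ℝ := ∫ x : ℝ, ((1 + |x|)⁻¹) ^ 2
  -- One factor `exp L` bounds the root of the Jacobian, the other compares `1 + |x|` with `1 + |φ s
  -- x|`.
  set M : ℝ := Real.exp L * Real.exp L * C
  have key : ∀ t : ℝ, |t| ≤ 1 → ‖hφ.flowOp hv t (toL2 f) - toL2 f - t • toL2 (transport v f)‖ ≤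
      M * √I * t ^ 2 := by
    intro t ht
    have hpt : ∀ x, ‖(sqrtJac v φ t x : ℂ) * f (φ t x) - f x - t • transport v f x‖ ≤
        M * t ^ 2 * (1 + |x|)⁻¹ := by
      intro x
      have h1 := taylor_one_bound (a := 0) (b := t) (M := M * (1 + |x|)⁻¹)
        (fun s _ => hφ.hasDerivAt_weighted hv f s x)
        (fun s _ => hφ.hasDerivAt_weighted hv (transport v f) s x) (fun s hs => by
          have hs1 : |s| ≤ 1 := (by simpa using abs_sub_left_of_mem_uIcc hs : |s| ≤ |t|).trans ht
          have hLs : L * |s| ≤ L := mul_le_of_le_one_right hL hs1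
          have h2 : sqrtJac v φ s x ≤ Real.exp L :=
            (sqrtJac_le hv s x).trans (Real.exp_le_exp.2 hLs)
          have h3 : 1 + |x| ≤ Real.exp L * (1 + |φ s x|) := by
            have := hφ.le_abs_apply hv s x
            have h4 : Real.exp (L * |s|) * |φ s x| ≤ Real.exp L * |φ s x| := by gcongr
            have h5 : 1 ≤ Real.exp L := Real.one_le_exp hL
            linarith
          rw [norm_mul, Complex.norm_real, Real.norm_eq_abs, abs_of_pos (sqrtJac_pos _ _ _ _),
            ← div_eq_mul_inv, le_div_iff₀ (by positivity)]
          calc _ ≤ Real.exp L * ‖transport v (transport v f) (φ s x)‖ *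
                  (Real.exp L * (1 + |φ s x|)) := by gcongr
            _ = Real.exp L * Real.exp L *
                  ((1 + |φ s x|) * ‖transport v (transport v f) (φ s x)‖) := by ring
            _ ≤ _ := by
                  simp only [M]
                  gcongr
                  exact hf _)
      simp only [sqrtJac_zero, hφ.zero, Complex.ofReal_one, one_mul, sub_zero] at h1
      exact h1.trans (le_of_eq (by ring))
    have hae : ∀ᵐ x, ‖(hφ.flowOp hv t (toL2 f) - toL2 f - t • toL2 (transport v f) : L2) x‖ ≤
        M * t ^ 2 * (1 + |x|)⁻¹ := by
      filter_upwards [Lp.coeFn_sub (hφ.flowOp hv t (toL2 f) - toL2 f) (t • toL2 (transport v f)),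
        Lp.coeFn_sub (hφ.flowOp hv t (toL2 f)) (toL2 f), Lp.coeFn_smul t (toL2 (transport v f)),
        coeFn_toL2 f, coeFn_toL2 (transport v f), hφ.coeFn_flowOp_schwartz hv t f]
        with x h1 h2 h3 h4 h5 h6
      rw [h1, Pi.sub_apply, h2, Pi.sub_apply, h3, Pi.smul_apply, h4, h5, h6]
      exact hpt x
    have hsq := norm_sq_le_of_memLp (g := fun x => M * t ^ 2 * (1 + |x|)⁻¹) (by
      simp only [mul_pow (M * t ^ 2)]
      exact integrable_one_add_abs_inv_sq.const_mul _) hae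
    simp only [mul_pow (M * t ^ 2)] at hsq
    rw [integral_const_mul] at hsq
    have hI : 0 ≤ I := integral_nonneg fun x => by positivity
    refine le_of_sq_le_sq ?_ (by positivity)
    rw [show M * √I * t ^ 2 = M * t ^ 2 * √I by ring, mul_pow (M * t ^ 2), Real.sq_sqrt hI]
    exact hsq
  rw [hasDerivAt_iff_isLittleO]
  have h1 : (fun t => hφ.flowOp hv t (toL2 f) - hφ.flowOp hv 0 (toL2 f) -
      (t - 0) • toL2 (transport v f)) =O[𝓝 0] fun t : ℝ => t ^ 2 := by
    refine Asymptotics.IsBigO.of_bound (M * √I) ?_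
    filter_upwards [Metric.closedBall_mem_nhds (0 : ℝ) one_pos] with t ht
    rw [mem_closedBall_zero_iff, Real.norm_eq_abs] at ht
    rw [flowOp_zero, sub_zero, Real.norm_eq_abs, abs_of_nonneg (sq_nonneg t)]
    exact key t ht
  refine h1.trans_isLittleO ?_
  simpa [sq] using Asymptotics.isLittleO_pow_id (𝕜 := ℝ) one_lt_two

theorem tendsto_flowOp_zero (hv : FlowField v L) (hφ : IsFlow v φ) (f : L2) :
    Tendsto (fun t => hφ.flowOp hv t f) (𝓝 0) (𝓝 f) := by
  rw [Metric.tendsto_nhds]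
  intro ε hε
  obtain ⟨g, hg⟩ := (SchwartzMap.denseRange_toLpCLM (E := ℝ) (F := ℂ) (p := 2) (μ := volume)
    ENNReal.ofNat_ne_top).exists_dist_lt f (ε := ε / 3) (by positivity)
  change dist f (toL2 g) < ε / 3 at hg
  have h1 := (hφ.hasDerivAt_flowOp_schwartz hv g).continuousAt
  have h2 := Metric.tendsto_nhds.1 h1 (ε / 3) (by positivity)
  filter_upwards [h2] with t ht
  rw [flowOp_zero, one_apply_eq_self] at ht
  have h3 : dist (hφ.flowOp hv t f) (hφ.flowOp hv t (toL2 g)) < ε / 3 := by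
    rw [dist_eq_norm, ← map_sub, norm_flowOp, ← dist_eq_norm]; exact hg
  have h4 := dist_triangle4 (hφ.flowOp hv t f) (hφ.flowOp hv t (toL2 g)) (toL2 g) f
  rw [dist_comm (toL2 g) f] at h4
  linarith

theorem continuous_flowOp (hv : FlowField v L) (hφ : IsFlow v φ) (f : L2) :
    Continuous fun t => hφ.flowOp hv t f := by
  rw [continuous_iff_continuousAt]
  intro t
  have h1 := (hφ.tendsto_flowOp_zero hv f).comp
    (show Tendsto (fun s => s - t) (𝓝 t) (𝓝 0) by
      have := (by fun_prop : Continuous fun s : ℝ => s - t).tendsto t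
      rwa [sub_self] at this)
  have h2 := ((hφ.flowOp hv t).continuous.tendsto f).comp h1
  refine h2.congr fun s => ?_
  simp only [Function.comp_apply]
  rw [← mul_apply_eq_comp, ← flowOp_add, add_sub_cancel]

end IsFlow

end NakReg

end

noncomputable section

namespace NakReg

open Set Filter Topology

/-! ### Unitary groups and closures of operators -/

namespace IsUnitaryGroup

variable {A : L2 →ₗ.[ℂ] L2} {U W : ℝ → L2 →L[ℂ] L2}

theorem norm_map (hU : IsUnitaryGroup A U) (τ : ℝ) (f : L2) : ‖U τ f‖ = ‖f‖ :=
  ContinuousLinearMap.norm_map_of_mem_unitary (hU.unitary τ) f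

/-- Two unitary groups whose generators extend `A` agree if the domain of `A` contains a dense set
mapped into the domain by one of them. -/
theorem eq_of_core (hU : IsUnitaryGroup A U) (hW : IsUnitaryGroup A W) {D : Set L2}
    (hD : Dense D) (hUD : ∀ f ∈ D, ∀ τ, U τ f ∈ A.domain) : U = W := by
  have key : ∀ f ∈ D, ∀ τ, W (-τ) (U τ f) = f := by
    intro f hf τ
    have hder : ∀ τ, HasDerivAt (fun τ => W (-τ) (U τ f)) 0 τ := by
      intro τ
      set x : L2 := U τ f
      -- Both groups have the same derivative at `x = U τ f`, so `U (s - τ) x` and `W (s - τ) x`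
      -- agree up to `o(s - τ)`. Since `W (-s)` is isometric, this is also the size of the increment
      -- of `W (-s) (U s f)`.
      have h1 := (hU.generator ⟨x, hUD f hf τ⟩).sub (hW.generator ⟨x, hUD f hf τ⟩)
      rw [sub_self, hasDerivAt_iff_isLittleO] at h1
      simp only [Pi.sub_apply, hU.zero, hW.zero, one_apply_eq_self, sub_self, sub_zero,
        smul_zero] at h1
      rw [hasDerivAt_iff_isLittleO]
      simp only [smul_zero, sub_zero]
      have h2 : Tendsto (fun s : ℝ => s - τ) (𝓝 τ) (𝓝 0) := by
        have := (by fun_prop : Continuous fun s : ℝ => s - τ).tendsto τ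
        rwa [sub_self] at this
      refine (Asymptotics.isLittleO_norm_left.1 ?_)
      refine (Asymptotics.isLittleO_norm_left.2 (h1.comp_tendsto h2)).congr_left fun s => ?_
      have e1 : U s f = U (s - τ) x := by
        rw [← mul_apply_eq_comp, ← hU.add, sub_add_cancel]
      have e2 : W (-τ) x = W (-s) (W (s - τ) x) := by
        rw [← mul_apply_eq_comp (W (-s)), ← hW.add]
        congr 2
        ring
      rw [e1, e2, ← map_sub, hW.norm_map]
      rfl
    have := is_const_of_deriv_eq_zero (fun τ => (hder τ).differentiableAt)
      (fun τ => (hder τ).deriv) τ 0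
    simpa [hU.zero, hW.zero] using this
  have key2 : ∀ f ∈ D, ∀ τ, U τ f = W τ f := by
    intro f hf τ
    have := congrArg (W τ) (key f hf τ)
    rwa [← mul_apply_eq_comp, ← hW.add, add_neg_cancel, hW.zero, one_apply_eq_self] at this
  funext τ
  exact DFunLike.coe_injective (Continuous.ext_on hD (U τ).continuous (W τ).continuous
    fun f hf => key2 f hf τ)

theorem sub_eq_integral (hU : IsUnitaryGroup A U) (f : A.domain) (τ : ℝ) :
    U τ (f : L2) - f = ∫ s in (0 : ℝ)..τ, U s (Complex.I • A f) := by
  have hd : ∀ τ, HasDerivAt (fun τ => U τ (f : L2)) (U τ (Complex.I • A f)) τ := by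
    intro τ
    have h0 : HasDerivAt (fun s => U s (f : L2)) (Complex.I • A f) (τ - τ) := by
      rw [sub_self]; exact hU.generator f
    have h1 := ((U τ).restrictScalars ℝ).hasFDerivAt.comp_hasDerivAt τ (h0.comp_sub_const τ τ)
    refine h1.congr_of_eventuallyEq (Eventually.of_forall fun s => ?_)
    simp only [Function.comp_apply, ContinuousLinearMap.coe_restrictScalars']
    rw [← mul_apply_eq_comp, ← hU.add, add_sub_cancel]
  rw [intervalIntegral.integral_eq_sub_of_hasDerivAt (fun s _ => hd s)
    ((hU.continuous _).intervalIntegrable _ _), hU.zero, one_apply_eq_self]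

/-- Both sides of the integrated relation are continuous in the pair, so it survives limits in the
graph. The derivative at `0` is recovered from it afterwards. -/
theorem sub_eq_integral_of_mem_closure (hU : IsUnitaryGroup A U) {p : L2 × L2}
    (hp : p ∈ A.graph.topologicalClosure) (τ : ℝ) :
    U τ p.1 - p.1 = ∫ s in (0 : ℝ)..τ, U s (Complex.I • p.2) := by
  have hcont : Continuous fun g : L2 => ∫ s in (0 : ℝ)..τ, U s (Complex.I • g) := by
    refine (LipschitzWith.of_dist_le_mul (K := |τ|.toNNReal) fun g g' => ?_).continuous
    rw [dist_eq_norm, dist_eq_norm, ← intervalIntegral.integral_sub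
      ((hU.continuous _).intervalIntegrable _ _) ((hU.continuous _).intervalIntegrable _ _),
      Real.coe_toNNReal _ (abs_nonneg τ)]
    refine (intervalIntegral.norm_integral_le_of_norm_le_const (C := ‖g - g'‖) fun s _ => ?_).trans
      (le_of_eq (by rw [sub_zero, mul_comm]))
    rw [← map_sub, hU.norm_map, ← smul_sub, norm_smul, Complex.norm_I, one_mul]
  have hclosed : IsClosed {p : L2 × L2 |
      U τ p.1 - p.1 = ∫ s in (0 : ℝ)..τ, U s (Complex.I • p.2)} :=
    isClosed_eq (((U τ).continuous.comp continuous_fst).sub continuous_fst)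
      (hcont.comp continuous_snd)
  refine closure_minimal ?_ hclosed hp
  rintro ⟨f, g⟩ hfg
  obtain ⟨y, hy1, hy2⟩ := (LinearPMap.mem_graph_iff A).1 hfg
  have := hU.sub_eq_integral y τ
  rwa [hy1, hy2] at this

theorem hasDerivAt_of_mem_closure (hU : IsUnitaryGroup A U) {p : L2 × L2}
    (hp : p ∈ A.graph.topologicalClosure) :
    HasDerivAt (fun τ => U τ p.1) (Complex.I • p.2) 0 := by
  have h1 := intervalIntegral.integral_hasDerivAt_right
    ((hU.continuous (Complex.I • p.2)).intervalIntegrable 0 0)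
    ((hU.continuous _).stronglyMeasurableAtFilter _ _) (hU.continuous _).continuousAt
  rw [hU.zero, one_apply_eq_self] at h1
  refine (h1.add_const p.1).congr_of_eventuallyEq (Eventually.of_forall fun τ => ?_)
  simp only
  rw [← hU.sub_eq_integral_of_mem_closure hp, sub_add_cancel]

/-- A limit `(0, g)` of points of the graph forces the derivative of the zero function to be `i g`,
so `g = 0`. -/
theorem isClosable (hU : IsUnitaryGroup A U) : A.IsClosable := by
  refine ⟨A.graph.topologicalClosure.toLinearPMap, (Submodule.toLinearPMap_graph_eq _ ?_).symm⟩
  intro p hp h0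
  have h1 := hU.hasDerivAt_of_mem_closure hp
  simp only [h0, map_zero] at h1
  have h2 := h1.unique (hasDerivAt_const (0 : ℝ) (0 : L2))
  exact (smul_eq_zero.1 h2).resolve_left Complex.I_ne_zero

theorem mem_closure_graph (hU : IsUnitaryGroup A U) {p : L2 × L2} :
    p ∈ A.closure.graph ↔ p ∈ A.graph.topologicalClosure := by
  rw [hU.isClosable.graph_closure_eq_closure_graph]

theorem closure (hU : IsUnitaryGroup A U) : IsUnitaryGroup A.closure U where
  unitary := hU.unitary
  zero := hU.zero
  add := hU.add
  continuous := hU.continuous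
  generator f := hU.hasDerivAt_of_mem_closure
    (p := ((f : L2), A.closure f)) (hU.mem_closure_graph.1 (A.closure.mem_graph f))

end IsUnitaryGroup

/-- `expI` picks some group whose generator extends `A`. A dense set inside the domain, invariant
under one such group, leaves no choice; self-adjointness of `A` need not be proved. -/
theorem expI_eq {A : L2 →ₗ.[ℂ] L2} {U : ℝ → L2 →L[ℂ] L2} (hU : IsUnitaryGroup A U) {D : Set L2}
    (hD : Dense D) (hUD : ∀ f ∈ D, ∀ τ, U τ f ∈ A.domain) : expI A = U := by
  have h : ∃ U, IsUnitaryGroup A U := ⟨U, hU⟩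
  rw [expI, dif_pos h]
  exact (hU.eq_of_core h.choose_spec hD hUD).symm

/-! ### Test functions are dense in the Schwartz space -/

/-- A smooth cutoff function, equal to `1` on `[-1, 1]` and vanishing outside `[-2, 2]`. -/
def cutoff : ContDiffBump (0 : ℝ) := ⟨1, 2, one_pos, one_lt_two⟩

theorem cutoff_eq_one {x : ℝ} (hx : |x| ≤ 1) : cutoff x = 1 :=
  cutoff.one_of_mem_closedBall (by simpa [cutoff] using hx)

theorem exists_cutoff_bound (n : ℕ) :
    ∃ C, 0 ≤ C ∧ ∀ x, ‖iteratedDeriv n (fun x : ℝ => cutoff x - 1) x‖ ≤ C := by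
  obtain ⟨C, hC, h⟩ :=
    (cutoff.hasCompactSupport.toSchwartzMap cutoff.contDiff).decay 0 n
  have h' : ∀ x, ‖iteratedDeriv n cutoff x‖ ≤ C := fun x => by
    have := h x
    rw [pow_zero, one_mul, norm_iteratedFDeriv_eq_norm_iteratedDeriv] at this
    exact this
  refine ⟨C + 1, by positivity, fun x => ?_⟩
  rw [iteratedDeriv_fun_sub (cutoff.contDiff.contDiffAt) contDiffAt_const]
  refine (norm_sub_le _ _).trans (add_le_add (h' x) ?_)
  rw [iteratedDeriv_const]
  split_ifs <;> simp

/-- `ψ` multiplied by a smooth cutoff at distance `R` from the origin. -/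
def truncate (R : ℝ) (ψ : 𝓢(ℝ, ℂ)) : 𝓢(ℝ, ℂ) :=
  SchwartzMap.smulLeftCLM ℂ (fun x : ℝ => cutoff (R⁻¹ * x)) ψ

theorem hasCompactSupport_cutoff_comp {R : ℝ} (hR : 0 < R) :
    HasCompactSupport fun x : ℝ => cutoff (R⁻¹ * x) :=
  cutoff.hasCompactSupport.comp_homeomorph (Homeomorph.mulLeft₀ R⁻¹ (inv_ne_zero hR.ne'))

theorem contDiff_cutoff_comp (R : ℝ) : ContDiff ℝ ∞ fun x : ℝ => cutoff (R⁻¹ * x) :=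
  cutoff.contDiff.comp (contDiff_const.mul contDiff_id)

theorem truncate_apply {R : ℝ} (hR : 0 < R) (ψ : 𝓢(ℝ, ℂ)) (x : ℝ) :
    truncate R ψ x = cutoff (R⁻¹ * x) • ψ x :=
  SchwartzMap.smulLeftCLM_apply_apply
    ((hasCompactSupport_cutoff_comp hR).hasTemperateGrowth (contDiff_cutoff_comp R)) ψ x

theorem hasCompactSupport_truncate {R : ℝ} (hR : 0 < R) (ψ : 𝓢(ℝ, ℂ)) :
    HasCompactSupport (truncate R ψ) := by
  have : ⇑(truncate R ψ) = fun x => cutoff (R⁻¹ * x) • ψ x := funext (truncate_apply hR ψ)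
  rw [this]
  exact (hasCompactSupport_cutoff_comp hR).smul_right

/-- The error vanishes where `|x| < R`. Where `|x| ≥ R`, the seminorms with weight `|x|^(k + 1)` in
place of `|x|^k` yield a factor `1/R`, while for `R > 1` the derivatives of the dilated cutoff are
bounded independently of `R`. -/
theorem tendsto_truncate (ψ : 𝓢(ℝ, ℂ)) : Tendsto (fun R => truncate R ψ) atTop (𝓝 ψ) := by
  rw [(schwartz_withSeminorms ℂ ℝ ℂ).tendsto_nhds]
  rintro ⟨k, n⟩ ε hε
  choose C hC hCb using exists_cutoff_bound
  choose D hD hDb using fun i => ψ.decay (k + 1) i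
  set K : ℝ := ∑ i ∈ Finset.range (n + 1), (n.choose i : ℝ) * C i * D (n - i)
  have hK : 0 ≤ K := Finset.sum_nonneg fun i _ => by
    have := hC i; have := (hD (n - i)).le; positivity
  filter_upwards [eventually_gt_atTop (max 1 (K / ε))] with R hR
  have hR1 : 1 < R := (le_max_left _ _).trans_lt hR
  have hR0 : 0 < R := one_pos.trans hR1
  have hRε : K / R < ε := by
    rw [div_lt_iff₀ hR0, mul_comm, ← div_lt_iff₀ hε]
    exact (le_max_right _ _).trans_lt hR
  refine lt_of_le_of_lt ?_ hRε
  refine SchwartzMap.seminorm_le_bound ℂ k n _ (by positivity) fun x => ?_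
  have hfun : ⇑(truncate R ψ - ψ) = fun x => (cutoff (R⁻¹ * x) - 1) • ψ x := by
    ext y
    rw [_root_.sub_apply, truncate_apply hR0, sub_smul, one_smul]
  rw [hfun]
  rcases lt_or_ge |x| R with hx | hx
  · have h0 : (fun x => (cutoff (R⁻¹ * x) - 1) • ψ x) =ᶠ[𝓝 x] fun _ => 0 := by
      filter_upwards [(isOpen_lt continuous_abs continuous_const).mem_nhds hx] with y hy
      rw [cutoff_eq_one, sub_self, zero_smul]
      rw [abs_mul, abs_of_pos (inv_pos.2 hR0), inv_mul_le_iff₀ hR0, mul_one]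
      exact le_of_lt hy
    rw [(h0.iteratedFDeriv ℝ n).self_of_nhds]
    simp only [iteratedFDeriv_fun_zero, Pi.zero_apply, norm_zero, mul_zero]
    positivity
  · have hx0 : 0 < |x| := hR0.trans_le hx
    have h1 := norm_iteratedFDeriv_smul_le (𝕜 := ℝ) (𝕜' := ℝ) (n := n) (N := ∞)
      (f := fun x => cutoff (R⁻¹ * x) - 1) (g := ψ)
      ((contDiff_cutoff_comp R).sub contDiff_const) (ψ.smooth ⊤) x (by exact_mod_cast le_top)
    have h2 : ∀ i, ‖iteratedFDeriv ℝ i (fun x => cutoff (R⁻¹ * x) - 1) x‖ ≤ C i := by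
      intro i
      rw [norm_iteratedFDeriv_eq_norm_iteratedDeriv,
        iteratedDeriv_comp_const_mul (f := fun x => cutoff x - 1)
          (cutoff.contDiff.sub contDiff_const), norm_mul, norm_pow]
      refine (mul_le_mul (pow_le_one₀ (norm_nonneg _) ?_) (hCb i _) (norm_nonneg _)
        zero_le_one).trans (one_mul _).le
      rw [norm_inv, Real.norm_eq_abs, abs_of_pos hR0]
      exact inv_le_one_of_one_le₀ hR1.le
    have h3 : ∀ i, |x| ^ k * ‖iteratedFDeriv ℝ i ψ x‖ ≤ D i / R := by
      intro i
      rw [le_div_iff₀ hR0]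
      have := hDb i x
      rw [Real.norm_eq_abs, pow_succ] at this
      refine le_trans ?_ this
      rw [mul_right_comm]
      gcongr
    calc ‖x‖ ^ k * ‖iteratedFDeriv ℝ n (fun x => (cutoff (R⁻¹ * x) - 1) • ψ x) x‖
        ≤ |x| ^ k * ∑ i ∈ Finset.range (n + 1), (n.choose i : ℝ) * C i *
            ‖iteratedFDeriv ℝ (n - i) ψ x‖ := by
          rw [Real.norm_eq_abs]
          gcongr
          refine h1.trans (Finset.sum_le_sum fun i _ => ?_)
          gcongr
          exact h2 i
      _ = ∑ i ∈ Finset.range (n + 1), (n.choose i : ℝ) * C i *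
            (|x| ^ k * ‖iteratedFDeriv ℝ (n - i) ψ x‖) := by
          rw [Finset.mul_sum]
          exact Finset.sum_congr rfl fun i _ => by ring
      _ ≤ ∑ i ∈ Finset.range (n + 1), (n.choose i : ℝ) * C i * (D (n - i) / R) := by
          gcongr with i hi
          · have := hC i; positivity
          · exact h3 _
      _ = K / R := by
          rw [Finset.sum_div]
          exact Finset.sum_congr rfl fun i _ => by ring

theorem mem_graph_minimalOp (S : 𝓢(ℝ, ℂ) →L[ℂ] 𝓢(ℝ, ℂ)) {ψ : 𝓢(ℝ, ℂ)}
    (hψ : HasCompactSupport ψ) : (toL2 ψ, toL2 (S ψ)) ∈ (minimalOp S).graph := by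
  rw [LinearPMap.mem_graph_iff]
  let ψ' : testFunctions := ⟨ψ, hψ⟩
  refine ⟨⟨testToL2 ψ', LinearMap.mem_range_self _ _⟩, rfl, ?_⟩
  change toL2 (S ((LinearEquiv.ofInjective testToL2 testToL2_injective).symm
    ⟨testToL2 ψ', LinearMap.mem_range_self _ _⟩ : testFunctions)) = toL2 (S ψ)
  have : (⟨testToL2 ψ', LinearMap.mem_range_self _ _⟩ : LinearMap.range testToL2) =
      LinearEquiv.ofInjective testToL2 testToL2_injective ψ' := rfl
  rw [this, LinearEquiv.symm_apply_apply]

theorem mem_closure_graph_minimalOp (S : 𝓢(ℝ, ℂ) →L[ℂ] 𝓢(ℝ, ℂ)) (ψ : 𝓢(ℝ, ℂ)) :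
    (toL2 ψ, toL2 (S ψ)) ∈ (minimalOp S).graph.topologicalClosure := by
  have h : Tendsto (fun R => (toL2 (truncate R ψ), toL2 (S (truncate R ψ)))) atTop
      (𝓝 (toL2 ψ, toL2 (S ψ))) :=
    ((toL2.continuous.tendsto ψ).comp (tendsto_truncate ψ)).prodMk_nhds
      (((toL2.comp S).continuous.tendsto ψ).comp (tendsto_truncate ψ))
  refine mem_closure_of_tendsto h ?_
  filter_upwards [eventually_gt_atTop 0] with R hR
  exact mem_graph_minimalOp S (hasCompactSupport_truncate hR ψ)

theorem exists_test_of_mem_graph {S : 𝓢(ℝ, ℂ) →L[ℂ] 𝓢(ℝ, ℂ)} (f : (minimalOp S).domain) :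
    ∃ ψ : 𝓢(ℝ, ℂ), (f : L2) = toL2 ψ ∧ minimalOp S f = toL2 (S ψ) := by
  obtain ⟨ψ, hψ⟩ := f.2
  refine ⟨ψ, hψ.symm, ?_⟩
  have h := mem_graph_minimalOp S ψ.2
  obtain ⟨y, hy1, hy2⟩ := (LinearPMap.mem_graph_iff _).1 h
  have : y = f := Subtype.ext (hy1.trans hψ)
  rw [← this, hy2]

end NakReg

end

noncomputable section

namespace NakReg

open Set Filter Topology

/-! ### The operators `A_u` in the Fourier representation -/

/-- The Fourier transform in `L²`. -/
def fourierL2 : L2 ≃ₗᵢ[ℂ] L2 := Lp.fourierTransformₗᵢ ℝ ℂ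

theorem fourierL2_toL2 (ψ : 𝓢(ℝ, ℂ)) : fourierL2 (toL2 ψ) = toL2 (𝓕 ψ) :=
  SchwartzMap.toLp_fourier_eq ψ

theorem fourierL2_symm_toL2 (ψ : 𝓢(ℝ, ℂ)) : fourierL2.symm (toL2 ψ) = toL2 (𝓕⁻ ψ) :=
  SchwartzMap.toLp_fourierInv_eq ψ

/-- The vector field `u` in the frequency variable `x / 2π`. -/
def rescale (u : ℝ → ℝ) (x : ℝ) : ℝ := u (2 * Real.pi * x) / (2 * Real.pi)

theorem hasTemperateGrowth_id_complex : Function.HasTemperateGrowth fun x : ℝ => (x : ℂ) := by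
  fun_prop

theorem fourier_opQ (ψ : 𝓢(ℝ, ℂ)) :
    𝓕 (opQ ψ) = (Complex.I / (2 * Real.pi)) • SchwartzMap.derivCLM ℂ ℂ (𝓕 ψ) := by
  have h1 := SchwartzMap.lineDerivOp_fourier_eq ψ (1 : ℝ)
  have h2 : LineDeriv.lineDerivOp (1 : ℝ) (𝓕 ψ) = SchwartzMap.derivCLM ℂ ℂ (𝓕 ψ) := by
    ext x
    rw [SchwartzMap.lineDerivOp_apply_eq_fderiv, SchwartzMap.derivCLM_apply, fderiv_apply_one_eq_deriv]
  have h3 : -(2 * Real.pi * Complex.I) • SchwartzMap.smulLeftCLM ℂ (fun x : ℝ => inner ℝ x 1) ψ =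
      (-(2 * Real.pi * Complex.I)) • opQ ψ := by
    congr 1
    ext x
    have ht : Function.HasTemperateGrowth fun x : ℝ => inner ℝ x (1 : ℝ) := by fun_prop
    rw [opQ, SchwartzMap.smulLeftCLM_apply_apply ht,
      SchwartzMap.smulLeftCLM_apply_apply hasTemperateGrowth_id_complex]
    simp
  rw [h2, h3, FourierTransform.fourier_smul] at h1
  rw [h1, smul_smul]
  have : Complex.I / (2 * Real.pi) * -(2 * Real.pi * Complex.I) = 1 := by
    have hpi : (Real.pi : ℂ) ≠ 0 := by exact_mod_cast Real.pi_ne_zero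
    field_simp
    rw [Complex.I_sq]; ring
  rw [this, one_smul]

/-- `½ (u(p) q + q u(p))` on Schwartz functions. -/
def conjSchwartz (u : ℝ → ℝ) : 𝓢(ℝ, ℂ) →L[ℂ] 𝓢(ℝ, ℂ) :=
  (1 / 2 : ℂ) • ((opP u).comp opQ + opQ.comp (opP u))

theorem rescale_hasTemperateGrowth {u : ℝ → ℝ} {L : ℝ} (hv : FlowField (rescale u) L) :
    Function.HasTemperateGrowth fun x => (rescale u x : ℂ) := by
  have := hv.temperate
  fun_prop

theorem opP_eq {u : ℝ → ℝ} {L : ℝ} (hv : FlowField (rescale u) L) (ψ : 𝓢(ℝ, ℂ)) :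
    𝓕 (opP u ψ) =
      (2 * Real.pi : ℂ) • SchwartzMap.smulLeftCLM ℂ (fun x => (rescale u x : ℂ)) (𝓕 ψ) := by
  have h1 : (fun x : ℝ => (u (2 * Real.pi * x) : ℂ)) =
      (2 * Real.pi : ℂ) • fun x => (rescale u x : ℂ) := by
    ext x
    have hpi : (Real.pi : ℂ) ≠ 0 := by exact_mod_cast Real.pi_ne_zero
    simp only [rescale, Pi.smul_apply, smul_eq_mul]
    push_cast
    field_simp
  rw [opP, SchwartzMap.fourierMultiplierCLM_apply, FourierTransform.fourier_fourierInv_eq, h1,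
    SchwartzMap.smulLeftCLM_smul (rescale_hasTemperateGrowth hv), _root_.smul_apply]

/-- Under Mathlib's transform `q` becomes `(i / 2π) d/dx` and `u(p)` becomes multiplication by `2π ·
rescale u`. The factors `2π` cancel and `A_u` turns into `i` times a transport operator. -/
theorem fourier_conjSchwartz {u : ℝ → ℝ} {L : ℝ} (hv : FlowField (rescale u) L) (ψ : 𝓢(ℝ, ℂ)) :
    𝓕 (conjSchwartz u ψ) = Complex.I • transport (rescale u) (𝓕 ψ) := by
  have hpi : (Real.pi : ℂ) ≠ 0 := by exact_mod_cast Real.pi_ne_zero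
  have h0 : conjSchwartz u ψ = (1 / 2 : ℂ) • (opP u (opQ ψ) + opQ (opP u ψ)) := by
    simp only [conjSchwartz, _root_.smul_apply, _root_.add_apply, ContinuousLinearMap.comp_apply]
  rw [h0, FourierTransform.fourier_smul, FourierTransform.fourier_add, opP_eq hv, fourier_opQ,
    fourier_opQ, opP_eq hv, transport_eq, map_smul, map_smul, smul_smul, smul_smul,
    ← mul_comm (2 * Real.pi : ℂ) (Complex.I / (2 * Real.pi)), mul_div_cancel₀ _ (by simp),
    ← smul_add, smul_comm]

namespace IsFlow

variable {v : ℝ → ℝ} {L : ℝ} {φ : ℝ → ℝ → ℝ}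

/-- The unitary group with generator `A_u`, in terms of the flow of the rescaled vector field. -/
def groupOp (hv : FlowField v L) (hφ : IsFlow v φ) (τ : ℝ) : L2 →L[ℂ] L2 :=
  (fourierL2.symm.toContinuousLinearEquiv : L2 →L[ℂ] L2).comp
    ((hφ.flowOp hv (-τ)).comp (fourierL2.toContinuousLinearEquiv : L2 →L[ℂ] L2))

theorem groupOp_apply (hv : FlowField v L) (hφ : IsFlow v φ) (τ : ℝ) (f : L2) :
    hφ.groupOp hv τ f = fourierL2.symm (hφ.flowOp hv (-τ) (fourierL2 f)) := rfl

theorem fourier_groupOp (hv : FlowField v L) (hφ : IsFlow v φ) (τ : ℝ) (f : L2) :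
    fourierL2 (hφ.groupOp hv τ f) = hφ.flowOp hv (-τ) (fourierL2 f) := by
  rw [groupOp_apply, LinearIsometryEquiv.apply_symm_apply]

theorem groupOp_zero (hv : FlowField v L) (hφ : IsFlow v φ) : hφ.groupOp hv 0 = 1 := by
  ext1 f
  rw [groupOp_apply, neg_zero, flowOp_zero, one_apply_eq_self, one_apply_eq_self,
    LinearIsometryEquiv.symm_apply_apply]

theorem groupOp_add (hv : FlowField v L) (hφ : IsFlow v φ) (s t : ℝ) :
    hφ.groupOp hv (s + t) = hφ.groupOp hv s * hφ.groupOp hv t := by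
  ext1 f
  rw [mul_apply_eq_comp, groupOp_apply, groupOp_apply, fourier_groupOp, neg_add, flowOp_add,
    mul_apply_eq_comp]

theorem norm_groupOp (hv : FlowField v L) (hφ : IsFlow v φ) (τ : ℝ) (f : L2) :
    ‖hφ.groupOp hv τ f‖ = ‖f‖ := by
  rw [groupOp_apply, LinearIsometryEquiv.norm_map, norm_flowOp, LinearIsometryEquiv.norm_map]

theorem groupOp_mem_unitary (hv : FlowField v L) (hφ : IsFlow v φ) (τ : ℝ) :
    hφ.groupOp hv τ ∈ unitary (L2 →L[ℂ] L2) := by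
  have hinv : ∀ s f, hφ.groupOp hv (-s) (hφ.groupOp hv s f) = f := fun s f => by
    rw [← mul_apply_eq_comp, ← groupOp_add, neg_add_cancel, groupOp_zero, one_apply_eq_self]
  let e : L2 ≃ₗᵢ[ℂ] L2 :=
    { (hφ.groupOp hv τ).toLinearMap with
      invFun := hφ.groupOp hv (-τ)
      left_inv := hinv τ
      right_inv := fun f => by
        have := hinv (-τ) f
        rwa [neg_neg] at this
      norm_map' := hφ.norm_groupOp hv τ }
  have : hφ.groupOp hv τ = ((Unitary.linearIsometryEquiv.symm e : unitary (L2 →L[ℂ] L2)) :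
      L2 →L[ℂ] L2) := by
    ext1 f; rfl
  rw [this]
  exact (Unitary.linearIsometryEquiv.symm e).2

theorem hasDerivAt_groupOp_schwartz {u : ℝ → ℝ} (hv : FlowField (rescale u) L)
    (hφ : IsFlow (rescale u) φ) (ψ : 𝓢(ℝ, ℂ)) :
    HasDerivAt (fun τ => hφ.groupOp hv τ (toL2 ψ)) (Complex.I • toL2 (conjSchwartz u ψ)) 0 := by
  have h0 : HasDerivAt (fun t => hφ.flowOp hv t (toL2 (𝓕 ψ)))
      (toL2 (transport (rescale u) (𝓕 ψ))) (-0) := by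
    rw [neg_zero]; exact hφ.hasDerivAt_flowOp_schwartz hv (𝓕 ψ)
  have h1 := h0.scomp (0 : ℝ) (hasDerivAt_neg 0)
  have h2 := ((fourierL2.symm.toContinuousLinearEquiv : L2 →L[ℂ] L2).restrictScalars
    ℝ).hasFDerivAt.comp_hasDerivAt (0 : ℝ) h1
  refine HasDerivAt.congr_deriv (h2.congr_of_eventuallyEq (Eventually.of_forall fun τ => ?_)) ?_
  · change hφ.groupOp hv τ (toL2 ψ) = _
    rw [groupOp_apply, fourierL2_toL2]; rfl
  · have h3 : toL2 (conjSchwartz u ψ) =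
        fourierL2.symm (Complex.I • toL2 (transport (rescale u) (𝓕 ψ))) := by
      rw [← map_smul, ← fourier_conjSchwartz hv, ← fourierL2_toL2,
        LinearIsometryEquiv.symm_apply_apply]
    -- The sign `i · i = -1` is the reason why `groupOp` runs the flow at time `-τ`.
    have h4 : Complex.I • toL2 (conjSchwartz u ψ) =
        -fourierL2.symm (toL2 (transport (rescale u) (𝓕 ψ))) := by
      rw [h3, map_smul, smul_smul, Complex.I_mul_I, neg_one_smul]
    rw [h4, ← map_neg, neg_one_smul]
    rfl

theorem isUnitaryGroup_minimalOp {u : ℝ → ℝ} (hv : FlowField (rescale u) L)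
    (hφ : IsFlow (rescale u) φ) : IsUnitaryGroup (minimalOp (conjSchwartz u)) (hφ.groupOp hv) where
  unitary := hφ.groupOp_mem_unitary hv
  zero := hφ.groupOp_zero hv
  add := hφ.groupOp_add hv
  continuous f := fourierL2.symm.continuous.comp
    ((hφ.continuous_flowOp hv (fourierL2 f)).comp continuous_neg)
  generator f := by
    obtain ⟨ψ, h1, h2⟩ := exists_test_of_mem_graph f
    rw [h1, h2]
    exact hφ.hasDerivAt_groupOp_schwartz hv ψ

theorem isUnitaryGroup_conjOp {u : ℝ → ℝ} (hv : FlowField (rescale u) L)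
    (hφ : IsFlow (rescale u) φ) : IsUnitaryGroup (conjOp u) (hφ.groupOp hv) :=
  (hφ.isUnitaryGroup_minimalOp hv).closure

end IsFlow

/-! ### A core for `A_u` invariant under the group -/

/-- Functions with a `C¹` Fourier transform of compact support. -/
def fourierCore : Set L2 :=
  {f | ∃ h : ℝ → ℂ, ContDiff ℝ 1 h ∧ HasCompactSupport h ∧ fourierL2 f =ᵐ[volume] h}

theorem dense_range_toL2 : Dense (range toL2) :=
  SchwartzMap.denseRange_toLpCLM (E := ℝ) (F := ℂ) (p := 2) (μ := volume) ENNReal.ofNat_ne_top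

theorem dense_fourierCore : Dense fourierCore := by
  have h1 : Dense (fourierL2.symm '' range toL2) :=
    fourierL2.symm.surjective.denseRange.dense_image fourierL2.symm.continuous dense_range_toL2
  refine dense_closure.1 (h1.mono ?_)
  rintro _ ⟨_, ⟨ψ, rfl⟩, rfl⟩
  refine mem_closure_of_tendsto ((fourierL2.symm.continuous.tendsto _).comp
    ((toL2.continuous.tendsto ψ).comp (tendsto_truncate ψ))) ?_
  filter_upwards [eventually_gt_atTop 0] with R hR
  refine ⟨truncate R ψ, (truncate R ψ).smooth 1, hasCompactSupport_truncate hR ψ, ?_⟩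
  simp only [Function.comp_apply, LinearIsometryEquiv.apply_symm_apply]
  exact IsFlow.coeFn_toL2 _

/-- The flow and the root of its Jacobian are known to be `C¹` in space, and a homeomorphism
preserves compact supports. This is why the core consists of `C¹` functions and not of Schwartz
functions. -/
theorem IsFlow.groupOp_mem_fourierCore {v : ℝ → ℝ} {L : ℝ} {φ : ℝ → ℝ → ℝ} (hv : FlowField v L)
    (hφ : IsFlow v φ) {f : L2} (hf : f ∈ fourierCore) (τ : ℝ) :
    hφ.groupOp hv τ f ∈ fourierCore := by
  obtain ⟨h, h1, h2, h3⟩ := hf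
  let e : ℝ ≃ₜ ℝ :=
    { toFun := φ (-τ)
      invFun := φ τ
      left_inv := fun x => by simpa using hφ.apply_neg hv τ x
      right_inv := hφ.neg_apply hv τ
      continuous_toFun := hφ.continuous_space hv _
      continuous_invFun := hφ.continuous_space hv _ }
  refine ⟨fun x => (sqrtJac v φ (-τ) x : ℂ) * h (φ (-τ) x),
    (Complex.ofRealCLM.contDiff.comp (hφ.contDiff_sqrtJac hv _)).mul
      (h1.comp (hφ.contDiff_space hv _)), (h2.comp_homeomorph e).mul_left, ?_⟩
  rw [hφ.fourier_groupOp hv]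
  filter_upwards [hφ.coeFn_flowOp hv (-τ) (fourierL2 f),
    (hφ.quasiMeasurePreserving hv (-τ)).ae_eq_comp h3] with x hx1 hx2
  simp only [Function.comp_apply] at hx2
  rw [hx1, hx2]

theorem norm_le_of_support_subset {f : L2} {g : ℝ → ℂ} {c R : ℝ} (hR : 0 ≤ R) (hc : 0 ≤ c)
    (hfg : f =ᵐ[volume] g) (hg : ∀ x, ‖g x‖ ≤ c) (hsupp : ∀ x, R < |x| → g x = 0) :
    ‖f‖ ≤ c * √(2 * R) := by
  have h1 := norm_sq_le_of_memLp (f := f) (g := (Icc (-R) R).indicator fun _ => c) (by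
      have : (fun x => (Icc (-R) R).indicator (fun _ => c) x ^ 2) =
          (Icc (-R) R).indicator fun _ => c ^ 2 := by
        ext x; by_cases hx : x ∈ Icc (-R) R <;> simp [hx]
      rw [this]
      exact (integrable_indicator_iff measurableSet_Icc).2 (by simp)) (by
      filter_upwards [hfg] with x hx
      rw [hx]
      by_cases hxR : x ∈ Icc (-R) R
      · simpa [hxR] using hg x
      · rw [hsupp x (by rw [lt_abs]; grind)]
        simp [hxR])
  have h2 : ∫ x, (Icc (-R) R).indicator (fun _ => c) x ^ 2 = c ^ 2 * (2 * R) := by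
    have : (fun x => (Icc (-R) R).indicator (fun _ => c) x ^ 2) =
        (Icc (-R) R).indicator fun _ => c ^ 2 := by
      ext x; by_cases hx : x ∈ Icc (-R) R <;> simp [hx]
    rw [this, integral_indicator measurableSet_Icc]
    simp [Measure.real, ENNReal.toReal_ofReal (by linarith : 0 ≤ R + R)]
    ring
  rw [h2] at h1
  refine le_of_sq_le_sq ?_ (by positivity)
  rwa [mul_pow, Real.sq_sqrt (by linarith)]

/-- A compactly supported `C¹` function is approximated by test functions, in the `C¹` norm and with
supports in a fixed interval. -/
theorem exists_schwartz_approx {h : ℝ → ℂ} (h1 : ContDiff ℝ 1 h) (h2 : HasCompactSupport h) :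
    ∃ R, 0 ≤ R ∧ (∀ x, R < |x| → h x = 0) ∧ ∀ ε > 0, ∃ g : 𝓢(ℝ, ℂ), (∀ x, R < |x| → g x = 0) ∧
      (∀ x, ‖g x - h x‖ ≤ ε) ∧ ∀ x, ‖deriv g x - deriv h x‖ ≤ ε := by
  obtain ⟨R, hR⟩ := h2.isCompact.isBounded.subset_closedBall 0
  have hsupp : ∀ x, max R 0 < |x| → h x = 0 := fun x hx => by
    by_contra hne
    have := hR (subset_tsupport h hne)
    rw [mem_closedBall_zero_iff, Real.norm_eq_abs] at this
    exact absurd (this.trans (le_max_left R 0)) (not_le.2 hx)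
  refine ⟨max R 0 + 1, by positivity, fun x hx => hsupp x (by linarith), fun ε hε => ?_⟩
  have hd2 : HasCompactSupport (deriv h) := h2.deriv
  have hd1 : Continuous (deriv h) := h1.continuous_deriv le_rfl
  obtain ⟨δ₁, hδ₁, hu1⟩ := Metric.uniformContinuous_iff.1
    (h2.uniformContinuous_of_continuous h1.continuous) ε hε
  obtain ⟨δ₂, hδ₂, hu2⟩ := Metric.uniformContinuous_iff.1
    (hd2.uniformContinuous_of_continuous hd1) ε hε
  have hδ : 0 < min 1 (min δ₁ δ₂) := by positivity
  let ρ : ContDiffBump (0 : ℝ) := ⟨min 1 (min δ₁ δ₂) / 2, min 1 (min δ₁ δ₂), by positivity, by linarith⟩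
  let k : ℝ → ℝ := ρ.normed volume
  let g : ℝ → ℂ := convolution k h (ContinuousLinearMap.lsmul ℝ ℝ) volume
  have hk : HasCompactSupport k := ρ.hasCompactSupport_normed
  have hg1 : ContDiff ℝ ∞ g := hk.contDiff_convolution_left _ ρ.contDiff_normed
    h1.continuous.locallyIntegrable
  have hg2 : HasCompactSupport g := hk.convolution _ h2
  have hgd : ∀ x, HasDerivAt g (convolution k (deriv h) (ContinuousLinearMap.lsmul ℝ ℝ) volume x) x :=
    h2.hasDerivAt_convolution_right _ ρ.continuous_normed.locallyIntegrable h1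
  have hr1 : ρ.rOut ≤ 1 := min_le_left _ _
  have hr2 : ρ.rOut ≤ δ₁ := (min_le_right _ _).trans (min_le_left _ _)
  have hr3 : ρ.rOut ≤ δ₂ := (min_le_right _ _).trans (min_le_right _ _)
  refine ⟨hg2.toSchwartzMap hg1, fun x hx => ?_, fun x => ?_, fun x => ?_⟩
  · by_contra hne
    obtain ⟨y, hy, z, hz, hyz⟩ := support_convolution_subset _ hne
    rw [ρ.support_normed_eq, mem_ball_zero_iff, Real.norm_eq_abs] at hy
    have hz' : |z| ≤ max R 0 := by
      by_contra hlt
      exact hz (hsupp z (not_le.1 hlt))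
    have := abs_add_le y z
    simp only at hyz
    rw [hyz] at this
    linarith
  · rw [← dist_eq_norm]
    exact ContDiffBump.dist_normed_convolution_le h1.continuous.aestronglyMeasurable
      fun y hy => (hu1 ((Metric.mem_ball.1 hy).trans_le hr2)).le
  · have : deriv (hg2.toSchwartzMap hg1) x =
        convolution k (deriv h) (ContinuousLinearMap.lsmul ℝ ℝ) volume x := (hgd x).deriv
    rw [this, ← dist_eq_norm]
    exact ContDiffBump.dist_normed_convolution_le hd1.aestronglyMeasurable
      fun y hy => (hu2 ((Metric.mem_ball.1 hy).trans_le hr3)).le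

/-- Transport is of first order, so mollifiers that converge in `C¹` with supports in a fixed
interval converge in the graph norm on the Fourier side. Their inverse transforms are Schwartz
functions, which lie in the domain of the closure. -/
theorem IsFlow.fourierCore_subset_domain {u : ℝ → ℝ} {L : ℝ} {φ : ℝ → ℝ → ℝ}
    (hv : FlowField (rescale u) L) (hφ : IsFlow (rescale u) φ) {f : L2} (hf : f ∈ fourierCore) :
    f ∈ (conjOp u).domain := by
  obtain ⟨h, h1, h2, h3⟩ := hf
  set v := rescale u
  have hvc : Continuous v := hv.contDiff.continuous
  have hL := hv.nonneg
  obtain ⟨R, hR, hsupp, happ⟩ := exists_schwartz_approx h1 h2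
  let q : ℝ → ℂ := fun x => v x * deriv h x + (deriv v x / 2 : ℝ) * h x
  have hq1 : Continuous q :=
    ((Complex.continuous_ofReal.comp hvc).mul (h1.continuous_deriv le_rfl)).add
      ((Complex.continuous_ofReal.comp (hv.continuous_deriv.div_const 2)).mul h1.continuous)
  have hq2 : HasCompactSupport q := h2.deriv.mul_left.add h2.mul_left
  have hdsupp : ∀ x, R < |x| → deriv h x = 0 := fun x hx => by
    have : h =ᶠ[𝓝 x] fun _ => 0 := by
      filter_upwards [(isOpen_lt continuous_const continuous_abs).mem_nhds hx] with y hy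
      exact hsupp y hy
    rw [this.deriv_eq, deriv_const]
  let Q : L2 := (hq1.memLp_of_hasCompactSupport hq2 : MemLp q 2 volume).toLp
  have hQ : Q =ᵐ[volume] q := MemLp.coeFn_toLp _
  refine LinearPMap.mem_domain_of_mem_graph (y := fourierL2.symm (Complex.I • Q)) ?_
  have hcl := (hφ.isUnitaryGroup_minimalOp hv).mem_closure_graph
    (p := (f, fourierL2.symm (Complex.I • Q)))
  refine hcl.2 ((Submodule.isClosed_topologicalClosure _).closure_subset
    (Metric.mem_closure_iff.2 fun ε hε => ?_))
  -- On `|x| ≤ R` the field is at most `L R` and half its derivative at most `L`; the summand `1`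
  -- serves the function itself, and `√(2R)` passes from sup norm to `L²`.
  set K := (L * R + L + 1) * √(2 * R) with hK
  obtain ⟨g, hg0, hg1, hg2⟩ := happ (ε / (K + 1)) (by positivity)
  have hgd : ∀ x, R < |x| → deriv g x = 0 := fun x hx => by
    have : ⇑g =ᶠ[𝓝 x] fun _ => 0 := by
      filter_upwards [(isOpen_lt continuous_const continuous_abs).mem_nhds hx] with y hy
      exact hg0 y hy
    rw [this.deriv_eq, deriv_const]
  set δ := ε / (K + 1)
  have hδ : 0 < δ := by positivity
  have e1 : ‖fourierL2 f - toL2 g‖ ≤ δ * √(2 * R) := by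
    refine norm_le_of_support_subset (g := fun x => h x - g x) hR hδ.le ?_
      (fun x => by rw [norm_sub_rev]; exact hg1 x) fun x hx => by simp [hsupp x hx, hg0 x hx]
    filter_upwards [Lp.coeFn_sub (fourierL2 f) (toL2 g), h3, IsFlow.coeFn_toL2 g] with x h4 h5 h6
    rw [h4, Pi.sub_apply, h5, h6]
  have e2 : ‖Q - toL2 (transport v g)‖ ≤ ((L * R + L) * δ) * √(2 * R) := by
    refine norm_le_of_support_subset (g := fun x => q x - transport v g x) hR (by positivity) ?_
      (fun x => ?_) fun x hx => ?_
    · filter_upwards [Lp.coeFn_sub Q (toL2 (transport v g)), hQ,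
        IsFlow.coeFn_toL2 (transport v g)] with x h4 h5 h6
      rw [h4, Pi.sub_apply, h5, h6]
    · have e : q x - transport v g x =
          -((v x : ℂ) * (deriv g x - deriv h x) + ((deriv v x / 2 : ℝ) : ℂ) * (g x - h x)) := by
        rw [transport_apply hv]; simp only [q]; ring
      rw [e, norm_neg]
      rcases le_or_gt |x| R with hx | hx
      · have b1 : |v x| ≤ L * R := (hv.abs_le x).trans (by gcongr)
        have b2 : |deriv v x / 2| ≤ L := by
          have := hv.bound₁ x
          rw [abs_div, abs_two]; linarith
        refine (norm_add_le _ _).trans ?_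
        rw [norm_mul, norm_mul, Complex.norm_real, Complex.norm_real, Real.norm_eq_abs,
          Real.norm_eq_abs, add_mul]
        gcongr
        · exact hg2 x
        · exact hg1 x
      · rw [hsupp x hx, hg0 x hx, hdsupp x hx, hgd x hx]
        simp; positivity
    · rw [transport_apply hv]
      simp only [q]
      rw [hsupp x hx, hg0 x hx, hdsupp x hx, hgd x hx]
      simp
  have hlt : K * δ < ε := by
    rw [mul_div_assoc', div_lt_iff₀ (by positivity)]
    nlinarith
  have hsq : 0 ≤ √(2 * R) := Real.sqrt_nonneg _
  refine ⟨_, mem_closure_graph_minimalOp (conjSchwartz u) (𝓕⁻ g), ?_⟩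
  have t1 : toL2 (𝓕⁻ g) = fourierL2.symm (toL2 g) := (fourierL2_symm_toL2 g).symm
  have t2 : toL2 (conjSchwartz u (𝓕⁻ g)) = fourierL2.symm (Complex.I • toL2 (transport v g)) := by
    rw [← map_smul, fourierL2_symm_toL2]
    have h7 := fourier_conjSchwartz hv (𝓕⁻ g)
    rw [FourierTransform.fourier_fourierInv_eq] at h7
    rw [← h7, FourierTransform.fourierInv_fourier_eq]
  rw [Prod.dist_eq, max_lt_iff]
  simp only [t1, t2]
  have t3 : f = fourierL2.symm (fourierL2 f) := (LinearIsometryEquiv.symm_apply_apply _ f).symm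
  rw [LinearIsometryEquiv.dist_map, t3, LinearIsometryEquiv.dist_map, dist_eq_norm, dist_eq_norm,
    ← smul_sub, norm_smul, Complex.norm_I, one_mul]
  refine ⟨?_, ?_⟩
  · refine lt_of_le_of_lt ?_ hlt
    calc _ ≤ δ * √(2 * R) := by simpa using e1
      _ ≤ _ := by rw [hK]; nlinarith [mul_nonneg hδ.le hsq, mul_nonneg hL hR]
  · refine lt_of_le_of_lt (e2.trans ?_) hlt
    rw [hK]; nlinarith [mul_nonneg hδ.le hsq]

theorem IsFlow.expI_conjOp {u : ℝ → ℝ} {L : ℝ} {φ : ℝ → ℝ → ℝ} (hv : FlowField (rescale u) L)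
    (hφ : IsFlow (rescale u) φ) : expI (conjOp u) = hφ.groupOp hv :=
  expI_eq (hφ.isUnitaryGroup_conjOp hv) dense_fourierCore fun _ hf τ =>
    hφ.fourierCore_subset_domain hv (hφ.groupOp_mem_fourierCore hv hf τ)

end NakReg

end

noncomputable section

namespace NakReg

open Set Filter Topology

/-! ### The Sobolev space in the Fourier representation -/

theorem memLp_mul_schwartz (h : L2) (φ : 𝓢(ℝ, ℂ)) : Integrable fun x => φ x * h x :=
  (φ.memLp 2 volume).integrable_mul (Lp.memLp h)

theorem locallyIntegrable_L2 (h : L2) : LocallyIntegrable h volume :=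
  (Lp.memLp h).locallyIntegrable (by norm_num)

theorem fourier_derivCLM (T : 𝓢'(ℝ, ℂ)) (φ : 𝓢(ℝ, ℂ)) :
    𝓕 (TemperedDistribution.derivCLM ℂ T) φ =
      (2 * Real.pi * Complex.I) • 𝓕 T (opQ φ) := by
  have h0 : TemperedDistribution.derivCLM ℂ T = LineDeriv.lineDerivOp (1 : ℝ) T := by
    ext ψ
    rw [TemperedDistribution.derivCLM_apply_apply, TemperedDistribution.lineDerivOp_apply_apply]
    congr 1
  rw [h0, TemperedDistribution.fourier_lineDerivOp_eq, _root_.smul_apply,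
    TemperedDistribution.smulLeftCLM_apply_apply]
  congr 2
  rw [opQ]
  congr 2
  ext x
  simp

/-- Transforming the distributional identity leaves two locally integrable functions with equal
integrals against all test functions, so they agree almost everywhere. -/
theorem isWeakDeriv_iff {h k : L2} : IsWeakDeriv h k ↔
    fourierL2 k =ᵐ[volume] fun x => (2 * Real.pi * Complex.I * x) * fourierL2 h x := by
  have hiff : IsWeakDeriv h k ↔ ∀ φ : 𝓢(ℝ, ℂ),
      ∫ x, φ x * ((2 * Real.pi * Complex.I * x) * fourierL2 h x) = ∫ x, φ x * fourierL2 k x := by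
    have hinj : IsWeakDeriv h k ↔ 𝓕 (TemperedDistribution.derivCLM ℂ (Lp.toTemperedDistribution h)) =
        𝓕 (Lp.toTemperedDistribution k : 𝓢'(ℝ, ℂ)) := by
      refine ⟨fun e => by rw [e], fun e => ?_⟩
      have := congrArg (fun T : 𝓢'(ℝ, ℂ) => 𝓕⁻ T) e
      simp only [FourierTransform.fourierInv_fourier_eq] at this
      exact this
    rw [hinj, DFunLike.ext_iff]
    refine forall_congr' fun φ => ?_
    rw [fourier_derivCLM, Lp.fourier_toTemperedDistribution_eq, Lp.fourier_toTemperedDistribution_eq,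
      Lp.toTemperedDistribution_apply, Lp.toTemperedDistribution_apply, ← integral_smul]
    have e1 : ∀ x : ℝ, (2 * Real.pi * Complex.I) • (opQ φ x • (𝓕 h : L2) x) =
        φ x * ((2 * Real.pi * Complex.I * x) * fourierL2 h x) := fun x => by
      rw [opQ, SchwartzMap.smulLeftCLM_apply_apply hasTemperateGrowth_id_complex]
      simp only [smul_eq_mul]
      change _ = φ x * ((2 * Real.pi * Complex.I * x) * (𝓕 h : L2) x)
      ring
    simp only [e1]
    rfl
  rw [hiff]
  constructor
  · intro H
    refine EventuallyEq.symm (ae_eq_of_integral_contDiff_smul_eq (μ := volume)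
      (f' := fourierL2 k) ?_ (locallyIntegrable_L2 _) ?_)
    · have hc : Continuous fun x : ℝ => (2 * Real.pi * Complex.I * x : ℂ) := by fun_prop
      exact ((locallyIntegrable_L2 (fourierL2 h)).continuous_mul hc)
    · intro g hg1 hg2
      have hg1' : ContDiff ℝ ∞ fun x => (g x : ℂ) := Complex.ofRealCLM.contDiff.comp hg1
      have hg2' : HasCompactSupport fun x => (g x : ℂ) := hg2.comp_left Complex.ofReal_zero
      exact H (hg2'.toSchwartzMap hg1')
  · intro H φ
    refine integral_congr_ae ?_
    filter_upwards [H] with x hx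
    rw [hx]

/-- The Fourier transform of an element of `ℋ¹`. -/
def ft (f : H1) : L2 := fourierL2 (fn f)

theorem fourierL2_weakDeriv (f : H1) :
    fourierL2 (weakDeriv f) =ᵐ[volume] fun x => (2 * Real.pi * Complex.I * x) * ft f x :=
  isWeakDeriv_iff.1 f.2

/-- The operator from `ℋ¹` to `L²` underlying the inclusion. -/
def fnL : H1 →L[ℂ] L2 := (WithLp.fstL 2 ℂ L2 L2).comp sobolevH1.subtypeL

def weakDerivL : H1 →L[ℂ] L2 := (WithLp.sndL 2 ℂ L2 L2).comp sobolevH1.subtypeL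

theorem ft_add (f g : H1) : ft (f + g) = ft f + ft g := map_add fourierL2 _ _

theorem ft_smul (c : ℂ) (f : H1) : ft (c • f) = c • ft f := map_smul fourierL2 _ _

theorem ft_injective : Function.Injective ft := by
  intro f g h
  have h1 : fn f = fn g := fourierL2.injective h
  have h2 : weakDeriv f = weakDeriv g := fourierL2.injective <| by
    ext1
    filter_upwards [fourierL2_weakDeriv f, fourierL2_weakDeriv g] with x hf hg
    rw [hf, hg, h]
  exact Subtype.ext (WithLp.ofLp_injective 2 (Prod.ext h1 h2))

/-- The symbol of `1 + d/dx`. -/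
def symb (x : ℝ) : ℂ := 1 + 2 * Real.pi * Complex.I * x

theorem norm_symb_sq (x : ℝ) : ‖symb x‖ ^ 2 = 1 + (2 * Real.pi * x) ^ 2 := by
  have : symb x = ((1 : ℝ) : ℂ) + ((2 * Real.pi * x : ℝ) : ℂ) * Complex.I := by
    simp only [symb]; push_cast; ring
  rw [this, Complex.norm_add_mul_I, Real.sq_sqrt (by positivity)]
  ring

theorem one_add_abs_le_norm_symb (x : ℝ) : 1 + |x| ≤ 2 * ‖symb x‖ := by
  refine le_of_sq_le_sq ?_ (by positivity)
  rw [mul_pow, norm_symb_sq]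
  have h1 : x ^ 2 ≤ (2 * Real.pi * x) ^ 2 := by
    rw [mul_pow]
    have : 1 ≤ (2 * Real.pi) ^ 2 := by nlinarith [Real.pi_gt_three]
    nlinarith [sq_nonneg x]
  nlinarith [sq_abs x, sq_nonneg (1 - |x|)]

theorem symb_ne_zero (x : ℝ) : symb x ≠ 0 := by
  have := one_add_abs_le_norm_symb x
  rw [← norm_pos_iff]
  linarith [abs_nonneg x]

theorem continuous_symb : Continuous symb := by unfold symb; fun_prop

/-- The isomorphism from `ℋ¹` to `L²` given by `1 + d/dx`, in the Fourier representation. -/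
def toSymb : H1 →L[ℂ] L2 :=
  (fourierL2.toContinuousLinearEquiv : L2 →L[ℂ] L2).comp (fnL + weakDerivL)

theorem coeFn_toSymb (f : H1) : toSymb f =ᵐ[volume] fun x => symb x * ft f x := by
  have h : toSymb f = ft f + fourierL2 (weakDeriv f) := map_add fourierL2 _ _
  rw [h]
  filter_upwards [Lp.coeFn_add (ft f) (fourierL2 (weakDeriv f)), fourierL2_weakDeriv f] with x h1 h2
  rw [h1, Pi.add_apply, h2, symb]
  ring

theorem coeFn_ft (f : H1) : ft f =ᵐ[volume] fun x => (symb x)⁻¹ * toSymb f x := by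
  filter_upwards [coeFn_toSymb f] with x hx
  rw [hx, inv_mul_cancel_left₀ (symb_ne_zero x)]

theorem norm_toSymb_le (f : H1) : ‖toSymb f‖ ≤ 2 * ‖f‖ := by
  have h : toSymb f = fourierL2 (fn f + weakDeriv f) := rfl
  rw [h, LinearIsometryEquiv.norm_map]
  have h1 := H1.norm_sq f
  have h2 : ‖fn f‖ ≤ ‖f‖ := le_of_sq_le_sq (by nlinarith [sq_nonneg ‖weakDeriv f‖]) (norm_nonneg _)
  have h3 : ‖weakDeriv f‖ ≤ ‖f‖ := le_of_sq_le_sq (by nlinarith [sq_nonneg ‖fn f‖]) (norm_nonneg _)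
  linarith [norm_add_le (fn f) (weakDeriv f)]

/-- Both `1 / symb` and `2πix / symb` are bounded multipliers. They provide the function and its
weak derivative, hence an element of `ℋ¹`. -/
theorem exists_ofSymb : ∃ R : L2 →L[ℂ] H1, ∀ g, ft (R g) =ᵐ[volume] fun x => (symb x)⁻¹ * g x := by
  have hm : Continuous fun x => (symb x)⁻¹ := continuous_symb.inv₀ symb_ne_zero
  obtain ⟨S₀, hS₀, -⟩ := exists_mulOp (b := fun x => (symb x)⁻¹) (C := 2)
    hm.aestronglyMeasurable fun x => by
      rw [norm_inv]
      have := one_add_abs_le_norm_symb x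
      refine inv_le_of_inv_le₀ (by norm_num) ?_
      linarith [abs_nonneg x]
  have hc : Continuous fun x : ℝ => (2 * Real.pi * Complex.I * x : ℂ) := by fun_prop
  obtain ⟨S₁, hS₁, -⟩ := exists_mulOp (b := fun x => (2 * Real.pi * Complex.I * x) * (symb x)⁻¹)
    (C := 1) (hc.mul hm).aestronglyMeasurable fun x => by
      rw [norm_mul, norm_inv, ← div_eq_mul_inv, div_le_one (norm_pos_iff.2 (symb_ne_zero x))]
      refine le_of_sq_le_sq ?_ (norm_nonneg _)
      rw [norm_symb_sq]
      have : ‖(2 * Real.pi * Complex.I * x : ℂ)‖ ^ 2 = (2 * Real.pi * x) ^ 2 := by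
        simp [mul_pow]
      linarith
  let F : L2 →L[ℂ] L2 := (fourierL2.symm.toContinuousLinearEquiv : L2 →L[ℂ] L2)
  let P : L2 →L[ℂ] WithLp 2 (L2 × L2) :=
    ((WithLp.prodContinuousLinearEquiv 2 ℂ L2 L2).symm : L2 × L2 →L[ℂ] WithLp 2 (L2 × L2)).comp
      ((F.comp S₀).prod (F.comp S₁))
  have hP : ∀ g, P g ∈ sobolevH1 := fun g => by
    change IsWeakDeriv (fourierL2.symm (S₀ g)) (fourierL2.symm (S₁ g))
    rw [isWeakDeriv_iff, LinearIsometryEquiv.apply_symm_apply, LinearIsometryEquiv.apply_symm_apply]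
    filter_upwards [hS₀ g, hS₁ g] with x h0 h1
    rw [h0, h1, mul_assoc]
  let W : L2 →L[ℂ] H1 := P.codRestrict sobolevH1 hP
  refine ⟨W, fun g => ?_⟩
  have : ft (W g) = fourierL2 (fourierL2.symm (S₀ g)) := rfl
  rw [this, LinearIsometryEquiv.apply_symm_apply]
  exact hS₀ g

/-- The inverse of `toSymb`. -/
def ofSymb : L2 →L[ℂ] H1 := exists_ofSymb.choose

theorem coeFn_ft_ofSymb (g : L2) : ft (ofSymb g) =ᵐ[volume] fun x => (symb x)⁻¹ * g x :=
  exists_ofSymb.choose_spec g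

theorem ofSymb_toSymb (f : H1) : ofSymb (toSymb f) = f := by
  apply ft_injective
  ext1
  filter_upwards [coeFn_ft_ofSymb (toSymb f), coeFn_ft f] with x h1 h2
  rw [h1, h2]

theorem ft_toH1 (φ : 𝓢(ℝ, ℂ)) : ft (toH1 φ) = toL2 (𝓕 φ) := fourierL2_toL2 φ

theorem coeFn_ft_toH1 (φ : 𝓢(ℝ, ℂ)) : ft (toH1 φ) =ᵐ[volume] (𝓕 φ : 𝓢(ℝ, ℂ)) := by
  rw [ft_toH1]; exact IsFlow.coeFn_toL2 _

/-! ### The action of the groups on `ℋ¹` -/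

theorem restrictH1_spec {S : L2 →L[ℂ] L2} (h : ∃ W : H1 →L[ℂ] H1, ∀ f, fn (W f) = S (fn f))
    (f : H1) : fn (restrictH1 S f) = S (fn f) := by
  rw [restrictH1, dif_pos h]
  exact h.choose_spec f

namespace IsFlow

variable {v : ℝ → ℝ} {L : ℝ} {φ : ℝ → ℝ → ℝ}

/-- After conjugation by `symb` the operator is a weighted composition in `L²` with the extra factor
`symb x / symb (φ (-τ) x)`. This is at most `exp (L|τ|)`, as the flow fixes `0` and distorts
distances by no more than that. -/
theorem exists_restrict_groupOp (hv : FlowField v L) (hφ : IsFlow v φ) (τ : ℝ) :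
    ∃ W : H1 →L[ℂ] H1, ∀ f, fn (W f) = hφ.groupOp hv τ (fn f) := by
  have hsymb : ∀ x, ‖symb x‖ ≤ Real.exp (L * |τ|) * ‖symb (φ (-τ) x)‖ := fun x => by
    refine le_of_sq_le_sq ?_ (by positivity)
    rw [mul_pow, norm_symb_sq, norm_symb_sq]
    have h1 := hφ.le_abs_apply hv (-τ) x
    rw [abs_neg] at h1
    have h2 : x ^ 2 ≤ Real.exp (L * |τ|) ^ 2 * (φ (-τ) x) ^ 2 := by
      rw [← sq_abs x, ← sq_abs (φ (-τ) x), ← mul_pow]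
      gcongr
    have h3 : 1 ≤ Real.exp (L * |τ|) ^ 2 :=
      one_le_pow₀ (Real.one_le_exp (mul_nonneg hv.nonneg (abs_nonneg τ)))
    rw [mul_pow, mul_pow, mul_add, mul_one]
    have h4 := mul_le_mul_of_nonneg_left h2 (sq_nonneg (2 * Real.pi))
    linarith
  have hc : Continuous fun x => symb x * (symb (φ (-τ) x))⁻¹ * (sqrtJac v φ (-τ) x : ℂ) :=
    (continuous_symb.mul ((continuous_symb.comp (hφ.continuous_space hv _)).inv₀
      fun x => symb_ne_zero _)).mul (Complex.continuous_ofReal.comp (hφ.continuous_sqrtJac hv _))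
  obtain ⟨S, hS, -⟩ := exists_weightedComp (C := Real.exp (L * |τ|)) (Real.exp_pos _).le
    hc.aestronglyMeasurable (hφ.quasiMeasurePreserving hv (-τ)) fun g => by
      rw [← hφ.lintegral_comp hv (-τ) g, ← lintegral_const_mul' _ _ ENNReal.ofReal_ne_top]
      refine lintegral_mono fun x => ?_
      rw [← mul_assoc]
      gcongr
      rw [← ofReal_norm, ← ENNReal.ofReal_pow (norm_nonneg _), ← ENNReal.ofReal_mul (by positivity)]
      apply ENNReal.ofReal_le_ofReal
      rw [norm_mul, norm_mul, norm_inv, Complex.norm_real, Real.norm_eq_abs, mul_pow, sq_abs]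
      gcongr
      rw [← div_eq_mul_inv, div_le_iff₀ (norm_pos_iff.2 (symb_ne_zero _))]
      exact hsymb x
  refine ⟨ofSymb.comp (S.comp toSymb), fun f => fourierL2.injective ?_⟩
  rw [hφ.fourier_groupOp hv]
  ext1
  filter_upwards [coeFn_ft_ofSymb (S (toSymb f)), hS (toSymb f),
    (hφ.quasiMeasurePreserving hv (-τ)).ae_eq_comp (coeFn_toSymb f),
    hφ.coeFn_flowOp hv (-τ) (fourierL2 (fn f))] with x h1 h2 h3 h4
  change ft (ofSymb (S (toSymb f))) x = _
  simp only [Function.comp_apply] at h3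
  rw [h1, h2, h3, h4, ft]
  have := symb_ne_zero x
  have := symb_ne_zero (φ (-τ) x)
  field_simp

theorem coeFn_ft_expH1 {u : ℝ → ℝ} (hv : FlowField (rescale u) L) (hφ : IsFlow (rescale u) φ)
    (τ : ℝ) (f : H1) : ft (expH1 (conjOp u) τ f) =ᵐ[volume]
      fun x => (sqrtJac (rescale u) φ (-τ) x : ℂ) * ft f (φ (-τ) x) := by
  have h1 : fn (expH1 (conjOp u) τ f) = hφ.groupOp hv τ (fn f) := by
    rw [expH1, hφ.expI_conjOp hv]
    exact restrictH1_spec (hφ.exists_restrict_groupOp hv τ) f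
  rw [ft, h1, hφ.fourier_groupOp hv]
  exact hφ.coeFn_flowOp hv (-τ) _

end IsFlow

theorem evolve_apply (A : L2 →ₗ.[ℂ] L2) (T : H1 →L[ℂ] Hm1) (τ : ℝ) (f g : H1) :
    evolve A T τ f g = T (expH1 A (-τ) f) (expH1 A (-τ) g) := rfl

end NakReg

end

noncomputable section

namespace NakReg

open Set Filter Topology

/-! ### Hilbert–Schmidt operators are compact -/

/-- The finite rank truncations converge in norm: by Cauchy–Schwarz and Bessel, the remainder is
controlled by the tail of `∑ ‖B eᵢ‖²`. The target is only a Banach space, as suits `ℋ⁻¹` with its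
dual norm. -/
theorem isCompactOperator_of_sum_sq_le {E F : Type*} [NormedAddCommGroup E] [InnerProductSpace ℂ E]
    [CompleteSpace E] [NormedAddCommGroup F] [NormedSpace ℂ F] [CompleteSpace F] {ι : Type*}
    (e : HilbertBasis ι ℂ E) (B : E →L[ℂ] F) {M : ℝ} (h : ∀ s : Finset ι, ∑ i ∈ s, ‖B (e i)‖ ^ 2 ≤ M) :
    IsCompactOperator B := by
  classical
  have hsum : Summable fun i => ‖B (e i)‖ ^ 2 :=
    summable_of_sum_le (fun i => by positivity) h
  let T : Finset ι → E →L[ℂ] F := fun s =>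
    ∑ i ∈ s, (innerSL ℂ (e i)).smulRight (B (e i))
  have hT : ∀ s f, T s f = ∑ i ∈ s, ⟪e i, f⟫_ℂ • B (e i) := fun s f => by
    simp [T]
  have hcomp : ∀ s, IsCompactOperator (T s) := fun s => by
    have hr : ∀ i, IsCompactOperator ((innerSL ℂ (e i)).smulRight (B (e i))) := fun i =>
      (isCompactOperator_of_locallyCompactSpace_rng
        (ContinuousLinearMap.toSpanSingleton ℂ (B (e i)))).comp_clm (innerSL ℂ (e i))
    exact Submodule.sum_mem (compactOperator (RingHom.id ℂ) E F) (fun i _ => hr i)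
  refine isCompactOperator_of_tendsto (l := atTop) (F := T) ?_ (Eventually.of_forall hcomp)
  rw [Metric.tendsto_atTop]
  intro ε hε
  obtain ⟨s, hs⟩ := summable_iff_vanishing_norm.1 hsum ((ε / 2) ^ 2) (by positivity)
  refine ⟨s, fun t hst => ?_⟩
  rw [dist_eq_norm, norm_sub_rev]
  refine lt_of_le_of_lt (ContinuousLinearMap.opNorm_le_bound _ (by positivity) fun f => ?_)
    (half_lt_self hε)
  have hlim : Tendsto (fun r : Finset ι => ‖∑ i ∈ r, ⟪e i, f⟫_ℂ • B (e i) - T t f‖) atTop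
      (𝓝 ‖(B - T t) f‖) := by
    have h1 := e.hasSum_repr f
    have h2 : HasSum (fun i => ⟪e i, f⟫_ℂ • B (e i)) (B f) := by
      have := h1.mapL B
      simpa only [map_smul, HilbertBasis.repr_apply_apply] using this
    exact (h2.sub_const _).norm
  refine le_of_tendsto hlim ?_
  filter_upwards [eventually_ge_atTop t] with r hr
  rw [hT, ← Finset.sum_sdiff hr, add_sub_cancel_right]
  have hd : Disjoint (r \ t) s := (Finset.sdiff_disjoint).mono_right hst
  have h1 := hs _ hd
  rw [Real.norm_of_nonneg (Finset.sum_nonneg fun i _ => by positivity)] at h1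
  have h2 := e.orthonormal.sum_inner_products_le f (s := r \ t)
  refine le_of_sq_le_sq ?_ (by positivity)
  calc ‖∑ i ∈ r \ t, ⟪e i, f⟫_ℂ • B (e i)‖ ^ 2
      ≤ (∑ i ∈ r \ t, ‖⟪e i, f⟫_ℂ‖ * ‖B (e i)‖) ^ 2 := by
        gcongr
        exact norm_sum_le_of_le _ fun i _ => (norm_smul_le _ _)
    _ ≤ (∑ i ∈ r \ t, ‖⟪e i, f⟫_ℂ‖ ^ 2) * ∑ i ∈ r \ t, ‖B (e i)‖ ^ 2 :=
        Finset.sum_mul_sq_le_sq_mul_sq _ _ _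
    _ ≤ ‖f‖ ^ 2 * (ε / 2) ^ 2 := by gcongr
    _ = _ := by ring

/-! ### Kernel operators from `ℋ¹` to `ℋ⁻¹` in the Fourier representation -/

/-- The discriminant of the nonnegative quadratic `t ↦ ∫ (t f + g)²` is not positive. -/
theorem integral_mul_sq_le {f g : ℝ → ℝ} (hf : AEStronglyMeasurable f volume)
    (hg : AEStronglyMeasurable g volume) (hf2 : Integrable fun x => f x ^ 2)
    (hg2 : Integrable fun x => g x ^ 2) :
    Integrable (fun x => f x * g x) ∧
      (∫ x, f x * g x) ^ 2 ≤ (∫ x, f x ^ 2) * ∫ x, g x ^ 2 := by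
  have hfm : MemLp f 2 volume := (memLp_two_iff_integrable_sq hf).2 hf2
  have hgm : MemLp g 2 volume := (memLp_two_iff_integrable_sq hg).2 hg2
  have hfg : Integrable fun x => f x * g x := hfm.integrable_mul hgm
  refine ⟨hfg, ?_⟩
  have h : ∀ t : ℝ, 0 ≤ (∫ x, f x ^ 2) * (t * t) + (2 * ∫ x, f x * g x) * t + ∫ x, g x ^ 2 := by
    intro t
    have : ∫ x, (t * f x + g x) ^ 2 =
        (∫ x, f x ^ 2) * (t * t) + (2 * ∫ x, f x * g x) * t + ∫ x, g x ^ 2 := by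
      have e : ∀ x, (t * f x + g x) ^ 2 = (t * t) * f x ^ 2 + (2 * t) * (f x * g x) + g x ^ 2 :=
        fun x => by ring
      have hA : Integrable fun x => (t * t) * f x ^ 2 + (2 * t) * (f x * g x) :=
        (hf2.const_mul _).add (hfg.const_mul _)
      simp only [e]
      rw [integral_add hA hg2,
        integral_add (hf2.const_mul _) (hfg.const_mul _), integral_const_mul, integral_const_mul]
      ring
    rw [← this]
    exact integral_nonneg fun _ => sq_nonneg _
  have := discrim_le_zero h
  rw [discrim] at this
  nlinarith

/-- The weight `(1 + |x|)^s`. -/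
def wt (s x : ℝ) : ℝ := (1 + |x|) ^ s

theorem wt_pos (s x : ℝ) : 0 < wt s x := Real.rpow_pos_of_pos (by positivity) s

theorem continuous_wt (s : ℝ) : Continuous (wt s) :=
  (by fun_prop : Continuous fun x : ℝ => 1 + |x|).rpow_const fun x => Or.inl (by positivity)

/-- The weight relative to the symbol of `1 + d/dx`. -/
def relWt (s x : ℝ) : ℝ := wt s x * ‖symb x‖⁻¹

theorem relWt_nonneg (s x : ℝ) : 0 ≤ relWt s x := mul_nonneg (wt_pos s x).le (by positivity)

theorem continuous_relWt (s : ℝ) : Continuous (relWt s) :=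
  (continuous_wt s).mul (continuous_symb.norm.inv₀ fun x => norm_ne_zero_iff.2 (symb_ne_zero x))

/-- This is where the threshold `1/2` enters: `relWt s` is `O((1 + |x|)^(s - 1))`, whose square is
integrable when `2 - 2s > 1`. -/
theorem integrable_relWt_sq {s : ℝ} (hs : s < 1 / 2) : Integrable fun x => relWt s x ^ 2 := by
  have h1 := (integrable_one_add_norm (E := ℝ) (μ := volume) (r := 2 - 2 * s)
    (by simp; linarith)).const_mul 4
  refine h1.mono' ((continuous_relWt s).pow 2).aestronglyMeasurable (ae_of_all _ fun x => ?_)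
  rw [Real.norm_of_nonneg (by positivity)]
  have h2 : relWt s x ≤ 2 * (1 + |x|) ^ (s - 1) := by
    rw [Real.rpow_sub (by positivity), Real.rpow_one, relWt, wt, mul_div_assoc', mul_comm (2 : ℝ),
      mul_div_assoc]
    gcongr
    rw [le_div_iff₀ (by positivity), inv_mul_le_iff₀ (norm_pos_iff.2 (symb_ne_zero x)), mul_comm]
    exact one_add_abs_le_norm_symb x
  calc relWt s x ^ 2 ≤ (2 * (1 + |x|) ^ (s - 1)) ^ 2 := by
        gcongr; exact relWt_nonneg s x
    _ = _ := by
        rw [mul_pow, ← Real.rpow_natCast ((1 + |x|) ^ (s - 1)), ← Real.rpow_mul (by positivity), Real.norm_eq_abs]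
        norm_num
        congr 1
        ring

/-- The `L²` norm of `relWt s`. -/
def wtConst (s : ℝ) : ℝ := √(∫ x, relWt s x ^ 2)

theorem wtConst_sq (s : ℝ) : wtConst s ^ 2 = ∫ x, relWt s x ^ 2 :=
  Real.sq_sqrt (integral_nonneg fun _ => sq_nonneg _)

theorem wtConst_nonneg (s : ℝ) : 0 ≤ wtConst s := Real.sqrt_nonneg _

theorem norm_ft_ae (f : H1) (s : ℝ) :
    (fun x => wt s x * ‖ft f x‖) =ᵐ[volume] fun x => relWt s x * ‖toSymb f x‖ := by
  filter_upwards [coeFn_ft f] with x hx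
  rw [hx, norm_mul, norm_inv, relWt, mul_assoc]

theorem integrable_wt_ft {s : ℝ} (hs : s < 1 / 2) (f : H1) :
    Integrable fun x => wt s x * ‖ft f x‖ := by
  refine Integrable.congr ?_ (norm_ft_ae f s).symm
  exact (integral_mul_sq_le (continuous_relWt s).aestronglyMeasurable
    (Lp.aestronglyMeasurable _).norm (integrable_relWt_sq hs) (integrable_norm_sq_L2 _)).1

theorem integral_wt_ft_le {s : ℝ} (hs : s < 1 / 2) (f : H1) :
    ∫ x, wt s x * ‖ft f x‖ ≤ 2 * wtConst s * ‖f‖ := by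
  rw [integral_congr_ae (norm_ft_ae f s)]
  have h := (integral_mul_sq_le (continuous_relWt s).aestronglyMeasurable
    (Lp.aestronglyMeasurable (toSymb f)).norm (integrable_relWt_sq hs) (integrable_norm_sq_L2 _)).2
  rw [← norm_sq_L2, ← wtConst_sq, ← mul_pow] at h
  have h1 := wtConst_nonneg s
  calc _ ≤ wtConst s * ‖toSymb f‖ := le_of_sq_le_sq h (by positivity)
    _ ≤ wtConst s * (2 * ‖f‖) := by gcongr; exact norm_toSymb_le f
    _ = _ := by ring

/-- Continuous kernels dominated by `(1 + |x|)^s (1 + |y|)^s`, `s < 1/2`. -/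
structure IsKernel (s C : ℝ) (K : ℝ × ℝ → ℂ) : Prop where
  lt_half : s < 1 / 2
  continuous : Continuous K
  bound : ∀ p, ‖K p‖ ≤ C * (wt s p.1 * wt s p.2)

/-- The sesquilinear form with kernel `K` in the Fourier representation. -/
def kernelForm (K : ℝ × ℝ → ℂ) (f g : H1) : ℂ :=
  ∫ p : ℝ × ℝ, K p * (starRingEnd ℂ (ft g p.1) * ft f p.2)

namespace IsKernel

variable {s C : ℝ} {K : ℝ × ℝ → ℂ}

theorem nonneg (hK : IsKernel s C K) : 0 ≤ C := by
  have h := (norm_nonneg _).trans (hK.bound 0)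
  have := mul_pos (wt_pos s (0 : ℝ × ℝ).1) (wt_pos s (0 : ℝ × ℝ).2)
  exact nonneg_of_mul_nonneg_left h this

theorem norm_integrand_le (hK : IsKernel s C K) (f g : H1) (p : ℝ × ℝ) :
    ‖K p * (starRingEnd ℂ (ft g p.1) * ft f p.2)‖ ≤
      C * ((wt s p.1 * ‖ft g p.1‖) * (wt s p.2 * ‖ft f p.2‖)) := by
  rw [norm_mul, norm_mul, RCLike.norm_conj]
  calc _ ≤ C * (wt s p.1 * wt s p.2) * (‖ft g p.1‖ * ‖ft f p.2‖) := by gcongr; exact hK.bound p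
    _ = _ := by ring

theorem integrable (hK : IsKernel s C K) (f g : H1) :
    Integrable fun p : ℝ × ℝ => K p * (starRingEnd ℂ (ft g p.1) * ft f p.2) := by
  have h1 := ((integrable_wt_ft hK.lt_half g).mul_prod (integrable_wt_ft hK.lt_half f)).const_mul C
  refine h1.mono' ?_ (ae_of_all _ fun p => hK.norm_integrand_le f g p)
  refine hK.continuous.aestronglyMeasurable.mul (AEStronglyMeasurable.mul ?_ ?_)
  · exact (Complex.continuous_conj.comp_aestronglyMeasurable
      (Lp.aestronglyMeasurable (ft g))).comp_fst
  · exact (Lp.aestronglyMeasurable (ft f)).comp_snd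

theorem norm_kernelForm_le (hK : IsKernel s C K) (f g : H1) :
    ‖kernelForm K f g‖ ≤ C * (2 * wtConst s) ^ 2 * ‖f‖ * ‖g‖ := by
  have hC := hK.nonneg
  have h1 := ((integrable_wt_ft hK.lt_half g).mul_prod (integrable_wt_ft hK.lt_half f)).const_mul C
  refine (norm_integral_le_of_norm_le h1 (ae_of_all _ fun p => hK.norm_integrand_le f g p)).trans ?_
  rw [integral_const_mul]
  have h2 := integral_prod_mul (μ := (volume : Measure ℝ)) (ν := (volume : Measure ℝ))
    (fun x => wt s x * ‖ft g x‖) (fun y => wt s y * ‖ft f y‖)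
  rw [h2]
  have h3 := integral_wt_ft_le hK.lt_half f
  have h4 := integral_wt_ft_le hK.lt_half g
  have h5 := wtConst_nonneg s
  have h6 : 0 ≤ ∫ x, wt s x * ‖ft f x‖ :=
    integral_nonneg fun x => mul_nonneg (wt_pos s x).le (norm_nonneg _)
  calc _ ≤ C * ((2 * wtConst s * ‖g‖) * (2 * wtConst s * ‖f‖)) := by gcongr
    _ = _ := by ring

theorem ae_fst {P : ℝ → Prop} (h : ∀ᵐ x, P x) : ∀ᵐ p : ℝ × ℝ, P p.1 :=
  Measure.quasiMeasurePreserving_fst.ae h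

theorem ae_snd {P : ℝ → Prop} (h : ∀ᵐ x, P x) : ∀ᵐ p : ℝ × ℝ, P p.2 :=
  Measure.quasiMeasurePreserving_snd.ae h

/-- The operator `ℋ¹ → ℋ⁻¹` with kernel `K` in the Fourier representation. -/
def op (hK : IsKernel s C K) : H1 →L[ℂ] Hm1 :=
  LinearMap.mkContinuous₂ (σ₂₃ := starRingEnd ℂ) (σ₁₃ := RingHom.id ℂ)
    (LinearMap.mk₂'ₛₗ (RingHom.id ℂ) (starRingEnd ℂ) (kernelForm K)
      (fun f f' g => by
        simp only [kernelForm]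
        rw [← integral_add (hK.integrable f g) (hK.integrable f' g)]
        refine integral_congr_ae ?_
        filter_upwards [ae_snd (Lp.coeFn_add (ft f) (ft f'))] with p hp
        rw [ft_add, hp, Pi.add_apply]
        ring)
      (fun c f g => by
        simp only [kernelForm]
        rw [← integral_smul]
        refine integral_congr_ae ?_
        filter_upwards [ae_snd (Lp.coeFn_smul c (ft f))] with p hp
        rw [ft_smul, hp, Pi.smul_apply, smul_eq_mul, smul_eq_mul, RingHom.id_apply]
        ring)
      (fun f g g' => by
        simp only [kernelForm]
        rw [← integral_add (hK.integrable f g) (hK.integrable f g')]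
        refine integral_congr_ae ?_
        filter_upwards [ae_fst (Lp.coeFn_add (ft g) (ft g'))] with p hp
        rw [ft_add, hp, Pi.add_apply, map_add]
        ring)
      (fun c f g => by
        simp only [kernelForm]
        rw [← integral_smul]
        refine integral_congr_ae ?_
        filter_upwards [ae_fst (Lp.coeFn_smul c (ft g))] with p hp
        rw [ft_smul, hp, Pi.smul_apply, smul_eq_mul, smul_eq_mul, map_mul]
        ring))
    (C * (2 * wtConst s) ^ 2) hK.norm_kernelForm_le

theorem op_apply (hK : IsKernel s C K) (f g : H1) : hK.op f g = kernelForm K f g := rfl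

theorem norm_le (hK : IsKernel s C K) {B : H1 →L[ℂ] Hm1} (hB : ∀ f g, B f g = kernelForm K f g) :
    ‖B‖ ≤ C * (2 * wtConst s) ^ 2 := by
  have hC := hK.nonneg
  refine ContinuousLinearMap.opNorm_le_bound₂ _ (by positivity) fun f g => ?_
  rw [hB]
  exact hK.norm_kernelForm_le f g

/-- Write `k x` for the conjugated slice `y ↦ K(x, y) / symb y`. In the `L²` picture the image of
`eᵢ` has squared norm at most `4 ∫ |⟪k x, eᵢ⟫|² / ‖symb x‖²`. Bessel's inequality sums this over `i`
to `4 ∫ ‖k x‖² / ‖symb x‖²`, which is finite because `‖k x‖` grows at most like `wt s x`. -/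
theorem isCompactOperator_op (hK : IsKernel s C K) : IsCompactOperator hK.op := by
  have hC := hK.nonneg
  obtain ⟨w, e, -⟩ := exists_hilbertBasis ℂ L2
  have hcont : ∀ x, Continuous fun y => starRingEnd ℂ (K (x, y) * (symb y)⁻¹) := fun x =>
    Complex.continuous_conj.comp ((hK.continuous.comp (by fun_prop)).mul
      (continuous_symb.inv₀ symb_ne_zero))
  have hb : ∀ x y, ‖starRingEnd ℂ (K (x, y) * (symb y)⁻¹)‖ ≤ C * wt s x * relWt s y := fun x y => by
    rw [RCLike.norm_conj, norm_mul, norm_inv, relWt]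
    calc _ ≤ C * (wt s x * wt s y) * ‖symb y‖⁻¹ := by gcongr; exact hK.bound (x, y)
      _ = _ := by ring
  have hint : ∀ x, Integrable fun y => (C * wt s x * relWt s y) ^ 2 := fun x => by
    simp only [mul_pow (C * wt s x)]
    exact (integrable_relWt_sq hK.lt_half).const_mul _
  have hmem : ∀ x, MemLp (fun y => starRingEnd ℂ (K (x, y) * (symb y)⁻¹)) 2 volume := fun x => by
    refine (memLp_two_iff_integrable_sq_norm (hcont x).aestronglyMeasurable).2 ?_
    refine (hint x).mono' ((hcont x).norm.pow 2).aestronglyMeasurable (ae_of_all _ fun y => ?_)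
    rw [Real.norm_of_nonneg (by positivity)]
    gcongr
    exact hb x y
  let k : ℝ → L2 := fun x => (hmem x).toLp
  have hk : ∀ x, ‖k x‖ ^ 2 ≤ (C * wtConst s * wt s x) ^ 2 := fun x => by
    refine (norm_sq_le_of_memLp (hint x) ?_).trans (le_of_eq ?_)
    · filter_upwards [(hmem x).coeFn_toLp] with y hy
      rw [hy]
      exact hb x y
    · simp only [mul_pow (C * wt s x)]
      rw [integral_const_mul, ← wtConst_sq]
      ring
  have hinner : ∀ x f, ⟪k x, f⟫_ℂ = ∫ y, K (x, y) * ((symb y)⁻¹ * f y) := fun x f => by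
    rw [L2.inner_def]
    refine integral_congr_ae ?_
    filter_upwards [(hmem x).coeFn_toLp] with y hy
    simp only [k]
    rw [hy, RCLike.inner_apply, Complex.conj_conj]
    ring
  have hmeas : ∀ f : L2, AEStronglyMeasurable (fun x => ⟪k x, f⟫_ℂ) volume := fun f => by
    simp only [hinner]
    exact AEStronglyMeasurable.integral_prod_right'
      (f := fun p : ℝ × ℝ => K p * ((symb p.2)⁻¹ * f p.2))
      (hK.continuous.aestronglyMeasurable.mul
        (((continuous_symb.inv₀ symb_ne_zero).aestronglyMeasurable.mul
          (Lp.aestronglyMeasurable f)).comp_snd))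
  have hsq : ∀ f : L2, Integrable fun x => (‖⟪k x, f⟫_ℂ‖ * ‖symb x‖⁻¹) ^ 2 := fun f => by
    refine (((integrable_relWt_sq hK.lt_half).const_mul ((C * wtConst s * ‖f‖) ^ 2))).mono'
      (((hmeas f).norm.mul (continuous_symb.norm.inv₀ fun x =>
        norm_ne_zero_iff.2 (symb_ne_zero x)).aestronglyMeasurable).pow 2) (ae_of_all _ fun x => ?_)
    rw [Real.norm_of_nonneg (by positivity), ← mul_pow, relWt]
    have h1 := norm_inner_le_norm (𝕜 := ℂ) (k x) f
    have h2 : ‖k x‖ ≤ C * wtConst s * wt s x := le_of_sq_le_sq (hk x) (by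
      have := wtConst_nonneg s; have := wt_pos s x; positivity)
    have h3 : ‖⟪k x, f⟫_ℂ‖ ≤ C * wtConst s * wt s x * ‖f‖ := h1.trans (by gcongr)
    calc _ ≤ (C * wtConst s * wt s x * ‖f‖ * ‖symb x‖⁻¹) ^ 2 := by gcongr
      _ = _ := by ring
  have hform : ∀ (f : L2) (g : H1), ‖hK.op (ofSymb f) g‖ ≤
      2 * √(∫ x, (‖⟪k x, f⟫_ℂ‖ * ‖symb x‖⁻¹) ^ 2) * ‖g‖ := fun f g => by
    have e1 : hK.op (ofSymb f) g = ∫ x, starRingEnd ℂ (ft g x) * ⟪k x, f⟫_ℂ := by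
      rw [op_apply, kernelForm, Measure.volume_eq_prod, integral_prod _ (hK.integrable _ _)]
      refine integral_congr_ae (ae_of_all _ fun x => ?_)
      simp only
      rw [hinner, ← integral_const_mul]
      refine integral_congr_ae ?_
      filter_upwards [coeFn_ft_ofSymb f] with y hy
      rw [hy]
      ring
    have h1 := (integral_mul_sq_le (f := fun x => ‖⟪k x, f⟫_ℂ‖ * ‖symb x‖⁻¹)
      (g := fun x => ‖toSymb g x‖) ((hmeas f).norm.mul (continuous_symb.norm.inv₀ fun x =>
        norm_ne_zero_iff.2 (symb_ne_zero x)).aestronglyMeasurable)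
      (Lp.aestronglyMeasurable (toSymb g)).norm (hsq f) (integrable_norm_sq_L2 _)).2
    rw [← norm_sq_L2, ← Real.sq_sqrt (integral_nonneg fun _ => sq_nonneg _), ← mul_pow] at h1
    have h2 := le_of_sq_le_sq h1 (by positivity)
    rw [e1]
    refine (norm_integral_le_integral_norm _).trans ?_
    have e2 : ∫ x, ‖starRingEnd ℂ (ft g x) * ⟪k x, f⟫_ℂ‖ =
        ∫ x, (‖⟪k x, f⟫_ℂ‖ * ‖symb x‖⁻¹) * ‖toSymb g x‖ := by
      refine integral_congr_ae ?_
      filter_upwards [coeFn_ft g] with x hx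
      rw [norm_mul, RCLike.norm_conj, hx, norm_mul, norm_inv]
      ring
    rw [e2]
    refine h2.trans ?_
    calc _ ≤ √(∫ x, (‖⟪k x, f⟫_ℂ‖ * ‖symb x‖⁻¹) ^ 2) * (2 * ‖g‖) := by
          gcongr; exact norm_toSymb_le g
      _ = _ := by ring
  have hcomp : IsCompactOperator (hK.op.comp ofSymb) := by
    refine isCompactOperator_of_sum_sq_le e _ (M := 4 * ((C * wtConst s) ^ 2 * wtConst s ^ 2))
      fun t => ?_
    have h1 : ∀ i, ‖hK.op.comp ofSymb (e i)‖ ^ 2 ≤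
        4 * ∫ x, (‖⟪k x, e i⟫_ℂ‖ * ‖symb x‖⁻¹) ^ 2 := fun i => by
      have := ContinuousLinearMap.opNorm_le_bound (hK.op.comp ofSymb (e i)) (by positivity)
        fun g => hform (e i) g
      calc _ ≤ (2 * √(∫ x, (‖⟪k x, e i⟫_ℂ‖ * ‖symb x‖⁻¹) ^ 2)) ^ 2 := by gcongr
        _ = _ := by
          rw [mul_pow, Real.sq_sqrt (integral_nonneg fun _ => sq_nonneg _)]
          norm_num
    refine (Finset.sum_le_sum fun i _ => h1 i).trans ?_
    rw [← Finset.mul_sum, ← integral_finsetSum _ fun i _ => hsq (e i)]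
    refine mul_le_mul_of_nonneg_left ?_ (by norm_num)
    rw [wtConst_sq s, ← integral_const_mul]
    refine integral_mono (integrable_finsetSum _ fun i _ => hsq (e i))
      ((integrable_relWt_sq hK.lt_half).const_mul _) fun x => ?_
    have h2 := e.orthonormal.sum_inner_products_le (k x) (s := t)
    simp only [norm_inner_symm (e _) (k x)] at h2
    simp only [mul_pow _ (‖symb x‖⁻¹)]
    rw [← Finset.sum_mul, relWt, mul_pow (wt s x), ← mul_assoc, ← mul_pow]
    exact mul_le_mul_of_nonneg_right (h2.trans (hk x)) (by positivity)
  have heq : ⇑hK.op = ⇑(hK.op.comp ofSymb) ∘ ⇑toSymb := by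
    ext1 f
    rw [Function.comp_apply, ContinuousLinearMap.comp_apply, ofSymb_toSymb]
  rw [heq]
  exact hcomp.comp_clm toSymb

end IsKernel

end NakReg

end

noncomputable section

namespace NakReg

open Set Filter Topology

/-! ### Evolution of kernel operators -/

theorem wt_le_of_le {s a x y : ℝ} (hs : 0 ≤ s) (ha : 1 ≤ a) (h : |x| ≤ a * |y|) :
    wt s x ≤ a ^ s * wt s y := by
  rw [wt, wt, ← Real.mul_rpow (by positivity) (by positivity)]
  refine Real.rpow_le_rpow (by positivity) ?_ hs
  linarith

theorem wt_sub_le {s : ℝ} (hs : 0 ≤ s) (x y : ℝ) : wt s (x - y) ≤ wt s x * wt s y := by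
  rw [wt, wt, wt, ← Real.mul_rpow (by positivity) (by positivity)]
  refine Real.rpow_le_rpow (by positivity) ?_ hs
  nlinarith [abs_sub x y, mul_nonneg (abs_nonneg x) (abs_nonneg y)]

/-- The kernel of `T_τ` in terms of the kernel `K` of `T`. -/
def evolvedKernel (v : ℝ → ℝ) (φ : ℝ → ℝ → ℝ) (τ : ℝ) (K : ℝ × ℝ → ℂ) (p : ℝ × ℝ) : ℂ :=
  ((sqrtJac v φ (-τ) p.1 * sqrtJac v φ (-τ) p.2 : ℝ) : ℂ) * K (φ (-τ) p.1, φ (-τ) p.2)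

namespace IsKernel

variable {s C L : ℝ} {K : ℝ × ℝ → ℂ} {v : ℝ → ℝ} {φ : ℝ → ℝ → ℝ}

theorem evolved (hK : IsKernel s C K) (hs : 0 ≤ s) (hv : FlowField v L) (hφ : IsFlow v φ) (τ : ℝ) :
    IsKernel s (Real.exp (L * |τ|) ^ 2 * (Real.exp (L * |τ|) ^ s) ^ 2 * C)
      (evolvedKernel v φ τ K) where
  lt_half := hK.lt_half
  continuous := by
    have h1 := hφ.continuous_space hv (-τ)
    have h2 := hφ.continuous_sqrtJac hv (-τ)
    have h3 := hK.continuous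
    unfold evolvedKernel
    fun_prop
  bound p := by
    have hC := hK.nonneg
    have h1 : ∀ x, wt s (φ (-τ) x) ≤ Real.exp (L * |τ|) ^ s * wt s x := fun x =>
      wt_le_of_le hs (Real.one_le_exp (mul_nonneg hv.nonneg (abs_nonneg τ))) (by
        simpa using hφ.abs_apply_le hv (-τ) x)
    have h2 : ∀ x, sqrtJac v φ (-τ) x ≤ Real.exp (L * |τ|) := fun x => by
      simpa using IsFlow.sqrtJac_le (φ := φ) hv (-τ) x
    have h3 : ∀ x, 0 ≤ sqrtJac v φ (-τ) x := fun x => (IsFlow.sqrtJac_pos _ _ _ _).le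
    have h4 : ∀ x, 0 ≤ wt s x := fun x => (wt_pos s x).le
    rw [evolvedKernel, norm_mul, Complex.norm_real, Real.norm_of_nonneg (mul_nonneg (h3 _) (h3 _))]
    calc _ ≤ (Real.exp (L * |τ|) * Real.exp (L * |τ|)) *
          (C * ((Real.exp (L * |τ|) ^ s * wt s p.1) * (Real.exp (L * |τ|) ^ s * wt s p.2))) := by
          gcongr
          · exact h3 _
          · exact h2 _
          · exact h2 _
          · refine (hK.bound _).trans ?_
            refine mul_le_mul_of_nonneg_left ?_ hC
            exact mul_le_mul (h1 _) (h1 _) (h4 _) (mul_nonneg (by positivity) (h4 _))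
      _ = _ := by ring

/-- The weighted compositions at time `τ` acting on `f` and `g` are moved to the kernel one variable
at a time. Each transposition replaces `φ τ` by `φ (-τ)`. -/
theorem evolve_op {u : ℝ → ℝ} (hK : IsKernel s C K) (hs : 0 ≤ s) (hv : FlowField (rescale u) L)
    (hφ : IsFlow (rescale u) φ) (τ : ℝ) (f g : H1) :
    evolve (conjOp u) hK.op τ f g = kernelForm (evolvedKernel (rescale u) φ τ K) f g := by
  have hft : ∀ f, ft (expH1 (conjOp u) (-τ) f) =ᵐ[volume]
      fun x => (sqrtJac (rescale u) φ τ x : ℂ) * ft f (φ τ x) := fun f => by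
    simpa using hφ.coeFn_ft_expH1 hv (-τ) f
  rw [evolve_apply, op_apply, kernelForm, kernelForm, Measure.volume_eq_prod,
    integral_prod _ (hK.integrable _ _), integral_prod _ ((hK.evolved hs hv hφ τ).integrable _ _)]
  set f' := expH1 (conjOp u) (-τ) f
  set g' := expH1 (conjOp u) (-τ) g
  set G : ℝ → ℂ := fun x =>
    ∫ y, ft f y * ((sqrtJac (rescale u) φ (-τ) y : ℂ) * K (x, φ (-τ) y)) with hG
  have h1 : ∀ x, ∫ y, K (x, y) * (starRingEnd ℂ (ft g' x) * ft f' y) =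
      starRingEnd ℂ (ft g' x) * G x := fun x => by
    rw [hG]
    simp only
    rw [← hφ.integral_transpose hv τ (ft f) (fun y => K (x, y)), ← integral_const_mul]
    refine integral_congr_ae ?_
    filter_upwards [hft f] with y hy
    rw [hy]
    ring
  have h2 : ∫ x, starRingEnd ℂ (ft g' x) * G x =
      ∫ x, (sqrtJac (rescale u) φ τ x : ℂ) * (fun x => starRingEnd ℂ (ft g x)) (φ τ x) * G x := by
    refine integral_congr_ae ?_
    filter_upwards [hft g] with x hx
    rw [hx, map_mul, Complex.conj_ofReal]
  simp only [h1]
  rw [h2, hφ.integral_transpose hv τ (fun x => starRingEnd ℂ (ft g x)) G]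
  refine integral_congr_ae (ae_of_all _ fun x => ?_)
  simp only [hG, evolvedKernel]
  rw [← integral_const_mul, ← integral_const_mul]
  refine integral_congr_ae (ae_of_all _ fun y => ?_)
  simp only
  push_cast
  ring

end IsKernel

/-! ### Regularity with respect to bounded vector fields -/

/-- `w` is twice differentiable and bounded by `B (1 + |x|)^s` together with its derivatives. -/
structure IsSymbol (s B : ℝ) (w w₁ w₂ : ℝ → ℂ) : Prop where
  hasDerivAt : ∀ x, HasDerivAt w (w₁ x) x
  hasDerivAt₁ : ∀ x, HasDerivAt w₁ (w₂ x) x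
  bound : ∀ x, ‖w x‖ ≤ B * wt s x
  bound₁ : ∀ x, ‖w₁ x‖ ≤ B * wt s x
  bound₂ : ∀ x, ‖w₂ x‖ ≤ B * wt s x

namespace IsSymbol

variable {s B L M : ℝ} {w w₁ w₂ : ℝ → ℂ} {v : ℝ → ℝ} {φ : ℝ → ℝ → ℝ}

theorem nonneg (hw : IsSymbol s B w w₁ w₂) : 0 ≤ B :=
  nonneg_of_mul_nonneg_left ((norm_nonneg _).trans (hw.bound 0)) (wt_pos s 0)

theorem continuous (hw : IsSymbol s B w w₁ w₂) : Continuous w :=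
  continuous_iff_continuousAt.2 fun x => (hw.hasDerivAt x).continuousAt

theorem isKernel (hw : IsSymbol s B w w₁ w₂) (hs : 0 ≤ s) (hs' : s < 1 / 2) :
    IsKernel s B fun p => w (p.1 - p.2) where
  lt_half := hs'
  continuous := hw.continuous.comp (by fun_prop)
  bound p := (hw.bound _).trans
    (mul_le_mul_of_nonneg_left (wt_sub_le hs p.1 p.2) hw.nonneg)

/-- Along the flow the kernel is `e w(P)`, and its second derivative is `e (a² w'' + (b + 2ac) w' +
(d + c²) w)`. The coefficients are bounded since `v` itself is bounded; for dilations `a` would grow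
like `|x - y|`. Submultiplicativity of the weight then separates the variables. -/
theorem exists_second_difference_bound (hw : IsSymbol s B w w₁ w₂) (hs : 0 ≤ s)
    (hv : FlowField v L) (hφ : IsFlow v φ) (hM : ∀ x, |v x| ≤ M) :
    ∃ D, ∀ τ, |τ| ≤ 1 → ∀ p, ‖evolvedKernel v φ τ (fun p => w (p.1 - p.2)) p +
      evolvedKernel v φ (-τ) (fun p => w (p.1 - p.2)) p - (2 : ℝ) • w (p.1 - p.2)‖ ≤
        D * τ ^ 2 * (wt s p.1 * wt s p.2) := by
  have hL := hv.nonneg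
  have hB := hw.nonneg
  have hM0 : 0 ≤ M := (abs_nonneg _).trans (hM 0)
  -- Sum of the bounds `4M²` for `a²`, `6ML` for `b + 2ac` and `ML + L²` for `d + c²`.
  set N := 4 * M ^ 2 + 7 * M * L + L ^ 2
  set E := Real.exp L
  refine ⟨2 * (B * (E ^ s * E ^ s) * N * (E * E)), fun τ hτ ⟨x, y⟩ => ?_⟩
  let P : ℝ → ℝ := fun t => φ t x - φ t y
  let a : ℝ → ℝ := fun t => v (φ t x) - v (φ t y)
  let b : ℝ → ℝ := fun t => deriv v (φ t x) * v (φ t x) - deriv v (φ t y) * v (φ t y)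
  let c : ℝ → ℝ := fun t => (deriv v (φ t x) + deriv v (φ t y)) / 2
  let d : ℝ → ℝ := fun t =>
    (deriv (deriv v) (φ t x) * v (φ t x) + deriv (deriv v) (φ t y) * v (φ t y)) / 2
  let e : ℝ → ℝ := fun t => sqrtJac v φ t x * sqrtJac v φ t y
  have hP : ∀ t, HasDerivAt P (a t) t := fun t => (hφ.hasDerivAt t x).sub (hφ.hasDerivAt t y)
  have ha : ∀ t, HasDerivAt a (b t) t := fun t =>
    ((hv.hasDerivAt _).comp t (hφ.hasDerivAt t x)).sub ((hv.hasDerivAt _).comp t (hφ.hasDerivAt t y))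
  have hc : ∀ t, HasDerivAt c (d t) t := fun t =>
    (((hv.hasDerivAt₂ _).comp t (hφ.hasDerivAt t x)).add
      ((hv.hasDerivAt₂ _).comp t (hφ.hasDerivAt t y))).div_const 2
  have he : ∀ t, HasDerivAt e (c t * e t) t := fun t =>
    ((hφ.hasDerivAt_sqrtJac hv t x).mul (hφ.hasDerivAt_sqrtJac hv t y)).congr_deriv (by
      simp only [c, e]; ring)
  have hwP : ∀ t, HasDerivAt (fun t => w (P t)) (a t * w₁ (P t)) t := fun t =>
    ((hw.hasDerivAt _).scomp t (hP t)).congr_deriv (Complex.real_smul ..)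
  have hwP₁ : ∀ t, HasDerivAt (fun t => w₁ (P t)) (a t * w₂ (P t)) t := fun t =>
    ((hw.hasDerivAt₁ _).scomp t (hP t)).congr_deriv (Complex.real_smul ..)
  have hk : ∀ t, HasDerivAt (fun t => (e t : ℂ) * w (P t))
      (e t * (a t * w₁ (P t) + c t * w (P t))) t := fun t =>
    ((he t).ofReal_comp.fun_mul (hwP t)).congr_deriv (by push_cast; ring)
  have hk₁ : ∀ t, HasDerivAt (fun t => (e t : ℂ) * (a t * w₁ (P t) + c t * w (P t)))
      (e t * (((a t ^ 2 : ℝ) : ℂ) * w₂ (P t) + ((b t + 2 * a t * c t : ℝ) : ℂ) * w₁ (P t) +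
        ((d t + c t ^ 2 : ℝ) : ℂ) * w (P t))) t := fun t =>
    ((he t).ofReal_comp.fun_mul (((ha t).ofReal_comp.fun_mul (hwP₁ t)).fun_add
      ((hc t).ofReal_comp.fun_mul (hwP t)))).congr_deriv (by push_cast; ring)
  have hmul : ∀ {p q A C : ℝ}, |p| ≤ A → |q| ≤ C → |p * q| ≤ A * C := fun {p q A C} h1 h2 => by
    rw [abs_mul]
    exact mul_le_mul h1 h2 (abs_nonneg _) ((abs_nonneg _).trans h1)
  have b_a : ∀ t, |a t| ≤ 2 * M := fun t => (abs_sub _ _).trans (by linarith [hM (φ t x), hM (φ t y)])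
  have b_b : ∀ t, |b t| ≤ 2 * (L * M) := fun t => (abs_sub _ _).trans (by
    linarith [hmul (hv.bound₁ (φ t x)) (hM (φ t x)), hmul (hv.bound₁ (φ t y)) (hM (φ t y))])
  have b_c : ∀ t, |c t| ≤ L := fun t => by
    have := abs_add_le (deriv v (φ t x)) (deriv v (φ t y))
    simp only [c]
    rw [abs_div, abs_two]
    linarith [hv.bound₁ (φ t x), hv.bound₁ (φ t y)]
  have b_d : ∀ t, |d t| ≤ L * M := fun t => by
    have := abs_add_le (deriv (deriv v) (φ t x) * v (φ t x)) (deriv (deriv v) (φ t y) * v (φ t y))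
    simp only [d]
    rw [abs_div, abs_two]
    linarith [hmul (hv.bound₂ (φ t x)) (hM (φ t x)), hmul (hv.bound₂ (φ t y)) (hM (φ t y))]
  have key := second_difference_bound (r := 1) (t := τ)
    (M := B * (E ^ s * E ^ s) * N * (E * E) * (wt s x * wt s y)) hk hk₁ (fun t ht => by
      have hLt : L * |t| ≤ L := mul_le_of_le_one_right hL ht
      have hEt : Real.exp (L * |t|) ≤ E := Real.exp_le_exp.2 hLt
      have hW : wt s (P t) ≤ (E ^ s * wt s x) * (E ^ s * wt s y) := by
        refine (wt_sub_le hs _ _).trans ?_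
        have h : ∀ x, wt s (φ t x) ≤ E ^ s * wt s x := fun x =>
          wt_le_of_le hs (Real.one_le_exp hL) ((hφ.abs_apply_le hv t x).trans (by gcongr))
        have := fun x => (wt_pos s x).le
        exact mul_le_mul (h x) (h y) (this _) (mul_nonneg (by positivity) (this _))
      have hE : ∀ x, |sqrtJac v φ t x| ≤ E := fun x => by
        rw [abs_of_pos (IsFlow.sqrtJac_pos _ _ _ _)]
        exact (IsFlow.sqrtJac_le hv t x).trans hEt
      have hsum : ‖((a t ^ 2 : ℝ) : ℂ) * w₂ (P t) + ((b t + 2 * a t * c t : ℝ) : ℂ) * w₁ (P t) +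
          ((d t + c t ^ 2 : ℝ) : ℂ) * w (P t)‖ ≤ N * (B * wt s (P t)) := by
        have n1 : ‖((a t ^ 2 : ℝ) : ℂ)‖ ≤ 4 * M ^ 2 := by
          rw [Complex.norm_real, Real.norm_eq_abs, sq]
          exact (hmul (b_a t) (b_a t)).trans (by ring_nf; rfl)
        have n2 : ‖((b t + 2 * a t * c t : ℝ) : ℂ)‖ ≤ 6 * M * L := by
          rw [Complex.norm_real, Real.norm_eq_abs]
          refine (abs_add_le _ _).trans ?_
          have h1 := hmul (b_a t) (b_c t)
          rw [show 2 * a t * c t = 2 * (a t * c t) by ring, abs_mul, abs_two]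
          linarith [b_b t]
        have n3 : ‖((d t + c t ^ 2 : ℝ) : ℂ)‖ ≤ M * L + L ^ 2 := by
          rw [Complex.norm_real, Real.norm_eq_abs]
          refine (abs_add_le _ _).trans ?_
          have h1 := hmul (b_c t) (b_c t)
          rw [← sq, ← sq] at h1
          linarith [b_d t]
        have hBW : 0 ≤ B * wt s (P t) := mul_nonneg hB (wt_pos _ _).le
        refine (norm_add₃_le).trans ?_
        rw [norm_mul, norm_mul, norm_mul]
        have m1 := mul_le_mul n1 (hw.bound₂ (P t)) (norm_nonneg _) (by positivity)
        have m2 := mul_le_mul n2 (hw.bound₁ (P t)) (norm_nonneg _) (by positivity)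
        have m3 := mul_le_mul n3 (hw.bound (P t)) (norm_nonneg _) (by positivity)
        refine (add_le_add (add_le_add m1 m2) m3).trans (le_of_eq ?_)
        simp only [N]
        ring
      rw [norm_mul, Complex.norm_real, Real.norm_eq_abs]
      have hN : 0 ≤ N := by positivity
      calc _ ≤ (E * E) * (N * (B * ((E ^ s * wt s x) * (E ^ s * wt s y)))) := by
            refine mul_le_mul (hmul (hE x) (hE y)) (hsum.trans ?_) (norm_nonneg _) (by positivity)
            gcongr
        _ = _ := by ring) hτ
  have e0 : (e 0 : ℂ) * w (P 0) = w (x - y) := by simp [e, P, IsFlow.sqrtJac_zero, hφ.zero]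
  rw [e0] at key
  simp only [evolvedKernel, neg_neg]
  -- The evolved kernel at time `τ` uses the flow at time `-τ`, so the two outer terms appear in the
  -- opposite order.
  rw [add_comm]
  refine key.trans (le_of_eq ?_)
  ring

/-- Convolution operators with smooth symbols growing slower than `|x|^{1/2}` are of class
`C^{1,1}` with respect to bounded vector fields. -/
theorem isC11 {u : ℝ → ℝ} (hw : IsSymbol s B w w₁ w₂) (hs : 0 ≤ s) (hs' : s < 1 / 2)
    (hv : FlowField (rescale u) L) (hM : ∀ x, |rescale u x| ≤ M) :
    IsC11 (conjOp u) (hw.isKernel hs hs').op := by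
  obtain ⟨φ, hφ⟩ := exists_isFlow hv hM
  set hK := hw.isKernel hs hs'
  obtain ⟨D, hD⟩ := hw.exists_second_difference_bound hs hv hφ hM
  set A := D * (2 * wtConst s) ^ 2
  have hbound : ∀ τ ∈ Ioc (0 : ℝ) 1,
      ‖evolve (conjOp u) hK.op τ + evolve (conjOp u) hK.op (-τ) - (2 : ℂ) • hK.op‖ ≤ A * τ ^ 2 := by
    intro τ hτ
    have h1 := hK.evolved hs hv hφ τ
    have h2 := hK.evolved hs hv hφ (-τ)
    have hK2 : IsKernel s (D * τ ^ 2) fun p =>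
        evolvedKernel (rescale u) φ τ (fun p => w (p.1 - p.2)) p +
          evolvedKernel (rescale u) φ (-τ) (fun p => w (p.1 - p.2)) p - (2 : ℝ) • w (p.1 - p.2) :=
      { lt_half := hs'
        continuous := (h1.continuous.add h2.continuous).sub (hK.continuous.const_smul (2 : ℝ))
        bound := hD τ (abs_le.2 ⟨by linarith [hτ.1], hτ.2⟩) }
    refine (hK2.norm_le fun f g => ?_).trans (le_of_eq (by simp only [A]; ring))
    have e1 : (evolve (conjOp u) hK.op τ + evolve (conjOp u) hK.op (-τ) - (2 : ℂ) • hK.op) f g =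
        evolve (conjOp u) hK.op τ f g + evolve (conjOp u) hK.op (-τ) f g - 2 * hK.op f g := rfl
    have hsum : ∀ f g, Integrable fun p : ℝ × ℝ =>
        evolvedKernel (rescale u) φ τ (fun p => w (p.1 - p.2)) p *
            (starRingEnd ℂ (ft g p.1) * ft f p.2) +
          evolvedKernel (rescale u) φ (-τ) (fun p => w (p.1 - p.2)) p *
            (starRingEnd ℂ (ft g p.1) * ft f p.2) :=
      fun f g => (h1.integrable f g).add (h2.integrable f g)
    rw [e1, hK.evolve_op hs hv hφ, hK.evolve_op hs hv hφ, hK.op_apply, kernelForm, kernelForm,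
      kernelForm, kernelForm, ← integral_add (h1.integrable f g) (h2.integrable f g),
      ← integral_const_mul, ← integral_sub (hsum f g)
        ((hK.integrable f g).const_mul 2)]
    refine integral_congr_ae (ae_of_all _ fun p => ?_)
    simp only [Complex.real_smul]
    push_cast
    ring
  have hle : ∀ τ ∈ Ioc (0 : ℝ) 1,
      ‖evolve (conjOp u) hK.op τ + evolve (conjOp u) hK.op (-τ) - (2 : ℂ) • hK.op‖ₑ /
        ENNReal.ofReal (τ ^ 2) ≤ ENNReal.ofReal A := by
    intro τ hτ
    have hτ2 : 0 < τ ^ 2 := pow_pos hτ.1 2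
    rw [← ofReal_norm, ← ENNReal.ofReal_div_of_pos hτ2]
    exact ENNReal.ofReal_le_ofReal (by rw [div_le_iff₀ hτ2]; exact hbound τ hτ)
  refine (setLIntegral_mono measurable_const hle).trans_lt ?_
  simp

end IsSymbol

/-- The sign condition is needed only to give `u 0 = 0`, by continuity from both sides; this makes
the origin a fixed point of the flow. -/
theorem IsAdmissible.flowField {u : ℝ → ℝ} (hu : IsAdmissible u) :
    ∃ L M, FlowField (rescale u) L ∧ ∀ x, |rescale u x| ≤ M := by
  obtain ⟨h1, h2, h3⟩ := hu
  have hpi := Real.two_pi_pos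
  choose C hC using h2
  have hit : ∀ k x, iteratedDeriv k (rescale u) x =
      (2 * Real.pi) ^ k * iteratedDeriv k u (2 * Real.pi * x) / (2 * Real.pi) := fun k x => by
    have e : rescale u = fun x => (2 * Real.pi)⁻¹ * (fun x => u (2 * Real.pi * x)) x := by
      ext x; rw [rescale]; field_simp
    have hc : ContDiff ℝ ∞ fun x => u (2 * Real.pi * x) := h1.comp (by fun_prop)
    rw [e, iteratedDeriv_const_mul_field,
      iteratedDeriv_comp_const_mul (h1.of_le (by exact_mod_cast le_top))]
    field_simp
  have hb : ∀ k x, |iteratedDeriv k (rescale u) x| ≤ (2 * Real.pi) ^ k * C k / (2 * Real.pi) :=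
    fun k x => by
      rw [hit, abs_div, abs_mul, abs_of_pos hpi, abs_of_pos (pow_pos hpi k)]
      gcongr
      exact hC k _
  have hu0 : u 0 = 0 := by
    have hc := h1.continuous.tendsto 0
    have hp : ∀ x, 0 < x → 0 < u x := fun x hx => pos_of_mul_pos_right (h3 x hx.ne') hx.le
    have hn : ∀ x, x < 0 → u x < 0 := fun x hx => by
      have := h3 x hx.ne
      by_contra hcon
      nlinarith [not_lt.1 hcon]
    refine le_antisymm ?_ ?_
    · exact le_of_tendsto (hc.mono_left (nhdsWithin_le_nhds (s := Iio 0)))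
        (by filter_upwards [self_mem_nhdsWithin] with x hx using (hn x hx).le)
    · exact ge_of_tendsto (hc.mono_left (nhdsWithin_le_nhds (s := Ioi 0)))
        (by filter_upwards [self_mem_nhdsWithin] with x hx using (hp x hx).le)
  have hsm : ContDiff ℝ ∞ (rescale u) := (h1.comp (by fun_prop)).div_const _
  refine ⟨max ((2 * Real.pi) ^ 1 * C 1 / (2 * Real.pi)) ((2 * Real.pi) ^ 2 * C 2 / (2 * Real.pi)),
    (2 * Real.pi) ^ 0 * C 0 / (2 * Real.pi), ⟨⟨hsm, fun n => ?_⟩, ?_, fun x => ?_, fun x => ?_⟩,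
    fun x => ?_⟩
  · refine ⟨0, (2 * Real.pi) ^ n * C n / (2 * Real.pi), fun x => ?_⟩
    rw [norm_iteratedFDeriv_eq_norm_iteratedDeriv, pow_zero, mul_one]
    exact hb n x
  · simp [rescale, hu0]
  · have := hb 1 x
    rw [iteratedDeriv_one] at this
    exact this.trans (le_max_left _ _)
  · have := hb 2 x
    rw [iteratedDeriv_succ, iteratedDeriv_one] at this
    exact this.trans (le_max_right _ _)
  · have := hb 0 x
    rwa [iteratedDeriv_zero] at this

end NakReg

end

noncomputable section

namespace NakReg

open Set Filter Topology

/-! ### Sums of translated bumps -/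

/-- The function `ξ ↦ ∑ₙ λₙ ψ(ξ - n)`. -/
def latticeSum (lam : ℤ → ℝ) (ψ : ℝ → ℝ) (ξ : ℝ) : ℝ := ∑' n : ℤ, lam n * ψ (ξ - n)

theorem bumpSum_eq (χ : ℝ → ℝ) (lam : ℤ → ℝ) (ξ : ℝ) :
    bumpSum χ lam ξ = (latticeSum lam χ ξ : ℂ) := rfl

section Lattice

variable {lam : ℤ → ℝ} {ψ ψ' : ℝ → ℝ} {s C : ℝ}

theorem latticeSum_eq_sum (hψ : ∀ x, 1 < |x| → ψ x = 0) {N : ℤ} {ξ : ℝ} (hξ : |ξ| ≤ N) :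
    latticeSum lam ψ ξ = ∑ n ∈ Finset.Icc (-(N + 1)) (N + 1), lam n * ψ (ξ - n) := by
  refine tsum_eq_sum fun n hn => ?_
  rw [hψ, mul_zero]
  have hn' : N + 2 ≤ |n| := by
    rw [Finset.mem_Icc] at hn
    rw [le_abs]
    omega
  have h1 : ((N + 2 : ℤ) : ℝ) ≤ |(n : ℝ)| := by rw [← Int.cast_abs]; exact_mod_cast hn'
  have h2 := abs_sub_abs_le_abs_sub (n : ℝ) ξ
  rw [abs_sub_comm] at h2
  push_cast at h1
  linarith

theorem latticeSum_eventuallyEq (hψ : ∀ x, 1 < |x| → ψ x = 0) (ξ : ℝ) :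
    latticeSum lam ψ =ᶠ[𝓝 ξ] fun η =>
      ∑ n ∈ Finset.Icc (-(⌈|ξ|⌉ + 1 + 1)) (⌈|ξ|⌉ + 1 + 1), lam n * ψ (η - n) := by
  have h : |ξ| < (⌈|ξ|⌉ + 1 : ℤ) := by push_cast; linarith [Int.le_ceil |ξ|]
  filter_upwards [(isOpen_lt continuous_abs continuous_const).mem_nhds h] with η hη
  exact latticeSum_eq_sum hψ (le_of_lt hη)

theorem continuous_latticeSum (hψ : ∀ x, 1 < |x| → ψ x = 0) (hc : Continuous ψ) :
    Continuous (latticeSum lam ψ) := by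
  rw [continuous_iff_continuousAt]
  intro ξ
  refine ContinuousAt.congr ?_ (latticeSum_eventuallyEq hψ ξ).symm
  exact Continuous.continuousAt (by fun_prop)

theorem hasDerivAt_latticeSum (hψ : ∀ x, 1 < |x| → ψ x = 0) (hψ' : ∀ x, 1 < |x| → ψ' x = 0)
    (hd : ∀ x, HasDerivAt ψ (ψ' x) x) (ξ : ℝ) :
    HasDerivAt (latticeSum lam ψ) (latticeSum lam ψ' ξ) ξ := by
  rw [(latticeSum_eventuallyEq (lam := lam) hψ' ξ).self_of_nhds]
  refine HasDerivAt.congr_of_eventuallyEq ?_ (latticeSum_eventuallyEq hψ ξ)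
  exact HasDerivAt.fun_sum fun n _ => ((hd _).comp_sub_const ξ n).const_mul _

/-- The sum `∑ₙ λₙ ⟨n⟩^(-s)`. -/
def weightSum (lam : ℤ → ℝ) (s : ℝ) : ℝ := ∑' n : ℤ, lam n * √(1 + (n : ℝ) ^ 2) ^ (-s)

/-- If `|n| ≤ |ξ| + 1` then `⟨n⟩ ≤ 2 (1 + |ξ|)`. This exchanges weighted summability of `λ` for
pointwise growth of order `s`. -/
theorem lam_le_weight (hlam : ∀ n, 0 ≤ lam n) (hs : 0 ≤ s) {n : ℤ} {ξ : ℝ} (h : |(n : ℝ)| ≤ |ξ| + 1) :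
    lam n ≤ 2 ^ s * wt s ξ * (lam n * √(1 + (n : ℝ) ^ 2) ^ (-s)) := by
  have h1 : 1 ≤ √(1 + (n : ℝ) ^ 2) := by
    rw [Real.one_le_sqrt]; nlinarith [sq_nonneg (n : ℝ)]
  have h2 : √(1 + (n : ℝ) ^ 2) ≤ 2 * (1 + |ξ|) := by
    rw [Real.sqrt_le_left (by positivity)]
    have : (n : ℝ) ^ 2 ≤ (|ξ| + 1) ^ 2 := by rw [← sq_abs]; gcongr
    nlinarith [abs_nonneg ξ]
  have h3 : √(1 + (n : ℝ) ^ 2) ^ s ≤ 2 ^ s * wt s ξ := by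
    rw [wt, ← Real.mul_rpow (by positivity) (by positivity)]
    exact Real.rpow_le_rpow (by positivity) h2 hs
  have h4 : √(1 + (n : ℝ) ^ 2) ^ s * √(1 + (n : ℝ) ^ 2) ^ (-s) = 1 := by
    rw [← Real.rpow_add (by positivity), add_neg_cancel, Real.rpow_zero]
  calc lam n = √(1 + (n : ℝ) ^ 2) ^ s * (lam n * √(1 + (n : ℝ) ^ 2) ^ (-s)) := by
        rw [mul_left_comm, h4, mul_one]
    _ ≤ _ := by
        gcongr
        exact mul_nonneg (hlam n) (by positivity)

theorem weightSum_term_nonneg (hlam : ∀ n, 0 ≤ lam n) (s : ℝ) (n : ℤ) :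
    0 ≤ lam n * √(1 + (n : ℝ) ^ 2) ^ (-s) := mul_nonneg (hlam n) (by positivity)

theorem abs_latticeSum_le (hlam : ∀ n, 0 ≤ lam n) (hs : 0 ≤ s)
    (hsum : Summable fun n : ℤ => lam n * √(1 + (n : ℝ) ^ 2) ^ (-s))
    (hψ : ∀ x, 1 < |x| → ψ x = 0) (hC : ∀ x, |ψ x| ≤ C) (ξ : ℝ) :
    |latticeSum lam ψ ξ| ≤ C * (2 ^ s * weightSum lam s) * wt s ξ := by
  have hC0 : 0 ≤ C := (abs_nonneg _).trans (hC 0)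
  have h := (hsum.hasSum.mul_left (C * (2 ^ s * wt s ξ)))
  have := tsum_of_norm_bounded h (f := fun n : ℤ => lam n * ψ (ξ - n)) fun n => by
    rcases le_or_gt |ξ - n| 1 with hn | hn
    · have h1 : |(n : ℝ)| ≤ |ξ| + 1 := by
        have := abs_sub_abs_le_abs_sub (n : ℝ) ξ
        rw [abs_sub_comm] at this
        linarith
      have h2 := lam_le_weight hlam hs h1
      rw [norm_mul, Real.norm_of_nonneg (hlam n), Real.norm_eq_abs]
      calc _ ≤ (2 ^ s * wt s ξ * (lam n * √(1 + (n : ℝ) ^ 2) ^ (-s))) * C :=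
            mul_le_mul h2 (hC _) (abs_nonneg _) ((hlam n).trans h2)
        _ = _ := by ring
    · rw [hψ _ hn, mul_zero, norm_zero]
      have := weightSum_term_nonneg hlam s n
      have := (wt_pos s ξ).le
      positivity
  rw [← Real.norm_eq_abs]
  refine this.trans (le_of_eq ?_)
  rw [weightSum]
  ring

/-- The primitive of `∑ₙ λₙ ψ(ξ - n)` vanishing at `0`. -/
def latticePrim (lam : ℤ → ℝ) (ψ : ℝ → ℝ) (ξ : ℝ) : ℝ := ∫ t in (0 : ℝ)..ξ, latticeSum lam ψ t

theorem hasDerivAt_latticePrim (hψ : ∀ x, 1 < |x| → ψ x = 0) (hc : Continuous ψ) (ξ : ℝ) :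
    HasDerivAt (latticePrim lam ψ) (latticeSum lam ψ ξ) ξ :=
  intervalIntegral.integral_hasDerivAt_right
    ((continuous_latticeSum hψ hc).intervalIntegrable _ _)
    ((continuous_latticeSum hψ hc).stronglyMeasurableAtFilter _ _)
    (continuous_latticeSum hψ hc).continuousAt

theorem hasCompactSupport_of_unit (hψ : ∀ x, 1 < |x| → ψ x = 0) : HasCompactSupport ψ :=
  HasCompactSupport.of_support_subset_isCompact (isCompact_closedBall (0 : ℝ) 1) fun x hx => by
    rw [mem_closedBall_zero_iff, Real.norm_eq_abs]
    by_contra h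
    exact hx (hψ x (not_le.1 h))

/-- The primitive grows no faster than the sum: each translate contributes at most `∫ |ψ|`, however
long the interval, and only those with `|n| ≤ |ξ| + 1` contribute. -/
theorem abs_latticePrim_le (hlam : ∀ n, 0 ≤ lam n) (hs : 0 ≤ s)
    (hsum : Summable fun n : ℤ => lam n * √(1 + (n : ℝ) ^ 2) ^ (-s))
    (hψ : ∀ x, 1 < |x| → ψ x = 0) (hc : Continuous ψ) (ξ : ℝ) :
    |latticePrim lam ψ ξ| ≤ (∫ x, |ψ x|) * (2 ^ s * weightSum lam s) * wt s ξ := by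
  set I := ∫ x, |ψ x|
  have hI : 0 ≤ I := integral_nonneg fun _ => abs_nonneg _
  have hint : Integrable ψ := hc.integrable_of_hasCompactSupport (hasCompactSupport_of_unit hψ)
  set J := Finset.Icc (-(⌈|ξ|⌉ + 1)) (⌈|ξ|⌉ + 1)
  have h1 : latticePrim lam ψ ξ = ∑ n ∈ J, lam n * ∫ t in (0 : ℝ)..ξ, ψ (t - n) := by
    have : latticePrim lam ψ ξ = ∫ t in (0 : ℝ)..ξ, ∑ n ∈ J, lam n * ψ (t - n) := by
      refine intervalIntegral.integral_congr fun t ht => ?_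
      refine latticeSum_eq_sum hψ (le_trans ?_ (Int.le_ceil |ξ|))
      simpa using abs_sub_left_of_mem_uIcc ht
    rw [this, intervalIntegral.integral_finsetSum]
    · simp only [intervalIntegral.integral_const_mul]
    · exact fun n _ => Continuous.intervalIntegrable (by fun_prop) _ _
  have h2 : ∀ n : ℤ, |lam n * ∫ t in (0 : ℝ)..ξ, ψ (t - n)| ≤
      I * (2 ^ s * wt s ξ) * (lam n * √(1 + (n : ℝ) ^ 2) ^ (-s)) := fun n => by
    rcases le_or_gt |(n : ℝ)| (|ξ| + 1) with hn | hn
    · have e1 : |∫ t in (0 : ℝ)..ξ, ψ (t - n)| ≤ I := by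
        refine (intervalIntegral.norm_integral_le_integral_norm_uIoc (f := fun t => ψ (t - n))).trans ?_
        have e2 : I = ∫ t, ‖ψ (t - n)‖ := (integral_sub_right_eq_self (fun x => |ψ x|) (n : ℝ)).symm
        rw [e2]
        exact setIntegral_le_integral (hint.comp_sub_right (n : ℝ)).norm
          (ae_of_all _ fun _ => norm_nonneg _)
      have e3 := lam_le_weight hlam hs hn
      rw [abs_mul, abs_of_nonneg (hlam n)]
      calc _ ≤ (2 ^ s * wt s ξ * (lam n * √(1 + (n : ℝ) ^ 2) ^ (-s))) * I :=
            mul_le_mul e3 e1 (abs_nonneg _) ((hlam n).trans e3)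
        _ = _ := by ring
    · have e1 : ∫ t in (0 : ℝ)..ξ, ψ (t - n) = ∫ t in (0 : ℝ)..ξ, (0 : ℝ) := by
        refine intervalIntegral.integral_congr fun t ht => ?_
        refine hψ _ ?_
        have h3 : |t| ≤ |ξ| := by simpa using abs_sub_left_of_mem_uIcc ht
        have h4 := abs_sub_abs_le_abs_sub (n : ℝ) t
        rw [abs_sub_comm] at h4
        linarith
      rw [e1, intervalIntegral.integral_zero, mul_zero, abs_zero]
      have := weightSum_term_nonneg hlam s n
      have := (wt_pos s ξ).le
      positivity
  rw [h1]
  refine (Finset.abs_sum_le_sum_abs _ _).trans ((Finset.sum_le_sum fun n _ => h2 n).trans ?_)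
  rw [← Finset.mul_sum]
  have h3 : ∑ n ∈ J, lam n * √(1 + (n : ℝ) ^ 2) ^ (-s) ≤ weightSum lam s :=
    hsum.sum_le_tsum _ fun n _ => weightSum_term_nonneg hlam s n
  have := (wt_pos s ξ).le
  calc _ ≤ I * (2 ^ s * wt s ξ) * weightSum lam s := by gcongr
    _ = _ := by ring

theorem latticeSum_neg (hψ : ∀ x, ψ (-x) = ψ x) (hlam : ∀ n, lam (-n) = lam n) (ξ : ℝ) :
    latticeSum lam ψ (-ξ) = latticeSum lam ψ ξ := by
  rw [latticeSum, latticeSum, ← (Equiv.neg ℤ).tsum_eq]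
  refine tsum_congr fun n => ?_
  rw [Equiv.neg_apply, hlam, ← hψ]
  congr 2
  push_cast
  ring

theorem latticePrim_neg (hψ : ∀ x, ψ (-x) = ψ x) (hlam : ∀ n, lam (-n) = lam n) (ξ : ℝ) :
    latticePrim lam ψ (-ξ) = -latticePrim lam ψ ξ := by
  have := intervalIntegral.integral_comp_neg (a := 0) (b := -ξ) (latticeSum lam ψ)
  simp only [latticeSum_neg hψ hlam, neg_neg, neg_zero] at this
  rw [latticePrim, latticePrim, this, intervalIntegral.integral_symm]

theorem latticePrim_zero (lam : ℤ → ℝ) (ψ : ℝ → ℝ) : latticePrim lam ψ 0 = 0 :=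
  intervalIntegral.integral_same

theorem latticeSum_nonneg (hψ : ∀ x, 0 ≤ ψ x) (hlam : ∀ n, 0 ≤ lam n) (ξ : ℝ) :
    0 ≤ latticeSum lam ψ ξ := tsum_nonneg fun n => mul_nonneg (hlam n) (hψ _)

theorem le_latticeSum (hψ : ∀ x, 1 < |x| → ψ x = 0) (hψ0 : ∀ x, 0 ≤ ψ x) (hlam : ∀ n, 0 ≤ lam n)
    (n : ℤ) (ξ : ℝ) : lam n * ψ (ξ - n) ≤ latticeSum lam ψ ξ := by
  by_cases hn : |ξ - n| ≤ 1
  · rw [latticeSum_eq_sum hψ (Int.le_ceil |ξ|)]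
    refine Finset.single_le_sum (f := fun n : ℤ => lam n * ψ (ξ - n))
      (fun m _ => mul_nonneg (hlam m) (hψ0 _)) ?_
    have h1 : |(n : ℝ)| ≤ (⌈|ξ|⌉ + 1 : ℤ) := by
      have := abs_sub_abs_le_abs_sub (n : ℝ) ξ
      rw [abs_sub_comm] at this
      push_cast
      linarith [Int.le_ceil |ξ|]
    rw [← Int.cast_abs, Int.cast_le, abs_le] at h1
    exact Finset.mem_Icc.2 h1
  · rw [hψ _ (not_le.1 hn), mul_zero]
    exact latticeSum_nonneg hψ0 hlam ξ

end Lattice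

end NakReg

end

noncomputable section

namespace NakReg

open Set Filter Topology

/-! ### The Fourier transform in the normalisation of the spectral variable -/

theorem fourierS_apply_fourier (φ : 𝓢(ℝ, ℂ)) (ξ : ℝ) :
    fourierS φ ξ = ((√(2 * Real.pi))⁻¹ : ℂ) * (𝓕 φ : 𝓢(ℝ, ℂ)) (ξ * (2 * Real.pi)⁻¹) := rfl

theorem sqrt_two_pi_mul_self : (√(2 * Real.pi) : ℂ) * √(2 * Real.pi) = 2 * Real.pi := by
  rw [← Complex.ofReal_mul, Real.mul_self_sqrt Real.two_pi_pos.le]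
  push_cast
  rfl

theorem sqrt_two_pi_ne_zero : (√(2 * Real.pi) : ℂ) ≠ 0 := by
  exact_mod_cast (Real.sqrt_pos.2 Real.two_pi_pos).ne'

/-- The inverse of `fourierS`. -/
def fourierSInv : 𝓢(ℝ, ℂ) →L[ℂ] 𝓢(ℝ, ℂ) :=
  ((√(2 * Real.pi))⁻¹ : ℂ) •
    ((SchwartzMap.compCLMOfContinuousLinearEquiv ℂ
      (ContinuousLinearEquiv.unitsEquivAut ℝ
        (Units.mk0 (2 * Real.pi)⁻¹ (inv_ne_zero Real.two_pi_pos.ne')))).comp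
      (FourierTransform.fourierInvCLM ℂ 𝓢(ℝ, ℂ)))

theorem fourierSInv_apply (θ : 𝓢(ℝ, ℂ)) (ξ : ℝ) :
    fourierSInv θ ξ = ((√(2 * Real.pi))⁻¹ : ℂ) * (𝓕⁻ θ : 𝓢(ℝ, ℂ)) (ξ * (2 * Real.pi)⁻¹) := rfl

theorem fourierS_fourierSInv (θ : 𝓢(ℝ, ℂ)) : fourierS (fourierSInv θ) = θ := by
  have hpi : (Real.pi : ℂ) ≠ 0 := by exact_mod_cast Real.pi_ne_zero
  ext η
  have h1 : (𝓕 (𝓕⁻ θ) : 𝓢(ℝ, ℂ)) η = θ η := by rw [FourierTransform.fourier_fourierInv_eq]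
  rw [SchwartzMap.fourier_coe, Real.fourier_real_eq_integral_exp_smul] at h1
  have h2 := Measure.integral_comp_mul_right
    (fun k : ℝ => Complex.exp (((-2 * Real.pi * k * η : ℝ) : ℂ) * Complex.I) • (𝓕⁻ θ : 𝓢(ℝ, ℂ)) k)
    (2 * Real.pi)⁻¹
  rw [h1, inv_inv, abs_of_pos Real.two_pi_pos] at h2
  rw [fourierS_apply]
  have h3 : ∀ x : ℝ, Complex.exp (-(Complex.I * x * η)) * fourierSInv θ x =
      ((√(2 * Real.pi))⁻¹ : ℂ) *
        (Complex.exp (((-2 * Real.pi * (x * (2 * Real.pi)⁻¹) * η : ℝ) : ℂ) * Complex.I) •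
          (𝓕⁻ θ : 𝓢(ℝ, ℂ)) (x * (2 * Real.pi)⁻¹)) := fun x => by
    rw [fourierSInv_apply, smul_eq_mul, mul_left_comm]
    congr 3
    push_cast
    field_simp
  simp only [h3]
  rw [integral_const_mul, h2, Complex.real_smul, ← mul_assoc, ← mul_assoc, ← mul_inv,
    sqrt_two_pi_mul_self]
  push_cast
  field_simp

theorem fourierS_injective : Function.Injective fourierS := by
  intro φ ψ h
  have h1 : (𝓕 φ : 𝓢(ℝ, ℂ)) = 𝓕 ψ := by
    ext y
    have h2 := DFunLike.congr_fun h (y * (2 * Real.pi))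
    rw [fourierS_apply_fourier, fourierS_apply_fourier, mul_assoc,
      mul_inv_cancel₀ Real.two_pi_pos.ne', mul_one] at h2
    exact mul_left_cancel₀ (inv_ne_zero sqrt_two_pi_ne_zero) h2
  have h2 := congrArg (fun f : 𝓢(ℝ, ℂ) => (𝓕⁻ f : 𝓢(ℝ, ℂ))) h1
  simpa only [FourierTransform.fourierInv_fourier_eq] using h2

theorem fourierSInv_fourierS (φ : 𝓢(ℝ, ℂ)) : fourierSInv (fourierS φ) = φ :=
  fourierS_injective (fourierS_fourierSInv _)

theorem opQ_fourierS (φ : 𝓢(ℝ, ℂ)) :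
    opQ (fourierS φ) = fourierS ((-Complex.I) • SchwartzMap.derivCLM ℂ ℂ φ) := by
  have hpi : (Real.pi : ℂ) ≠ 0 := by exact_mod_cast Real.pi_ne_zero
  have h1 := SchwartzMap.fourier_lineDerivOp_eq φ (1 : ℝ)
  have h2 : LineDeriv.lineDerivOp (1 : ℝ) φ = SchwartzMap.derivCLM ℂ ℂ φ := rfl
  rw [h2] at h1
  ext ξ
  have h3 := DFunLike.congr_fun h1 (ξ * (2 * Real.pi)⁻¹)
  have ht : Function.HasTemperateGrowth fun x : ℝ => inner ℝ x (1 : ℝ) := by fun_prop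
  rw [_root_.smul_apply, SchwartzMap.smulLeftCLM_apply_apply ht] at h3
  rw [map_smul, _root_.smul_apply, fourierS_apply_fourier, h3, opQ,
    SchwartzMap.smulLeftCLM_apply_apply hasTemperateGrowth_id_complex, fourierS_apply_fourier]
  have hi : inner ℝ (ξ * (2 * Real.pi)⁻¹) (1 : ℝ) = ξ * (2 * Real.pi)⁻¹ := by simp
  have hI : -Complex.I * (2 * Real.pi * Complex.I) = 2 * Real.pi := by
    linear_combination (-2 * Real.pi : ℂ) * Complex.I_mul_I
  have hx : (2 * Real.pi : ℂ) * ((ξ * (2 * Real.pi)⁻¹ : ℝ) : ℂ) = ξ := by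
    push_cast
    field_simp
  rw [hi, smul_eq_mul, smul_eq_mul, smul_eq_mul, Complex.real_smul]
  linear_combination (-((√(2 * Real.pi))⁻¹ : ℂ) * ((ξ * (2 * Real.pi)⁻¹ : ℝ) : ℂ) *
    (𝓕 φ : 𝓢(ℝ, ℂ)) (ξ * (2 * Real.pi)⁻¹)) * hI -
    ((√(2 * Real.pi))⁻¹ : ℂ) * (𝓕 φ : 𝓢(ℝ, ℂ)) (ξ * (2 * Real.pi)⁻¹) * hx

/-! ### Tempered distributions given by functions of slow growth -/

section SlowGrowth

variable {v : ℝ → ℂ} {s B : ℝ}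

theorem symb_hasTemperateGrowth : Function.HasTemperateGrowth symb := by
  have : symb = fun x : ℝ => 1 + 2 * Real.pi * Complex.I * (x : ℂ) := rfl
  rw [this]
  fun_prop

theorem memLp_div_symb (hs : s < 1 / 2) (hv : Continuous v) (hb : ∀ x, ‖v x‖ ≤ B * wt s x) :
    MemLp (fun x => (symb x)⁻¹ * v x) 2 volume := by
  have hc : Continuous fun x => (symb x)⁻¹ * v x := (continuous_symb.inv₀ symb_ne_zero).mul hv
  refine (memLp_two_iff_integrable_sq_norm hc.aestronglyMeasurable).2 ?_
  refine ((integrable_relWt_sq hs).const_mul (B ^ 2)).mono' (hc.norm.pow 2).aestronglyMeasurable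
    (ae_of_all _ fun x => ?_)
  rw [Real.norm_of_nonneg (by positivity), ← mul_pow]
  have : ‖(symb x)⁻¹ * v x‖ ≤ B * relWt s x := by
    rw [norm_mul, norm_inv, relWt]
    calc _ ≤ ‖symb x‖⁻¹ * (B * wt s x) := by gcongr; exact hb x
      _ = _ := by ring
  gcongr

/-- The quotient `v / symb` is in `L²` and so defines a tempered distribution; it is multiplied back
by the polynomial `symb`. -/
theorem exists_distribution (hs : s < 1 / 2) (hv : Continuous v) (hb : ∀ x, ‖v x‖ ≤ B * wt s x) :
    ∃ T : 𝓢'(ℝ, ℂ), ∀ φ : 𝓢(ℝ, ℂ), Integrable (fun x => v x * φ x) ∧ T φ = ∫ x, v x * φ x := by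
  have hm := memLp_div_symb hs hv hb
  let h : L2 := hm.toLp
  refine ⟨TemperedDistribution.smulLeftCLM ℂ symb (Lp.toTemperedDistribution h), fun φ => ?_⟩
  have h1 : (fun x => SchwartzMap.smulLeftCLM ℂ symb φ x * h x) =ᵐ[volume]
      fun x => v x * φ x := by
    filter_upwards [hm.coeFn_toLp] with x hx
    simp only [h]
    rw [hx, SchwartzMap.smulLeftCLM_apply_apply symb_hasTemperateGrowth, smul_eq_mul]
    have := symb_ne_zero x
    field_simp
  refine ⟨(memLp_mul_schwartz h (SchwartzMap.smulLeftCLM ℂ symb φ)).congr h1, ?_⟩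
  rw [TemperedDistribution.smulLeftCLM_apply_apply, Lp.toTemperedDistribution_apply]
  exact integral_congr_ae h1

theorem integrable_mul_schwartz (hs : s < 1 / 2) (hv : Continuous v) (hb : ∀ x, ‖v x‖ ≤ B * wt s x)
    (φ : 𝓢(ℝ, ℂ)) : Integrable fun x => v x * φ x :=
  ((exists_distribution hs hv hb).choose_spec φ).1

theorem exists_hasFourierTransform (hs : s < 1 / 2) (hv : Continuous v)
    (hb : ∀ x, ‖v x‖ ≤ B * wt s x) : ∃ V : 𝓢'(ℝ, ℂ), HasFourierTransform V v := by
  obtain ⟨T, hT⟩ := exists_distribution hs hv hb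
  refine ⟨PointwiseConvergenceCLM.precomp ℂ fourierSInv T, fun φ => ⟨(hT φ).1, ?_⟩⟩
  have : PointwiseConvergenceCLM.precomp ℂ fourierSInv T (fourierS φ) =
      T (fourierSInv (fourierS φ)) := rfl
  rw [this, fourierSInv_fourierS, (hT φ).2]

end SlowGrowth

/-- Dual form of the rule that the transform of `qV` is `i V̂'`; it turns the defining equation into
`V̂' = -i ∑ₙ λₙ χ(ξ - n)`. -/
theorem mulQ_fourierS (V : 𝓢'(ℝ, ℂ)) (φ : 𝓢(ℝ, ℂ)) :
    mulQ V (fourierS φ) = -Complex.I * V (fourierS (SchwartzMap.derivCLM ℂ ℂ φ)) := by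
  have : mulQ V (fourierS φ) = V (opQ (fourierS φ)) := rfl
  rw [this, opQ_fourierS, map_smul, map_smul, smul_eq_mul]

/-! ### Functions with vanishing distributional derivative -/

theorem exists_schwartz_antideriv {k : ℝ → ℝ} (hk : ContDiff ℝ ∞ k) (hk' : HasCompactSupport k)
    (h0 : ∫ x, k x = 0) :
    ∃ φ : 𝓢(ℝ, ℂ), HasCompactSupport φ ∧ ∀ x, deriv φ x = k x := by
  obtain ⟨R, hR⟩ := hk'.isCompact.isBounded.subset_closedBall 0
  have hsupp : ∀ x, R < |x| → k x = 0 := fun x hx => by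
    by_contra hne
    have := hR (subset_tsupport k hne)
    rw [mem_closedBall_zero_iff, Real.norm_eq_abs] at this
    linarith
  set a := -(|R| + 1)
  have hRa : R < |R| + 1 := by linarith [le_abs_self R]
  let p : ℝ → ℝ := fun x => ∫ t in a..x, k t
  have hd : ∀ x, HasDerivAt p (k x) x := fun x =>
    intervalIntegral.integral_hasDerivAt_right (hk.continuous.intervalIntegrable _ _)
      (hk.continuous.stronglyMeasurableAtFilter _ _) hk.continuous.continuousAt
  have hp : ContDiff ℝ ∞ p := by
    rw [contDiff_infty_iff_deriv]
    refine ⟨fun x => (hd x).differentiableAt, ?_⟩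
    rwa [show deriv p = k from funext fun x => (hd x).deriv]
  have hps : HasCompactSupport p := by
    refine HasCompactSupport.of_support_subset_isCompact (isCompact_Icc (a := a) (b := |R| + 1))
      fun x hx => ?_
    by_contra hout
    apply hx
    rw [mem_Icc, not_and_or, not_le, not_le] at hout
    rcases hout with hlt | hgt
    · have : ∫ t in a..x, k t = ∫ t in a..x, (0 : ℝ) := by
        refine intervalIntegral.integral_congr fun t ht => hsupp t ?_
        rw [uIcc_of_ge hlt.le] at ht
        rw [lt_abs]
        right
        have := ht.2
        simp only [a] at this
        linarith
      simpa using this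
    · have : ∫ t in a..x, k t = ∫ t, k t := by
        refine intervalIntegral.integral_eq_integral_of_support_subset fun t ht => ?_
        have h1 : |t| ≤ R := by
          by_contra h
          exact ht (hsupp t (not_le.1 h))
        rw [abs_le] at h1
        simp only [a]
        constructor <;> linarith
      simp only [p]
      rw [this, h0]
  have hpc : ContDiff ℝ ∞ fun x => (p x : ℂ) := Complex.ofRealCLM.contDiff.comp hp
  have hpsc : HasCompactSupport fun x => (p x : ℂ) := hps.comp_left Complex.ofReal_zero
  exact ⟨hpsc.toSchwartzMap hpc, hpsc, fun x => (hd x).ofReal_comp.deriv⟩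

/-- Du Bois-Reymond's argument: subtracting from `g` its integral times a unit bump `r` leaves the
derivative of a test function. Thus `w` pairs with `g` like the constant `∫ r w`. -/
theorem exists_eq_const_of_integral_mul_deriv {w : ℝ → ℂ} (hw : Continuous w)
    (h : ∀ φ : 𝓢(ℝ, ℂ), HasCompactSupport φ → ∫ x, w x * deriv φ x = 0) : ∃ c, ∀ x, w x = c := by
  let ρ : ContDiffBump (0 : ℝ) := ⟨1, 2, one_pos, one_lt_two⟩
  set r : ℝ → ℝ := ρ.normed volume
  have hr1 : ContDiff ℝ ∞ r := ρ.contDiff_normed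
  have hr2 : HasCompactSupport r := ρ.hasCompactSupport_normed
  have hr3 : ∫ x, r x = 1 := ρ.integral_normed
  have hint : ∀ g : ℝ → ℝ, Continuous g → HasCompactSupport g → Integrable fun x => g x • w x :=
    fun g h1 h2 => (h1.smul hw).integrable_of_hasCompactSupport h2.smul_right
  refine ⟨∫ x, r x • w x, fun x => ?_⟩
  refine congrFun ((hw.ae_eq_iff_eq (μ := volume) continuous_const).1 ?_) x
  refine ae_eq_of_integral_contDiff_smul_eq hw.locallyIntegrable (locallyIntegrable_const _)
    fun g hg1 hg2 => ?_
  have hgi := hg1.continuous.integrable_of_hasCompactSupport (μ := volume) hg2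
  have hri := hr1.continuous.integrable_of_hasCompactSupport (μ := volume) hr2
  obtain ⟨φ, hφ1, hφ2⟩ := exists_schwartz_antideriv
    (k := fun x => g x - (∫ y, g y) * r x) (hg1.sub (contDiff_const.mul hr1))
    (hg2.sub hr2.mul_left) (by
      rw [integral_sub hgi (hri.const_mul _), integral_const_mul, hr3]; ring)
  have h1 := h φ hφ1
  simp only [hφ2] at h1
  have h2 : ∀ x, w x * ((g x - (∫ y, g y) * r x : ℝ) : ℂ) =
      g x • w x - (∫ y, g y) • (r x • w x) := fun x => by
    simp only [Complex.real_smul]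
    push_cast
    ring
  simp only [h2] at h1
  have h3 : Integrable fun x => (∫ y, g y) • (r x • w x) :=
    (hint r hr1.continuous hr2).smul (∫ y, g y)
  rw [integral_sub (hint g hg1.continuous hg2) h3, integral_smul, sub_eq_zero] at h1
  rw [h1, integral_smul_const]

/-! ### The matrix elements of multiplication operators -/

/-- The transform of a product as a correlation of transforms. Inserting the inversion formula for
`φ` and exchanging the integrals leaves the conjugate transform of `ψ` at `k + l`. -/
theorem fourierInv_conjMul (φ ψ : 𝓢(ℝ, ℂ)) (k : ℝ) :
    (𝓕⁻ (conjMul ψ φ) : 𝓢(ℝ, ℂ)) k =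
      ∫ l, starRingEnd ℂ ((𝓕 ψ : 𝓢(ℝ, ℂ)) (k + l)) * (𝓕 φ : 𝓢(ℝ, ℂ)) l := by
  have hφ : ∀ x, φ x = ∫ l : ℝ, Complex.exp (((2 * Real.pi * l * x : ℝ) : ℂ) * Complex.I) *
      (𝓕 φ : 𝓢(ℝ, ℂ)) l := fun x => by
    have h1 : (𝓕⁻ (𝓕 φ) : 𝓢(ℝ, ℂ)) x = φ x := by rw [FourierTransform.fourierInv_fourier_eq]
    rw [← h1, SchwartzMap.fourierInv_coe, Real.fourierInv_eq']
    simp [mul_assoc, mul_comm]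
  have hψ : ∀ m, (𝓕 ψ : 𝓢(ℝ, ℂ)) m =
      ∫ x : ℝ, Complex.exp (((-2 * Real.pi * x * m : ℝ) : ℂ) * Complex.I) * ψ x := fun m => by
    rw [SchwartzMap.fourier_coe, Real.fourier_real_eq_integral_exp_smul]
    rfl
  let G : ℝ → ℝ → ℂ := fun x l => Complex.exp (((2 * Real.pi * x * (k + l) : ℝ) : ℂ) * Complex.I) *
    (starRingEnd ℂ (ψ x) * (𝓕 φ : 𝓢(ℝ, ℂ)) l)
  have hG : Integrable (Function.uncurry G) (volume.prod volume) := by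
    have h1 : Integrable fun x => starRingEnd ℂ (ψ x) :=
      ψ.integrable.mono (Complex.continuous_conj.comp ψ.continuous).aestronglyMeasurable
        (ae_of_all _ fun x => (RCLike.norm_conj _).le)
    refine (h1.mul_prod (𝓕 φ : 𝓢(ℝ, ℂ)).integrable).bdd_mul (c := 1)
      (Continuous.aestronglyMeasurable (by fun_prop)) (ae_of_all _ fun p => ?_)
    rw [Complex.norm_exp_ofReal_mul_I]
  have e1 : (𝓕⁻ (conjMul ψ φ) : 𝓢(ℝ, ℂ)) k = ∫ x, ∫ l, G x l := by
    rw [SchwartzMap.fourierInv_coe, Real.fourierInv_eq']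
    refine integral_congr_ae (ae_of_all _ fun x => ?_)
    have h1 : conjMul ψ φ x = starRingEnd ℂ (ψ x) * φ x := rfl
    simp only [G]
    rw [h1, hφ x, smul_eq_mul, ← integral_const_mul, ← integral_const_mul]
    refine integral_congr_ae (ae_of_all _ fun l => ?_)
    have h2 : Complex.exp (((2 * Real.pi * x * (k + l) : ℝ) : ℂ) * Complex.I) =
        Complex.exp (((2 * Real.pi * inner ℝ x k : ℝ) : ℂ) * Complex.I) *
          Complex.exp (((2 * Real.pi * l * x : ℝ) : ℂ) * Complex.I) := by
      rw [← Complex.exp_add]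
      congr 1
      simp only [RCLike.inner_apply, conj_trivial]
      push_cast
      ring
    simp only
    rw [h2]
    ring
  rw [e1, integral_integral_swap hG]
  refine integral_congr_ae (ae_of_all _ fun l => ?_)
  simp only [G]
  rw [hψ, ← integral_conj, ← integral_mul_const]
  refine integral_congr_ae (ae_of_all _ fun x => ?_)
  simp only
  rw [map_mul, ← Complex.exp_conj, map_mul, Complex.conj_I, Complex.conj_ofReal, ← mul_assoc]
  congr 3
  push_cast
  ring

theorem HasFourierTransform.apply_eq {V : 𝓢'(ℝ, ℂ)} {v : ℝ → ℂ} (hV : HasFourierTransform V v)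
    (θ : 𝓢(ℝ, ℂ)) :
    V θ = ∫ k, (√(2 * Real.pi) * v (2 * Real.pi * k)) * (𝓕⁻ θ : 𝓢(ℝ, ℂ)) k := by
  have h1 := (hV (fourierSInv θ)).2
  rw [fourierS_fourierSInv] at h1
  have h2 := Measure.integral_comp_mul_right
    (fun k : ℝ => v (2 * Real.pi * k) * (((√(2 * Real.pi))⁻¹ : ℂ) * (𝓕⁻ θ : 𝓢(ℝ, ℂ)) k))
    (2 * Real.pi)⁻¹
  rw [inv_inv, abs_of_pos Real.two_pi_pos, Complex.real_smul, ← integral_const_mul] at h2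
  have h3 : ∀ ξ : ℝ, 2 * Real.pi * (ξ * (2 * Real.pi)⁻¹) = ξ := fun ξ => by
    have := Real.pi_ne_zero
    field_simp
  simp only [h3] at h2
  rw [h1]
  simp only [fourierSInv_apply]
  rw [h2]
  refine integral_congr_ae (ae_of_all _ fun k => ?_)
  have h4 : ((2 * Real.pi : ℝ) : ℂ) * (√(2 * Real.pi) : ℂ)⁻¹ = √(2 * Real.pi) := by
    push_cast
    rw [← sqrt_two_pi_mul_self, mul_assoc, mul_inv_cancel₀ sqrt_two_pi_ne_zero, mul_one]
  linear_combination v (2 * Real.pi * k) * (𝓕⁻ θ : 𝓢(ℝ, ℂ)) k * h4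

theorem kernelForm_toH1 {K : ℝ × ℝ → ℂ} (φ ψ : 𝓢(ℝ, ℂ)) : kernelForm K (toH1 φ) (toH1 ψ) =
    ∫ p : ℝ × ℝ, K p * (starRingEnd ℂ ((𝓕 ψ : 𝓢(ℝ, ℂ)) p.1) * (𝓕 φ : 𝓢(ℝ, ℂ)) p.2) := by
  refine integral_congr_ae ?_
  filter_upwards [IsKernel.ae_fst (coeFn_ft_toH1 ψ), IsKernel.ae_snd (coeFn_ft_toH1 φ)] with p h1 h2
  rw [h1, h2]

/-- The measure preserving shear `(k, l) ↦ (k + l, l)` turns `w(p.1 - p.2)` into `w(k)`. The inner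
integral is then the inverse transform of `conj ψ · φ`, and the outer one evaluates `V` on this
product. -/
theorem isMultiplicationBy_op {V : 𝓢'(ℝ, ℂ)} {v w : ℝ → ℂ} {s C : ℝ} (hV : HasFourierTransform V v)
    (hw : ∀ k, w k = √(2 * Real.pi) * v (2 * Real.pi * k))
    (hK : IsKernel s C fun p => w (p.1 - p.2)) : IsMultiplicationBy V hK.op := by
  intro φ ψ
  let e : ℝ × ℝ ≃ₜ ℝ × ℝ :=
    { toFun := fun z => (z.1 + z.2, z.2)
      invFun := fun z => (z.1 - z.2, z.2)
      left_inv := fun z => by simp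
      right_inv := fun z => by simp
      continuous_toFun := by fun_prop
      continuous_invFun := by fun_prop }
  have he' : ∀ z, e z = (z.1 + z.2, z.2) := fun _ => rfl
  have he : MeasurePreserving e (volume.prod volume) (volume.prod volume) :=
    measurePreserving_add_prod (volume : Measure ℝ) (volume : Measure ℝ)
  have hint := hK.integrable (toH1 φ) (toH1 ψ)
  have hint' : Integrable (fun p : ℝ × ℝ => w (p.1 - p.2) *
      (starRingEnd ℂ ((𝓕 ψ : 𝓢(ℝ, ℂ)) p.1) * (𝓕 φ : 𝓢(ℝ, ℂ)) p.2)) (volume.prod volume) := by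
    refine hint.congr ?_
    filter_upwards [IsKernel.ae_fst (coeFn_ft_toH1 ψ), IsKernel.ae_snd (coeFn_ft_toH1 φ)]
      with p h1 h2
    rw [h1, h2]
  have hint'' := (he.integrable_comp_emb e.measurableEmbedding).2 hint'
  rw [hK.op_apply, kernelForm_toH1, Measure.volume_eq_prod,
    ← he.integral_comp e.measurableEmbedding]
  have h1 := integral_prod _ hint''
  simp only [Function.comp_def] at h1
  rw [h1, hV.apply_eq]
  refine integral_congr_ae (ae_of_all _ fun k => ?_)
  simp only [he', add_sub_cancel_right]
  rw [fourierInv_conjMul, ← hw, ← integral_const_mul]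

theorem isSymm_op {w : ℝ → ℂ} {s C : ℝ} (hw : ∀ k, w (-k) = starRingEnd ℂ (w k))
    (hK : IsKernel s C fun p => w (p.1 - p.2)) : IsSymm hK.op := by
  intro f g
  rw [hK.op_apply, hK.op_apply, kernelForm, kernelForm, ← integral_conj, Measure.volume_eq_prod,
    ← integral_prod_swap]
  refine integral_congr_ae (ae_of_all _ fun p => ?_)
  simp only [Prod.fst_swap, Prod.snd_swap, map_mul, Complex.conj_conj]
  rw [← hw, neg_sub]
  ring

end NakReg

end

noncomputable section

namespace NakReg

open Set Filter Topology

/-! ### The potentials -/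

/-- A bump `χ` and weights `λₙ` with `∑ₙ λₙ ⟨n⟩^(-s) < ∞`, `0 < s < 1/2`. -/
structure BumpData (χ : ℝ → ℝ) (lam : ℤ → ℝ) (s : ℝ) : Prop where
  contDiff : ContDiff ℝ 1 χ
  supp : ∀ x, 1 < |x| → χ x = 0
  pos : ∀ x, |x| < 1 → 0 < χ x
  even : ∀ x, χ (-x) = χ x
  lam_even : ∀ n, lam (-n) = lam n
  lam_nonneg : ∀ n, 0 ≤ lam n
  s_nonneg : 0 ≤ s
  s_lt : s < 1 / 2
  summable : Summable fun n : ℤ => lam n * √(1 + (n : ℝ) ^ 2) ^ (-s)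

/-- The function `c - i ∫₀^ξ ∑ₙ λₙ χ(η - n) dη`, the Fourier transform of a potential. -/
def potFun (χ : ℝ → ℝ) (lam : ℤ → ℝ) (c ξ : ℝ) : ℂ := c - Complex.I * latticePrim lam χ ξ

/-- The function `potFun` in the frequency variable. -/
def potSymb (χ : ℝ → ℝ) (lam : ℤ → ℝ) (c k : ℝ) : ℂ :=
  √(2 * Real.pi) * potFun χ lam c (2 * Real.pi * k)

namespace BumpData

variable {χ : ℝ → ℝ} {lam : ℤ → ℝ} {s : ℝ}

theorem hasDerivAt (h : BumpData χ lam s) (x : ℝ) : HasDerivAt χ (deriv χ x) x :=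
  (h.contDiff.differentiable one_ne_zero).differentiableAt.hasDerivAt

theorem continuous_deriv (h : BumpData χ lam s) : Continuous (deriv χ) :=
  h.contDiff.continuous_deriv le_rfl

theorem deriv_supp (h : BumpData χ lam s) (x : ℝ) (hx : 1 < |x|) : deriv χ x = 0 := by
  have : χ =ᶠ[𝓝 x] fun _ => 0 := by
    filter_upwards [(isOpen_lt continuous_const continuous_abs).mem_nhds hx] with y hy
    exact h.supp y hy
  rw [this.deriv_eq, deriv_const]

theorem nonneg (h : BumpData χ lam s) (x : ℝ) : 0 ≤ χ x := by
  rcases lt_trichotomy |x| 1 with hx | hx | hx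
  · exact (h.pos x hx).le
  · have hcl : x ∈ closure (Ioo (-1 : ℝ) 1) := by
      rw [closure_Ioo (by norm_num)]
      exact abs_le.1 hx.le
    refine closure_minimal (fun y hy => ?_) (isClosed_le continuous_const h.contDiff.continuous) hcl
    exact (h.pos y (abs_lt.2 hy)).le
  · exact (h.supp x hx).ge

theorem one_le_wt (hs : 0 ≤ s) (x : ℝ) : 1 ≤ wt s x :=
  Real.one_le_rpow (by linarith [abs_nonneg x]) hs

theorem exists_bounds (h : BumpData χ lam s) : ∃ B, 0 ≤ B ∧
    (∀ ξ, |latticePrim lam χ ξ| ≤ B * wt s ξ) ∧ (∀ ξ, |latticeSum lam χ ξ| ≤ B * wt s ξ) ∧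
    ∀ ξ, |latticeSum lam (deriv χ) ξ| ≤ B * wt s ξ := by
  obtain ⟨C₁, hC₁⟩ := (hasCompactSupport_of_unit h.supp).exists_bound_of_continuous
    h.contDiff.continuous
  obtain ⟨C₂, hC₂⟩ := (hasCompactSupport_of_unit h.deriv_supp).exists_bound_of_continuous
    h.continuous_deriv
  have h0 := fun ξ => abs_latticePrim_le h.lam_nonneg h.s_nonneg h.summable h.supp
    h.contDiff.continuous ξ
  have h1 := fun ξ => abs_latticeSum_le h.lam_nonneg h.s_nonneg h.summable h.supp hC₁ ξ
  have h2 := fun ξ => abs_latticeSum_le h.lam_nonneg h.s_nonneg h.summable h.deriv_supp hC₂ ξ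
  set B₀ := (∫ x, |χ x|) * (2 ^ s * weightSum lam s)
  set B₁ := C₁ * (2 ^ s * weightSum lam s)
  set B₂ := C₂ * (2 ^ s * weightSum lam s)
  have hle : ∀ (b : ℝ) (ξ : ℝ), b ≤ |B₀| + |B₁| + |B₂| →
      b * wt s ξ ≤ (|B₀| + |B₁| + |B₂|) * wt s ξ := fun b ξ hb =>
    mul_le_mul_of_nonneg_right hb (wt_pos s ξ).le
  have p0 := abs_nonneg B₀
  have p1 := abs_nonneg B₁
  have p2 := abs_nonneg B₂
  exact ⟨|B₀| + |B₁| + |B₂|, by positivity,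
    fun ξ => (h0 ξ).trans (hle _ ξ (by linarith [le_abs_self B₀])),
    fun ξ => (h1 ξ).trans (hle _ ξ (by linarith [le_abs_self B₁])),
    fun ξ => (h2 ξ).trans (hle _ ξ (by linarith [le_abs_self B₂]))⟩

theorem hasDerivAt_prim (h : BumpData χ lam s) (ξ : ℝ) :
    HasDerivAt (fun ξ => (latticePrim lam χ ξ : ℂ)) (latticeSum lam χ ξ : ℂ) ξ :=
  (hasDerivAt_latticePrim h.supp h.contDiff.continuous ξ).ofReal_comp

theorem continuous_prim (h : BumpData χ lam s) :
    Continuous fun ξ => (latticePrim lam χ ξ : ℂ) :=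
  continuous_iff_continuousAt.2 fun ξ => (h.hasDerivAt_prim ξ).continuousAt

theorem continuous_sum (h : BumpData χ lam s) : Continuous fun ξ => (latticeSum lam χ ξ : ℂ) :=
  Complex.continuous_ofReal.comp (continuous_latticeSum h.supp h.contDiff.continuous)

theorem integrable_prim_mul (h : BumpData χ lam s) (φ : 𝓢(ℝ, ℂ)) :
    Integrable fun x => (latticePrim lam χ x : ℂ) * φ x := by
  obtain ⟨B, -, h1, -, -⟩ := h.exists_bounds
  exact integrable_mul_schwartz h.s_lt h.continuous_prim
    (fun x => by rw [Complex.norm_real]; exact h1 x) φ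

theorem integrable_sum_mul (h : BumpData χ lam s) (φ : 𝓢(ℝ, ℂ)) :
    Integrable fun x => (latticeSum lam χ x : ℂ) * φ x := by
  obtain ⟨B, -, -, h1, -⟩ := h.exists_bounds
  exact integrable_mul_schwartz h.s_lt h.continuous_sum
    (fun x => by rw [Complex.norm_real]; exact h1 x) φ

theorem integral_prim_mul_deriv (h : BumpData χ lam s) (φ : 𝓢(ℝ, ℂ)) :
    ∫ x, (latticePrim lam χ x : ℂ) * SchwartzMap.derivCLM ℂ ℂ φ x =
      -∫ x, (latticeSum lam χ x : ℂ) * φ x :=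
  integral_mul_deriv_eq_deriv_mul_of_integrable (fun x _ => h.hasDerivAt_prim x)
    (fun x _ => φ.hasDerivAt x) (h.integrable_prim_mul (SchwartzMap.derivCLM ℂ ℂ φ))
    (h.integrable_sum_mul φ) (h.integrable_prim_mul φ)

theorem continuous_potFun (h : BumpData χ lam s) (c : ℝ) : Continuous (potFun χ lam c) :=
  continuous_const.sub (continuous_const.mul h.continuous_prim)

theorem potFun_zero (χ : ℝ → ℝ) (lam : ℤ → ℝ) (c : ℝ) : potFun χ lam c 0 = c := by
  simp [potFun, latticePrim_zero]

theorem norm_potFun_le {B c ξ : ℝ} (hs : 0 ≤ s) (hB : |latticePrim lam χ ξ| ≤ B * wt s ξ) :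
    ‖potFun χ lam c ξ‖ ≤ (|c| + B) * wt s ξ := by
  refine (norm_sub_le _ _).trans ?_
  rw [norm_mul, Complex.norm_I, one_mul, Complex.norm_real, Complex.norm_real, add_mul]
  exact add_le_add (le_mul_of_one_le_right (abs_nonneg c) (one_le_wt hs ξ)) hB

theorem exists_isPotential (h : BumpData χ lam s) : ∃ V : 𝓢'(ℝ, ℂ), IsPotential χ lam V := by
  obtain ⟨B, -, h1, -, -⟩ := h.exists_bounds
  obtain ⟨V, hV⟩ := exists_hasFourierTransform (v := potFun χ lam 0) h.s_lt (h.continuous_potFun 0)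
    fun ξ => norm_potFun_le h.s_nonneg (h1 ξ)
  refine ⟨V, fun φ => ⟨h.integrable_sum_mul φ, ?_⟩, _, h.continuous_potFun 0, hV, by
    rw [potFun_zero, Complex.ofReal_im]⟩
  rw [mulQ_fourierS, (hV _).2]
  have h2 : ∀ ξ, potFun χ lam 0 ξ * SchwartzMap.derivCLM ℂ ℂ φ ξ =
      -Complex.I * ((latticePrim lam χ ξ : ℂ) * SchwartzMap.derivCLM ℂ ℂ φ ξ) := fun ξ => by
    simp only [potFun, Complex.ofReal_zero]
    ring
  simp only [h2, bumpSum_eq]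
  rw [integral_const_mul, h.integral_prim_mul_deriv]
  linear_combination (-∫ x, (latticeSum lam χ x : ℂ) * φ x) * Complex.I_mul_I

/-- The functions `V̂` and `-i · latticePrim` have the same distributional derivative, so they
differ by a constant. It equals `V̂(0)`, because the primitive vanishes at `0`, and is therefore
real. -/
theorem exists_potFun (h : BumpData χ lam s) {V : 𝓢'(ℝ, ℂ)} (hV : IsPotential χ lam V) :
    ∃ c, HasFourierTransform V (potFun χ lam c) := by
  obtain ⟨h1, v, hv, hVv, hv0⟩ := hV
  obtain ⟨c, hc⟩ := exists_eq_const_of_integral_mul_deriv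
    (w := fun ξ => v ξ + Complex.I * latticePrim lam χ ξ)
    (hv.add (continuous_const.mul h.continuous_prim)) fun φ _ => by
      have e1 := (h1 φ).2
      rw [mulQ_fourierS, (hVv _).2] at e1
      have e2 : ∀ ξ, (v ξ + Complex.I * latticePrim lam χ ξ) * deriv φ ξ =
          v ξ * SchwartzMap.derivCLM ℂ ℂ φ ξ +
            Complex.I * ((latticePrim lam χ ξ : ℂ) * SchwartzMap.derivCLM ℂ ℂ φ ξ) := fun ξ => by
        rw [SchwartzMap.derivCLM_apply]; ring
      simp only [e2]
      rw [integral_add (hVv _).1 ((h.integrable_prim_mul _).const_mul _), integral_const_mul,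
        h.integral_prim_mul_deriv]
      simp only [bumpSum_eq] at e1
      linear_combination Complex.I * e1 +
        (∫ ξ, v ξ * SchwartzMap.derivCLM ℂ ℂ φ ξ) * Complex.I_mul_I
  have h0 : c = ((v 0).re : ℂ) := by
    rw [← hc 0, latticePrim_zero]
    apply Complex.ext <;> simp [hv0]
  have hvp : v = potFun χ lam (v 0).re := by
    ext ξ
    rw [potFun, ← h0, ← hc ξ]
    ring
  exact ⟨_, hvp ▸ hVv⟩

/-- Up to scaling, the two derivatives are the lattice sums of `χ` and of `χ'`, so `χ ∈ C¹` is
enough. All three functions have growth of order `s`. -/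
theorem exists_isSymbol (h : BumpData χ lam s) (c : ℝ) :
    ∃ B w₁ w₂, IsSymbol s B (potSymb χ lam c) w₁ w₂ := by
  obtain ⟨B, hB, h1, h2, h3⟩ := h.exists_bounds
  set a : ℝ := 2 * Real.pi
  have ha : 1 ≤ a := by simp only [a]; linarith [Real.pi_gt_three]
  have hwt : ∀ k, wt s (a * k) ≤ a ^ s * wt s k := fun k =>
    wt_le_of_le h.s_nonneg ha (by rw [abs_mul, abs_of_nonneg (by linarith)])
  have hlin : ∀ k : ℝ, HasDerivAt (fun k => a * k) a k := fun k => by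
    simpa using (hasDerivAt_id k).const_mul a
  have hd0 : ∀ k, HasDerivAt (potSymb χ lam c)
      (√a * (-Complex.I * (a * latticeSum lam χ (a * k)))) k := fun k => by
    have := (((h.hasDerivAt_prim (a * k)).scomp k (hlin k)).const_mul Complex.I).const_sub (c : ℂ)
    refine (this.const_mul (√a : ℂ)).congr_deriv ?_
    rw [Complex.real_smul]
    ring
  have hd1 : ∀ k, HasDerivAt (fun k => (√a * (-Complex.I * (a * latticeSum lam χ (a * k))) : ℂ))
      (√a * (-Complex.I * (a * (a * latticeSum lam (deriv χ) (a * k))))) k := fun k => by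
    have h4 := (hasDerivAt_latticeSum (lam := lam) h.supp h.deriv_supp h.hasDerivAt
      (a * k)).ofReal_comp
    have := (((h4.scomp k (hlin k)).const_mul (a : ℂ)).const_mul (-Complex.I)).const_mul (√a : ℂ)
    refine this.congr_deriv ?_
    rw [Complex.real_smul]
  have hsa : 0 ≤ √a := Real.sqrt_nonneg a
  have hcB : 0 ≤ |c| + B := by positivity
  have has : 0 ≤ a ^ s := by positivity
  have hm : ∀ {t b k : ℝ}, 0 ≤ b → |t| ≤ b * wt s (a * k) → |t| ≤ b * (a ^ s * wt s k) :=
    fun {t b k} hb ht => ht.trans (mul_le_mul_of_nonneg_left (hwt k) hb)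
  -- Two differentiations give two factors `a = 2π` by the chain rule. As `a ≥ 1`, the same constant
  -- dominates the lower derivatives.
  refine ⟨√a * a * a * a ^ s * (|c| + B), _, _, hd0, hd1, fun k => ?_, fun k => ?_, fun k => ?_⟩
  · have e1 := (norm_potFun_le (c := c) h.s_nonneg (h1 (a * k))).trans
      (mul_le_mul_of_nonneg_left (hwt k) hcB)
    rw [potSymb, norm_mul, Complex.norm_real, Real.norm_of_nonneg hsa]
    have hw := (wt_pos s k).le
    calc _ ≤ √a * ((|c| + B) * (a ^ s * wt s k)) := by gcongr
      _ ≤ √a * ((|c| + B) * (a ^ s * wt s k)) * (a * a) :=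
          le_mul_of_one_le_right (by positivity) (by nlinarith)
      _ = _ := by ring
  · have e1 := hm hB (h2 (a * k))
    rw [norm_mul, norm_mul, norm_mul, norm_neg, Complex.norm_I, one_mul, Complex.norm_real,
      Complex.norm_real, Complex.norm_real, Real.norm_of_nonneg hsa,
      Real.norm_of_nonneg (zero_le_one.trans ha), Real.norm_eq_abs]
    have hw := (wt_pos s k).le
    calc _ ≤ √a * (a * (B * (a ^ s * wt s k))) := by gcongr
      _ ≤ √a * (a * ((|c| + B) * (a ^ s * wt s k))) := by
          gcongr; linarith [abs_nonneg c]
      _ ≤ √a * (a * ((|c| + B) * (a ^ s * wt s k))) * a :=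
          le_mul_of_one_le_right (by positivity) ha
      _ = _ := by ring
  · have e1 := hm hB (h3 (a * k))
    rw [norm_mul, norm_mul, norm_mul, norm_mul, norm_neg, Complex.norm_I, one_mul,
      Complex.norm_real, Complex.norm_real, Complex.norm_real, Real.norm_of_nonneg hsa,
      Real.norm_of_nonneg (zero_le_one.trans ha), Real.norm_eq_abs]
    have hw := (wt_pos s k).le
    calc _ ≤ √a * (a * (a * (B * (a ^ s * wt s k)))) := by gcongr
      _ ≤ √a * (a * (a * ((|c| + B) * (a ^ s * wt s k)))) := by
          gcongr; linarith [abs_nonneg c]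
      _ = _ := by ring

theorem potSymb_neg (h : BumpData χ lam s) (c k : ℝ) :
    potSymb χ lam c (-k) = starRingEnd ℂ (potSymb χ lam c k) := by
  simp only [potSymb, potFun]
  rw [mul_neg, latticePrim_neg h.even h.lam_even]
  simp only [map_mul, map_sub, Complex.conj_ofReal, Complex.conj_I, Complex.ofReal_neg]
  ring

end BumpData

end NakReg

end

noncomputable section

namespace NakReg

open Set Filter Topology

/-! ### The dilation group -/

theorem rescale_id : rescale (fun x => x) = fun x => x := by
  ext x
  have := Real.pi_ne_zero
  rw [rescale]
  field_simp

theorem flowField_id : FlowField (rescale fun x => x) 1 := by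
  rw [rescale_id]
  exact
    { temperate := by fun_prop
      zero := rfl
      bound₁ := fun x => by simp
      bound₂ := fun x => by simp }

/-- The dilation field is unbounded, so `exists_isFlow` does not apply; its flow is written down
explicitly. -/
theorem isFlow_exp : IsFlow (rescale fun x => x) fun t x => Real.exp t * x := by
  rw [rescale_id]
  exact
    { zero := fun x => by simp
      hasDerivAt := fun t x => (Real.hasDerivAt_exp t).mul_const x }

theorem sqrtJac_id (φ : ℝ → ℝ → ℝ) (t x : ℝ) :
    sqrtJac (rescale fun x => x) φ t x = Real.exp (t / 2) := by
  rw [rescale_id, sqrtJac, logJac]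
  simp

theorem evolvedKernel_id (w : ℝ → ℂ) (τ : ℝ) (p : ℝ × ℝ) :
    evolvedKernel (rescale fun x => x) (fun t x => Real.exp t * x) τ (fun p => w (p.1 - p.2)) p =
      (Real.exp (-τ) : ℂ) * w (Real.exp (-τ) * (p.1 - p.2)) := by
  rw [evolvedKernel, sqrtJac_id, sqrtJac_id, ← Real.exp_add, add_halves, mul_sub]

/-! ### Wave packets -/

/-- A bump supported in a small neighbourhood of `0`. -/
def packet : ContDiffBump (0 : ℝ) :=
  ⟨1 / (32 * Real.pi), 1 / (16 * Real.pi), by positivity,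
    one_div_lt_one_div_of_lt (by positivity) (by linarith [Real.pi_pos])⟩

theorem packet_eq_zero {x : ℝ} (hx : 1 / (16 * Real.pi) < |x|) : packet x = 0 :=
  packet.zero_of_le_dist (by simpa [packet] using hx.le)

theorem continuous_packet : Continuous packet := packet.continuous

theorem integral_packet_pos : 0 < ∫ x, packet x := packet.integral_pos

theorem contDiff_packet_sub (a : ℝ) : ContDiff ℝ ∞ fun x => (packet (x - a) : ℂ) :=
  Complex.ofRealCLM.contDiff.comp (packet.contDiff.comp (contDiff_id.sub contDiff_const))

theorem hasCompactSupport_packet_sub (a : ℝ) : HasCompactSupport fun x => (packet (x - a) : ℂ) :=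
  (packet.hasCompactSupport.comp_homeomorph (Homeomorph.subRight a)).comp_left Complex.ofReal_zero

/-- The bump translated to `a`. -/
def packetAt (a : ℝ) : 𝓢(ℝ, ℂ) := (hasCompactSupport_packet_sub a).toSchwartzMap (contDiff_packet_sub a)

theorem packetAt_apply (a x : ℝ) : packetAt a x = packet (x - a) := rfl

/-- The wave packet with frequency `a`. -/
def wave (a : ℝ) : 𝓢(ℝ, ℂ) := 𝓕⁻ (packetAt a)

theorem fourier_wave (a : ℝ) : (𝓕 (wave a) : 𝓢(ℝ, ℂ)) = packetAt a :=
  FourierTransform.fourier_fourierInv_eq _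

theorem integrable_mul_packet {G : ℝ × ℝ → ℝ} (hG : Continuous G) (a : ℝ) :
    Integrable fun p : ℝ × ℝ => G p * (packet (p.1 - a) * packet p.2) := by
  have h1 := continuous_packet
  refine Continuous.integrable_of_hasCompactSupport (by fun_prop) ?_
  refine HasCompactSupport.of_support_subset_isCompact
    ((isCompact_closedBall a (1 / (16 * Real.pi))).prod
      (isCompact_closedBall (0 : ℝ) (1 / (16 * Real.pi)))) fun p hp => ?_
  rw [mem_prod, mem_closedBall_iff_norm, mem_closedBall_zero_iff, Real.norm_eq_abs,
    Real.norm_eq_abs]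
  by_contra hcon
  apply hp
  rw [not_and_or, not_le, not_le] at hcon
  rcases hcon with h | h
  · simp [packet_eq_zero h]
  · simp [packet_eq_zero h]

theorem le_integral_mul_packet {G : ℝ × ℝ → ℝ} (hG : Continuous G) {a m : ℝ}
    (h : ∀ p : ℝ × ℝ, |p.1 - a| ≤ 1 / (16 * Real.pi) → |p.2| ≤ 1 / (16 * Real.pi) → m ≤ G p) :
    m * (∫ x, packet x) ^ 2 ≤ ∫ p : ℝ × ℝ, G p * (packet (p.1 - a) * packet p.2) := by
  have h1 : ∫ p : ℝ × ℝ, packet (p.1 - a) * packet p.2 = (∫ x, packet x) ^ 2 := by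
    rw [Measure.volume_eq_prod, integral_prod_mul (fun x => packet (x - a)) packet,
      integral_sub_right_eq_self packet a, sq]
  rw [← h1, ← integral_const_mul]
  refine integral_mono (integrable_mul_packet (G := fun _ => m) continuous_const a)
    (integrable_mul_packet hG a) fun p => ?_
  simp only
  by_cases hp : |p.1 - a| ≤ 1 / (16 * Real.pi) ∧ |p.2| ≤ 1 / (16 * Real.pi)
  · exact mul_le_mul_of_nonneg_right (h p hp.1 hp.2) (mul_nonneg packet.nonneg packet.nonneg)
  · rw [not_and_or, not_le, not_le] at hp
    rcases hp with h | h
    · simp [packet_eq_zero h]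
    · simp [packet_eq_zero h]

/-- The packets have real nonnegative transforms. Taking imaginary parts therefore isolates the
monotone primitive, discards the real constant `c`, and leaves an integral bounded below pointwise.
-/
theorem im_kernelForm_wave {K : ℝ × ℝ → ℂ} (hK : Continuous K) (a : ℝ) :
    (kernelForm K (toH1 (wave 0)) (toH1 (wave a))).im =
      ∫ p : ℝ × ℝ, (K p).im * (packet (p.1 - a) * packet p.2) := by
  have h1 : ∀ p : ℝ × ℝ, K p * (starRingEnd ℂ ((𝓕 (wave a) : 𝓢(ℝ, ℂ)) p.1) *
      (𝓕 (wave 0) : 𝓢(ℝ, ℂ)) p.2) =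
      ((K p).re * (packet (p.1 - a) * packet p.2) : ℝ) +
        ((K p).im * (packet (p.1 - a) * packet p.2) : ℝ) * Complex.I := fun p => by
    rw [fourier_wave, fourier_wave, packetAt_apply, packetAt_apply, sub_zero, Complex.conj_ofReal]
    nth_rewrite 1 [← Complex.re_add_im (K p)]
    push_cast
    ring
  have i1 := integrable_mul_packet (Complex.continuous_re.comp hK) a
  have i2 := integrable_mul_packet (Complex.continuous_im.comp hK) a
  rw [kernelForm_toH1]
  simp only [h1]
  simp only [Function.comp_apply] at i1 i2
  rw [integral_add i1.ofReal (i2.ofReal.mul_const _), integral_mul_const, integral_complex_ofReal,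
    integral_complex_ofReal]
  simp

theorem norm_packetAt (a : ℝ) : ‖toL2 (packetAt a)‖ ^ 2 = ∫ x, packet x ^ 2 := by
  rw [norm_sq_L2, ← integral_sub_right_eq_self (fun x => packet x ^ 2) a]
  refine integral_congr_ae ?_
  filter_upwards [IsFlow.coeFn_toL2 (packetAt a)] with x hx
  rw [hx, packetAt_apply, Complex.norm_real, Real.norm_eq_abs, sq_abs]

theorem norm_fn_wave (a : ℝ) : ‖fn (toH1 (wave a))‖ = √(∫ x, packet x ^ 2) := by
  have h : fourierL2 (fn (toH1 (wave a))) = toL2 (packetAt a) :=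
    (ft_toH1 (wave a)).trans (by rw [fourier_wave])
  rw [← fourierL2.norm_map, h, ← norm_packetAt a, Real.sqrt_sq (norm_nonneg _)]

theorem norm_fourier_weakDeriv_wave_le (a x : ℝ) :
    ‖(2 * Real.pi * Complex.I * x : ℂ) * packet (x - a)‖ ≤
      2 * Real.pi * (|a| + 1 / (16 * Real.pi)) * packet (x - a) := by
  have hp := packet.nonneg (x := x - a)
  have hn : ‖(2 * Real.pi * Complex.I * x : ℂ)‖ = 2 * Real.pi * |x| := by
    simp [abs_of_pos Real.pi_pos]
  rw [norm_mul, Complex.norm_real, Real.norm_of_nonneg hp, hn]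
  rcases le_or_gt |x - a| (1 / (16 * Real.pi)) with hx | hx
  · have hxa : |x| ≤ |a| + 1 / (16 * Real.pi) := by linarith [abs_sub_abs_le_abs_sub x a]
    exact mul_le_mul_of_nonneg_right (mul_le_mul_of_nonneg_left hxa Real.two_pi_pos.le) hp
  · rw [packet_eq_zero hx, mul_zero, mul_zero]

theorem norm_sq_weakDeriv_wave_le (a : ℝ) :
    ‖weakDeriv (toH1 (wave a))‖ ^ 2 ≤
      (2 * Real.pi * (|a| + 1 / (16 * Real.pi))) ^ 2 * ∫ x, packet x ^ 2 := by
  generalize hM : 2 * Real.pi * (|a| + 1 / (16 * Real.pi)) = M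
  have hint : Integrable fun x => packet x ^ 2 := by
    simp only [sq]
    exact (continuous_packet.mul continuous_packet).integrable_of_hasCompactSupport
      (packet.hasCompactSupport.mul_left (f := packet))
  rw [← fourierL2.norm_map]
  refine (norm_sq_le_of_memLp (g := fun x => M * packet (x - a)) ?_ ?_).trans (le_of_eq ?_)
  · simp only [mul_pow]
    exact (hint.comp_sub_right a).const_mul _
  · filter_upwards [fourierL2_weakDeriv (toH1 (wave a)), coeFn_ft_toH1 (wave a)] with x hx1 hx2
    rw [hx1, hx2, fourier_wave, packetAt_apply, ← hM]
    exact norm_fourier_weakDeriv_wave_le a x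
  · simp only [mul_pow]
    rw [integral_const_mul, integral_sub_right_eq_self (fun x => packet x ^ 2) a]

/-- Linear growth in the frequency is what matters: it is exactly balanced by the factor `n` that
dilations produce, so that `λₙ` decides. -/
theorem norm_toH1_wave_le (a : ℝ) :
    ‖toH1 (wave a)‖ ≤ (2 + 2 * Real.pi * |a|) * √(∫ x, packet x ^ 2) := by
  have hN : 0 ≤ ∫ x, packet x ^ 2 := integral_nonneg fun _ => sq_nonneg _
  have h2 := norm_sq_weakDeriv_wave_le a
  have h3 : 2 * Real.pi * (|a| + 1 / (16 * Real.pi)) = 2 * Real.pi * |a| + 1 / 8 := by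
    have := Real.pi_ne_zero
    field_simp
    ring
  have ha : 0 ≤ 2 * Real.pi * |a| := mul_nonneg Real.two_pi_pos.le (abs_nonneg a)
  rw [h3] at h2
  refine le_of_sq_le_sq ?_ (mul_nonneg (by linarith) (Real.sqrt_nonneg _))
  rw [H1.norm_sq, norm_fn_wave, mul_pow, Real.sq_sqrt hN]
  generalize (∫ x, packet x ^ 2) = I at *
  generalize 2 * Real.pi * |a| = t at *
  have h4 : I + (t + 1 / 8) ^ 2 * I ≤ (2 + t) ^ 2 * I := by
    have : 1 + (t + 1 / 8) ^ 2 ≤ (2 + t) ^ 2 := by nlinarith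
    calc _ = (1 + (t + 1 / 8) ^ 2) * I := by ring
      _ ≤ _ := mul_le_mul_of_nonneg_right this hN
  linarith

/-- This dictates the packet radius: `2π · 2/(16π) = 1/4` leaves another `1/4` for the shift by a
dilation inside the zone `|ξ - n| ≤ 1/2`. -/
theorem abs_sub_le_of_packet {a : ℝ} {p : ℝ × ℝ} (h1 : |p.1 - a| ≤ 1 / (16 * Real.pi))
    (h2 : |p.2| ≤ 1 / (16 * Real.pi)) :
    |2 * Real.pi * (p.1 - p.2) - 2 * Real.pi * a| ≤ 1 / 4 := by
  have hpi := Real.pi_pos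
  have e : 2 * Real.pi * (p.1 - p.2) - 2 * Real.pi * a = 2 * Real.pi * ((p.1 - a) - p.2) := by ring
  rw [e, abs_mul, abs_of_pos (by positivity)]
  have h3 := (abs_sub (p.1 - a) p.2).trans (add_le_add h1 h2)
  calc _ ≤ 2 * Real.pi * (1 / (16 * Real.pi) + 1 / (16 * Real.pi)) := by gcongr
    _ = 1 / 4 := by field_simp; norm_num

/-! ### The potential is not smooth with respect to dilations -/

namespace BumpData

variable {χ : ℝ → ℝ} {lam : ℤ → ℝ} {s c C : ℝ}

theorem im_potSymb (χ : ℝ → ℝ) (lam : ℤ → ℝ) (c k : ℝ) :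
    (potSymb χ lam c k).im = -(√(2 * Real.pi) * latticePrim lam χ (2 * Real.pi * k)) := by
  simp [potSymb, potFun]

theorem exists_lower_bound (h : BumpData χ lam s) :
    ∃ m, 0 < m ∧ ∀ (n : ℤ) (ξ : ℝ), |ξ - n| ≤ 1 / 2 → lam n * m ≤ latticeSum lam χ ξ := by
  obtain ⟨x, hx, hmin⟩ := (isCompact_closedBall (0 : ℝ) (1 / 2)).exists_isMinOn
    ⟨0, by simp⟩ h.contDiff.continuous.continuousOn
  rw [mem_closedBall_zero_iff, Real.norm_eq_abs] at hx
  refine ⟨χ x, h.pos x (by linarith), fun n ξ hξ => ?_⟩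
  refine le_trans (mul_le_mul_of_nonneg_left (hmin ?_) (h.lam_nonneg n))
    (le_latticeSum h.supp h.nonneg h.lam_nonneg n ξ)
  rwa [mem_closedBall_zero_iff, Real.norm_eq_abs]

theorem mul_sub_le_prim_sub (h : BumpData χ lam s) {x y C : ℝ} (hxy : x ≤ y)
    (hC : ∀ t ∈ Icc x y, C ≤ latticeSum lam χ t) :
    C * (y - x) ≤ latticePrim lam χ y - latticePrim lam χ x := by
  have hd : ∀ t, HasDerivAt (latticePrim lam χ) (latticeSum lam χ t) t :=
    hasDerivAt_latticePrim h.supp h.contDiff.continuous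
  refine (convex_Icc x y).mul_sub_le_image_sub_of_le_deriv
    (fun t _ => (hd t).continuousAt.continuousWithinAt)
    (fun t _ => (hd t).differentiableAt.differentiableWithinAt) (fun t ht => ?_) x
    (left_mem_Icc.2 hxy) y (right_mem_Icc.2 hxy) hxy
  rw [(hd t).deriv]
  exact hC t (interior_subset ht)

theorem prim_mono (h : BumpData χ lam s) : Monotone (latticePrim lam χ) := fun x y hxy => by
  have := h.mul_sub_le_prim_sub hxy fun t _ => latticeSum_nonneg h.nonneg h.lam_nonneg t
  linarith

theorem prim_nonneg (h : BumpData χ lam s) {x : ℝ} (hx : 0 ≤ x) : 0 ≤ latticePrim lam χ x := by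
  rw [← latticePrim_zero lam χ]
  exact h.prim_mono hx

/-- Growth of the potential in the frequency variable under dilations. -/
theorem le_prim_sub_dilate (h : BumpData χ lam s) {m : ℝ} (hm : 0 < m)
    (hlow : ∀ (n : ℤ) (ξ : ℝ), |ξ - n| ≤ 1 / 2 → lam n * m ≤ latticeSum lam χ ξ) {n : ℤ} (hn : 1 ≤ n)
    {τ : ℝ} (hτ : 0 < τ) (hτ' : τ ≤ 1 / (4 * (n + 1))) {κ : ℝ} (hκ : |κ - n| ≤ 1 / 4) :
    lam n * m * (τ / 2 * ((n + 1) / 4)) ≤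
      latticePrim lam χ κ - Real.exp (-τ) * latticePrim lam χ (Real.exp (-τ) * κ) := by
  have hn' : (1 : ℝ) ≤ n := by exact_mod_cast hn
  rw [le_div_iff₀ (by positivity)] at hτ'
  have hτ1 : τ ≤ 1 := by nlinarith
  rw [abs_le] at hκ
  set q := Real.exp (-τ)
  have hq0 : 0 < q := Real.exp_pos _
  have hq1 : 1 - τ ≤ q := by linarith [Real.add_one_le_exp (-τ)]
  have hq2 : q ≤ 1 - τ / 2 := by
    have e1 : q * Real.exp τ = 1 := by
      rw [← Real.exp_add, neg_add_cancel, Real.exp_zero]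
    have e2 : q * (1 + τ) ≤ 1 := by
      rw [← e1]
      gcongr
      linarith [Real.add_one_le_exp τ]
    by_contra hcon
    nlinarith [not_le.1 hcon]
  have hκ0 : 0 ≤ κ := by linarith
  have hqκ : q * κ ≤ κ := by nlinarith
  -- The bound on `τ` makes `κ - q κ` at most `1/4`, so all of `[q κ, κ]` stays within `1/2` of `n`.
  have hlo : n - 1 / 2 ≤ q * κ := by nlinarith
  have h1 := h.mul_sub_le_prim_sub hqκ (C := lam n * m) fun t ht => hlow n t (by
    rw [abs_le]
    constructor <;> linarith [ht.1, ht.2])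
  have h2 : q * latticePrim lam χ (q * κ) ≤ latticePrim lam χ (q * κ) :=
    mul_le_of_le_one_left (h.prim_nonneg (by positivity)) (by linarith)
  have h3 : τ / 2 * ((n + 1) / 4) ≤ κ - q * κ := by
    have : κ - q * κ = (1 - q) * κ := by ring
    rw [this]
    exact mul_le_mul (by linarith) (by linarith) (by positivity) (by linarith)
  have h4 := mul_le_mul_of_nonneg_left h3 (mul_nonneg (h.lam_nonneg n) hm.le)
  linarith

/-- Differentiability at `τ = 0` on the packet at frequency `0` gives one Lipschitz constant `D` for
all test vectors `g`. Packets at frequency `n` then bound `λₙ` uniformly in `n`. -/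
theorem not_isC1 (h : BumpData χ lam s) (hK : IsKernel s C fun p => potSymb χ lam c (p.1 - p.2))
    (hunb : ¬ BddAbove (range lam)) : ¬ IsC1 dilationOp hK.op := by
  intro hC1
  set f := toH1 (wave 0)
  have hdiff : DifferentiableAt ℝ (fun τ => evolve dilationOp hK.op τ f) 0 :=
    ((hC1 f).differentiable one_ne_zero).differentiableAt
  obtain ⟨D, hD⟩ := (hdiff.hasDerivAt.isBigO_sub).bound
  obtain ⟨δ, hδ, hball⟩ := Metric.eventually_nhds_iff.1 hD
  obtain ⟨m, hm, hlow⟩ := h.exists_lower_bound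
  set J := ∫ x, packet x
  have hJ : 0 < J := integral_packet_pos
  set N := √(∫ x, packet x ^ 2)
  have hN : 0 ≤ N := Real.sqrt_nonneg _
  set S := √(2 * Real.pi)
  have hS : 0 < S := Real.sqrt_pos.2 Real.two_pi_pos
  have hev : ∀ τ g, evolve dilationOp hK.op τ f g = kernelForm (fun p =>
      (Real.exp (-τ) : ℂ) * potSymb χ lam c (Real.exp (-τ) * (p.1 - p.2))) f g := fun τ g => by
    have e1 := hK.evolve_op h.s_nonneg flowField_id isFlow_exp τ f g
    rw [funext (evolvedKernel_id (potSymb χ lam c) τ)] at e1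
    exact e1
  have hcont : Continuous (potSymb χ lam c) := by
    have := h.continuous_potFun c
    unfold potSymb
    fun_prop
  have hpos : ∀ n : ℤ, 1 ≤ n → lam n ≤ 8 * (D * (2 * N)) / (S * m * J ^ 2) := by
    intro n hn
    have hn' : (1 : ℝ) ≤ n := by exact_mod_cast hn
    set a : ℝ := n / (2 * Real.pi)
    have ha : 2 * Real.pi * a = n := by
      have := Real.pi_ne_zero
      simp only [a]
      field_simp
    -- `δ` does not depend on `n`, while the second bound shrinks with `n`. This is harmless because
    -- both estimates below are linear in `τ`, which cancels.
    set τ := min (δ / 2) (1 / (4 * ((n : ℝ) + 1)))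
    have hτ : 0 < τ := by positivity
    have hτδ : τ < δ := (min_le_left _ _).trans_lt (half_lt_self hδ)
    set g := toH1 (wave a)
    have hup : ‖evolve dilationOp hK.op τ f g - evolve dilationOp hK.op 0 f g‖ ≤
        D * τ * ((2 + n) * N) := by
      have e1 := hball (y := τ) (by rwa [dist_zero_right, Real.norm_of_nonneg hτ.le])
      simp only [sub_zero] at e1
      rw [Real.norm_of_nonneg hτ.le] at e1
      have e2 := norm_toH1_wave_le a
      have e3 : 2 * Real.pi * |a| = n := by
        rw [abs_of_nonneg (by positivity), ha]
      rw [e3] at e2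
      exact (ContinuousLinearMap.le_opNorm
        (evolve dilationOp hK.op τ f - evolve dilationOp hK.op 0 f) g).trans
        (mul_le_mul e1 e2 (norm_nonneg _) ((norm_nonneg _).trans e1))
    have hlo : S * (lam n * m * (τ / 2 * ((n + 1) / 4))) * J ^ 2 ≤
        (evolve dilationOp hK.op τ f g - evolve dilationOp hK.op 0 f g).im := by
      have hc : ∀ τ, Continuous fun p : ℝ × ℝ =>
          (Real.exp (-τ) : ℂ) * potSymb χ lam c (Real.exp (-τ) * (p.1 - p.2)) := fun τ => by
        fun_prop
      have i1 := integrable_mul_packet (Complex.continuous_im.comp (hc τ)) a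
      have i2 := integrable_mul_packet (Complex.continuous_im.comp (hc 0)) a
      simp only [Function.comp_apply] at i1 i2
      rw [hev, hev, Complex.sub_im, im_kernelForm_wave (hc τ), im_kernelForm_wave (hc 0),
        ← integral_sub i1 i2]
      simp only [← sub_mul]
      refine le_integral_mul_packet (((Complex.continuous_im.comp (hc τ)).sub
        (Complex.continuous_im.comp (hc 0)))) fun p hp1 hp2 => ?_
      have hp := abs_sub_le_of_packet hp1 hp2
      rw [ha] at hp
      have e1 := h.le_prim_sub_dilate hm hlow hn hτ (min_le_right _ _) hp
      simp only [Pi.sub_apply, Function.comp_apply, Complex.im_ofReal_mul, im_potSymb,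
        neg_zero, Real.exp_zero, one_mul]
      have e2 := mul_le_mul_of_nonneg_left e1 hS.le
      rw [show 2 * Real.pi * (Real.exp (-τ) * (p.1 - p.2)) =
        Real.exp (-τ) * (2 * Real.pi * (p.1 - p.2)) by ring]
      linarith
    have hfin := hlo.trans ((Complex.abs_im_le_norm _).trans' (le_abs_self _) |>.trans hup)
    rw [le_div_iff₀ (by positivity)]
    have hD0 : 0 ≤ D := by
      have e1 := hball (y := τ) (by rwa [dist_zero_right, Real.norm_of_nonneg hτ.le])
      simp only [sub_zero] at e1
      rw [Real.norm_of_nonneg hτ.le] at e1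
      exact nonneg_of_mul_nonneg_left ((norm_nonneg _).trans e1) hτ
    have e4 : D * τ * ((2 + n) * N) ≤ D * τ * ((2 * (n + 1)) * N) := by
      gcongr
      linarith
    have e5 : (lam n * (S * m * J ^ 2)) * (τ * (n + 1) / 8) ≤
        (8 * (D * (2 * N))) * (τ * (n + 1) / 8) := by
      linarith
    exact le_of_mul_le_mul_right e5 (by positivity)
  refine hunb ⟨max (lam 0) (8 * (D * (2 * N)) / (S * m * J ^ 2)), ?_⟩
  rintro _ ⟨n, rfl⟩
  rcases lt_trichotomy n 0 with hn | hn | hn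
  · rw [← h.lam_even]
    exact (hpos (-n) (by omega)).trans (le_max_right _ _)
  · rw [hn]; exact le_max_left _ _
  · exact (hpos n hn).trans (le_max_right _ _)

/-! ### Failure of `Δ`-boundedness -/

theorem not_isLaplacianBounded (h : BumpData χ lam s)
    (hK : IsKernel s C fun p => potSymb χ lam c (p.1 - p.2)) (hunb : ¬ BddAbove (range lam)) :
    ¬ IsLaplacianBounded hK.op := by
  rintro ⟨b₁, b₂, hb⟩
  -- Only `V f ∈ L²` for one Schwartz function is contradicted; the norm inequality is discarded.
  obtain ⟨u, hu, -⟩ := hb (toH1 (wave 0)) _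
    (schwartz_isWeakDeriv (SchwartzMap.derivCLM ℂ ℂ (wave 0)))
  obtain ⟨m, hm, hlow⟩ := h.exists_lower_bound
  obtain ⟨n₀, hn₀, hlam⟩ : ∃ n₀ : ℤ, 1 ≤ n₀ ∧ 0 < lam n₀ := by
    by_contra! hcon
    refine hunb ⟨max (lam 0) 0, ?_⟩
    rintro _ ⟨n, rfl⟩
    rcases lt_trichotomy n 0 with hn | hn | hn
    · rw [← h.lam_even]
      exact (hcon (-n) (by omega)).trans (le_max_right _ _)
    · rw [hn]; exact le_max_left _ _
    · exact (hcon n hn).trans (le_max_right _ _)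
  have hn₀' : (1 : ℝ) ≤ n₀ := by exact_mod_cast hn₀
  set J := ∫ x, packet x
  have hJ : 0 < J := integral_packet_pos
  set N := √(∫ x, packet x ^ 2)
  have hN : 0 ≤ N := Real.sqrt_nonneg _
  set S := √(2 * Real.pi)
  have hS : 0 < S := Real.sqrt_pos.2 Real.two_pi_pos
  have hcont : Continuous (potSymb χ lam c) := by
    have := h.continuous_potFun c
    unfold potSymb
    fun_prop
  set ε := S * (lam n₀ * m) * J ^ 2
  have hε : 0 < ε := by positivity
  -- The primitive is increasing, nonnegative on the right half line, and gains at least `lam n₀ *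
  -- m` around `n₀`. All matrix elements beyond `n₀ + 1` thus exceed a fixed `ε`.
  have hlo : ∀ a, n₀ + 1 ≤ 2 * Real.pi * a → ε ≤ ‖⟪fn (toH1 (wave a)), u⟫_ℂ‖ := by
    intro a ha
    rw [← hu, hK.op_apply]
    refine le_trans ?_ ((neg_le_abs _).trans (Complex.abs_im_le_norm _))
    rw [im_kernelForm_wave hK.continuous, ← integral_neg]
    simp only [← neg_mul, im_potSymb, neg_neg]
    have hp := h.continuous_prim
    have hcp : Continuous (latticePrim lam χ) := Complex.continuous_re.comp hp
    refine le_integral_mul_packet (by fun_prop) fun p hp1 hp2 => ?_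
    have hp := abs_le.1 (abs_sub_le_of_packet hp1 hp2)
    refine mul_le_mul_of_nonneg_left ?_ hS.le
    have h1 := h.mul_sub_le_prim_sub (x := n₀ - 1 / 2) (y := n₀ + 1 / 2) (by linarith)
      (C := lam n₀ * m) fun t ht => hlow n₀ t (by
        rw [abs_le]
        constructor <;> linarith [ht.1, ht.2])
    have h2 := h.prim_nonneg (x := n₀ - 1 / 2) (by linarith)
    have h3 := h.prim_mono (show (n₀ : ℝ) + 1 / 2 ≤ 2 * Real.pi * (p.1 - p.2) by linarith)
    linarith
  -- The vector `u` is approximated by one with compactly supported transform, to which packets of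
  -- high frequency are orthogonal. The tolerance `ε / (N + 1)` makes the remaining matrix element
  -- smaller than `ε`.
  obtain ⟨f, ⟨k, -, hk2, hk3⟩, hf⟩ := Metric.dense_iff.1 dense_fourierCore u (ε / (N + 1))
    (by positivity)|>.imp fun _ => And.symm
  obtain ⟨R, hR⟩ := hk2.isCompact.isBounded.subset_closedBall 0
  set a := max ((n₀ + 1) / (2 * Real.pi)) (R + 1 / (16 * Real.pi) + 1)
  have ha1 : n₀ + 1 ≤ 2 * Real.pi * a := by
    rw [← div_le_iff₀' Real.two_pi_pos]
    exact le_max_left _ _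
  have ha2 : R + 1 / (16 * Real.pi) < a := (lt_add_one _).trans_le (le_max_right _ _)
  have h0 : ⟪fn (toH1 (wave a)), f⟫_ℂ = 0 := by
    rw [← fourierL2.inner_map_map]
    change ⟪ft (toH1 (wave a)), fourierL2 f⟫_ℂ = 0
    rw [L2.inner_def]
    refine integral_eq_zero_of_ae ?_
    filter_upwards [coeFn_ft_toH1 (wave a), hk3] with x h1 h2
    rw [h1, h2, fourier_wave, packetAt_apply]
    rcases le_or_gt |x - a| (1 / (16 * Real.pi)) with hx | hx
    · have : k x = 0 := by
        by_contra hne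
        have h3 := hR (subset_tsupport k hne)
        rw [mem_closedBall_zero_iff, Real.norm_eq_abs] at h3
        have h4 := abs_le.1 hx
        linarith [le_abs_self x]
      simp [this]
    · simp [packet_eq_zero hx]
  have h1 : ‖⟪fn (toH1 (wave a)), u⟫_ℂ‖ ≤ N * (ε / (N + 1)) := by
    have e1 : ⟪fn (toH1 (wave a)), u⟫_ℂ = ⟪fn (toH1 (wave a)), u - f⟫_ℂ := by
      rw [inner_sub_right, h0, sub_zero]
    have e2 : ‖fn (toH1 (wave a))‖ = N := norm_fn_wave a
    rw [e1, ← e2]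
    refine (norm_inner_le_norm _ _).trans (mul_le_mul_of_nonneg_left ?_ (norm_nonneg _))
    rw [e2, ← dist_eq_norm, dist_comm]
    exact (Metric.mem_ball.1 hf).le
  have h2 := (hlo a ha1).trans h1
  rw [mul_div_assoc', le_div_iff₀ (by positivity)] at h2
  nlinarith

end BumpData

end NakReg

end

theorem lemmal
    (χ : ℝ → ℝ) (hχ : ContDiff ℝ 1 χ) (hχ_supp : ∀ x, 1 < |x| → χ x = 0)
    (hχ_pos : ∀ x, |x| < 1 → 0 < χ x) (hχ_even : ∀ x, χ (-x) = χ x)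
    (lam : ℤ → ℝ) (hlam_even : ∀ n, lam (-n) = lam n) (hlam_nonneg : ∀ n, 0 ≤ lam n)
    (hlam_zero : lam 0 = 0) (hlam_unbdd : ¬ BddAbove (Set.range lam))
    (ε : ℝ) (hε : 0 < ε) (hε' : ε < 1 / 2)
    (hlam_sum : Summable fun n : ℤ => lam n * Real.sqrt (1 + (n : ℝ) ^ 2) ^ (-1 / 2 + ε)) :
    (∃ V : 𝓢'(ℝ, ℂ), NakReg.IsPotential χ lam V) ∧
    ∀ V : 𝓢'(ℝ, ℂ), NakReg.IsPotential χ lam V →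
      ∃ T : NakReg.H1 →L[ℂ] NakReg.Hm1,
        NakReg.IsMultiplicationBy V T ∧
        (NakReg.IsSymm T ∧ IsCompactOperator T) ∧
        (∀ u : ℝ → ℝ, NakReg.IsAdmissible u → NakReg.IsC11 (NakReg.conjOp u) T) ∧
        ¬ NakReg.IsC1 NakReg.dilationOp T ∧
        ¬ NakReg.IsLaplacianBounded T := by
  -- The growth exponent `s = 1/2 - ε` is nonnegative, strictly below `1/2`, and matches the
  -- summability hypothesis.
  have h : NakReg.BumpData χ lam (1 / 2 - ε) :=
    { contDiff := hχ
      supp := hχ_supp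
      pos := hχ_pos
      even := hχ_even
      lam_even := hlam_even
      lam_nonneg := hlam_nonneg
      s_nonneg := by linarith
      s_lt := by linarith
      summable := by
        rw [show -(1 / 2 - ε) = -1 / 2 + ε by ring]
        exact hlam_sum }
  refine ⟨h.exists_isPotential, fun V hV => ?_⟩
  obtain ⟨c, hc⟩ := h.exists_potFun hV
  obtain ⟨B, w₁, w₂, hw⟩ := h.exists_isSymbol c
  have hK := hw.isKernel h.s_nonneg h.s_lt
  refine ⟨hK.op, NakReg.isMultiplicationBy_op hc (fun k => rfl) hK,
    ⟨NakReg.isSymm_op (h.potSymb_neg c) hK, hK.isCompactOperator_op⟩, fun u hu => ?_,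
    h.not_isC1 hK hlam_unbdd, h.not_isLaplacianBounded hK hlam_unbdd⟩
  obtain ⟨L, M, hv, hM⟩ := hu.flowField
  exact hw.isC11 h.s_nonneg h.s_lt hv hM
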